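/- Let $\Phi$ be a Young function: $\Phi(u)=\int_0^u\varphi(t)\,dt$ for $u\ge 0$, where $\varphi(0)=0$, $\varphi(t)>0$ for $t>0$, $\varphi$ is nondecreasing and right continuous on $[0,\infty)$, $\varphi(t)\to\infty$ as $t\to\infty$, and there is $a>1$ with $u\varphi(u)<a\,\Phi(u)$ for all $u>0$. For an open set $\Omega\subset\mathbb{R}^n$, let $L_\Phi(\Omega)$ be the space of measurable $u:\Omega\to\mathbb{R}$ with $\int_\Omega\Phi(|u|)\,dx<\infty$, with the Luxemburg norm $\|u\|_{\Phi,\Omega}=\inf\{\lambda>0:\int_\Omega\Phi(|u|/\lambda)\,dx\le 1\}$, and let $W^1_\Phi(\Omega)$ be the Orlicz–Sobolev space of all $u\in L_\Phi(\Omega)$ whose weak first-order partial derivatives belong to $L_\Phi(\Omega)$. Let $c^1_f,c^2_f>0$. Denote by $\mathcal{F}=\mathcal{F}(c^1_f,c^2_f,\Phi)$ the class of all functionals $F(u,\Omega)\in\overline{\mathbb{R}}$, defined for open sets $\Omega\subset\mathbb{R}^n$ of finite measure and $u\in L_\Phi(\Omega)$, of the form $$F(u,\Omega)=\int_\Omega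 f(x,Du(x))\,dx\ \text{ if } u\in W^1_\Phi(\Omega),\qquad F(u,\Omega)=+\infty\ \text{ if } u\in L_\Phi(\Omega)\setminus W^1_\Phi(\Omega),$$ where $f:\mathbb{R}^n\times\mathbb{R}^n\to\mathbb{R}$ is measurable in $x$ for every $p$, continuous in $p$ for almost every $x$, convex in $p$, and satisfies $c^1_f\Phi(|p|)\le f(x,p)\le c^2_f(1+\Phi(|p|))$ for all $(x,p)\in\mathbb{R}^n\times\mathbb{R}^n$. Functionals $G_k:L_\Phi(\Omega)\to\overline{\mathbb{R}}$ are said to $\Gamma(L_\Phi)$-converge to $G:L_\Phi(\Omega)\to\overline{\mathbb{R}}$ if for every $u\in L_\Phi(\Omega)$: (i) $G(u)\le\liminf_k G_k(u_k)$ for every sequence $u_k\to u$ in $L_\Phi(\Omega)$; (ii) there is a sequence $u_k\to u$ in $L_\Phi(\Omega)$ with $\limsup_k G_k(u_k)\le G(u)$. Then $\mathcal{F}$ is compact for $\Gamma(L_\Phi)$-convergence: every sequence $(F_k)$ in $\mathcal{F}$ has a subsequence $(F_{k_j})$ and there is $F\in\mathcal{F}$ such that, for every open set $\Omega\subset\mathbb{R}^n$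 of finite measure, $F_{k_j}(\cdot,\Omega)$ $\Gamma(L_\Phi)$-converges to $F(\cdot,\Omega)$ as $j\to\infty$. -/

import Mathlib

open MeasureTheory Filter Set
open scoped Topology ENNReal ContDiff

/-- `Φ` is a Young function (an `N`-function of class `Δ₂`) on `[0, ∞)`: `Φ u = ∫₀ᵘ φ` with `φ 0 = 0`,
`φ > 0` on `(0, ∞)`, `φ` nondecreasing and right continuous on `[0, ∞)`, `φ t → ∞`, and
`u φ(u) < a Φ(u)` for a constant `a > 1` and all `u > 0` (this yields `Φ (2 u) ≤ 2 ^ a Φ u`).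
Only the values of `Φ` and `φ` on `[0, ∞)` matter. -/
def IsYoungFunction (Φ : ℝ → ℝ) : Prop :=
  ∃ φ : ℝ → ℝ,
    φ 0 = 0 ∧
    (∀ t : ℝ, 0 < t → 0 < φ t) ∧
    MonotoneOn φ (Ici 0) ∧
    (∀ t : ℝ, 0 ≤ t → ContinuousWithinAt φ (Ici t) t) ∧
    Tendsto φ atTop atTop ∧
    (∀ u : ℝ, 0 ≤ u → Φ u = ∫ t in (0 : ℝ)..u, φ t) ∧
    ∃ a : ℝ, 1 < a ∧ ∀ u : ℝ, 0 < u → u * φ u < a * Φ u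

/-- `u ∈ L_Φ(Ω)`: `u` is measurable on `Ω` and `∫_Ω Φ(|u|) dx < ∞`. -/
def MemOrlicz {n : ℕ} (Φ : ℝ → ℝ) (Ω : Set (EuclideanSpace ℝ (Fin n)))
    (u : EuclideanSpace ℝ (Fin n) → ℝ) : Prop :=
  AEStronglyMeasurable u (volume.restrict Ω) ∧ ∫⁻ x in Ω, ENNReal.ofReal (Φ |u x|) < ⊤

/-- The Luxemburg norm `inf {l > 0 : ∫_Ω Φ(|u| / l) dx ≤ 1}` (with `inf ∅ = ∞`). -/
noncomputable def luxemburgNorm {n : ℕ} (Φ : ℝ → ℝ) (Ω : Set (EuclideanSpace ℝ (Fin n)))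
    (u : EuclideanSpace ℝ (Fin n) → ℝ) : ℝ≥0∞ :=
  ⨅ (l : ℝ) (_ : 0 < l ∧ ∫⁻ x in Ω, ENNReal.ofReal (Φ (|u x| / l)) ≤ 1), ENNReal.ofReal l

/-- `g` is the weak partial derivative `∂u/∂xᵢ` in the open set `Ω`, tested on `C_c^∞(Ω)`. -/
def HasWeakPartialDeriv {n : ℕ} (Ω : Set (EuclideanSpace ℝ (Fin n))) (i : Fin n)
    (u g : EuclideanSpace ℝ (Fin n) → ℝ) : Prop :=
  LocallyIntegrableOn u Ω ∧ LocallyIntegrableOn g Ω ∧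
  ∀ ψ : EuclideanSpace ℝ (Fin n) → ℝ, ContDiff ℝ ∞ ψ → HasCompactSupport ψ → tsupport ψ ⊆ Ω →
    ∫ x in Ω, u x * fderiv ℝ ψ x (EuclideanSpace.single i (1 : ℝ)) = - ∫ x in Ω, g x * ψ x

/-- `u ∈ W¹_Φ(Ω)` with weak gradient `Du = v`: `u` and all its weak first order partial derivatives,
the components of `v`, lie in `L_Φ(Ω)`. -/
def HasOrliczGradient {n : ℕ} (Φ : ℝ → ℝ) (Ω : Set (EuclideanSpace ℝ (Fin n)))
    (u : EuclideanSpace ℝ (Fin n) → ℝ)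
    (v : EuclideanSpace ℝ (Fin n) → EuclideanSpace ℝ (Fin n)) : Prop :=
  MemOrlicz Φ Ω u ∧
  ∀ i : Fin n, MemOrlicz Φ Ω (fun x => v x i) ∧ HasWeakPartialDeriv Ω i u (fun x => v x i)

/-- `u` belongs to the Orlicz-Sobolev space `W¹_Φ(Ω)`. -/
def MemOrliczSobolev {n : ℕ} (Φ : ℝ → ℝ) (Ω : Set (EuclideanSpace ℝ (Fin n)))
    (u : EuclideanSpace ℝ (Fin n) → ℝ) : Prop :=
  ∃ v : EuclideanSpace ℝ (Fin n) → EuclideanSpace ℝ (Fin n), HasOrliczGradient Φ Ω u v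

/-- The admissible integrands `f(x, p)`: (Lebesgue) measurable in `x`, continuous in `p` for almost
every `x`, convex in `p`, and `c₁ Φ(|p|) ≤ f(x, p) ≤ c₂ (1 + Φ(|p|))`. -/
structure IsConvexIntegrand {n : ℕ} (c₁ c₂ : ℝ) (Φ : ℝ → ℝ)
    (f : EuclideanSpace ℝ (Fin n) → EuclideanSpace ℝ (Fin n) → ℝ) : Prop where
  continuous : ∀ᵐ x, Continuous (f x)
  measurable : ∀ p, AEMeasurable (fun x => f x p) volume
  convex : ∀ x, ConvexOn ℝ univ (f x)
  lower : ∀ x p, c₁ * Φ ‖p‖ ≤ f x p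
  upper : ∀ x p, f x p ≤ c₂ * (1 + Φ ‖p‖)

/-- The class `𝓕(c₁, c₂, Φ)` of functionals `F(u, Ω)`, for `Ω ⊆ ℝⁿ` open of finite measure and
`u ∈ L_Φ(Ω)`, with `F(u, Ω) = ∫_Ω f(x, Du(x)) dx` if `u ∈ W¹_Φ(Ω)` and `F(u, Ω) = +∞` otherwise,
for an admissible integrand `f`, the same for all `Ω` and `u`.
(The weak gradient is unique almost everywhere, and `f ≥ 0`.) -/
def convexFunctionalClass (n : ℕ) (c₁ c₂ : ℝ) (Φ : ℝ → ℝ) :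
    Set ((EuclideanSpace ℝ (Fin n) → ℝ) → Set (EuclideanSpace ℝ (Fin n)) → EReal) :=
  {F | ∃ f : EuclideanSpace ℝ (Fin n) → EuclideanSpace ℝ (Fin n) → ℝ,
    IsConvexIntegrand c₁ c₂ Φ f ∧
    ∀ Ω : Set (EuclideanSpace ℝ (Fin n)), IsOpen Ω → volume Ω < ⊤ →
      ∀ u : EuclideanSpace ℝ (Fin n) → ℝ, MemOrlicz Φ Ω u →
        (∀ v : EuclideanSpace ℝ (Fin n) → EuclideanSpace ℝ (Fin n), HasOrliczGradient Φ Ω u v →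
          F u Ω = ((∫⁻ x in Ω, ENNReal.ofReal (f x (v x)) : ℝ≥0∞) : EReal)) ∧
        (¬ MemOrliczSobolev Φ Ω u → F u Ω = ⊤)}

/-- Norm convergence `w k → u` of a sequence in `L_Φ(Ω)`. -/
def TendstoOrlicz {n : ℕ} (Φ : ℝ → ℝ) (Ω : Set (EuclideanSpace ℝ (Fin n)))
    (w : ℕ → EuclideanSpace ℝ (Fin n) → ℝ) (u : EuclideanSpace ℝ (Fin n) → ℝ) : Prop :=
  (∀ k, MemOrlicz Φ Ω (w k)) ∧
    Tendsto (fun k => luxemburgNorm Φ Ω (fun x => w k x - u x)) atTop (𝓝 0)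

/-- `G k` `Γ(L_Φ(Ω))`-converges to `G₀`: the liminf inequality along every sequence converging in
`L_Φ(Ω)`, and the existence of a recovery sequence, at every `u ∈ L_Φ(Ω)`. -/
def OrliczGammaConverges {n : ℕ} (Φ : ℝ → ℝ) (Ω : Set (EuclideanSpace ℝ (Fin n)))
    (G : ℕ → (EuclideanSpace ℝ (Fin n) → ℝ) → EReal)
    (G₀ : (EuclideanSpace ℝ (Fin n) → ℝ) → EReal) : Prop :=
  ∀ u : EuclideanSpace ℝ (Fin n) → ℝ, MemOrlicz Φ Ω u →
    (∀ w : ℕ → EuclideanSpace ℝ (Fin n) → ℝ, TendstoOrlicz Φ Ω w u →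
      G₀ u ≤ liminf (fun k => G k (w k)) atTop) ∧
    ∃ w : ℕ → EuclideanSpace ℝ (Fin n) → ℝ, TendstoOrlicz Φ Ω w u ∧
      limsup (fun k => G k (w k)) atTop ≤ G₀ u

/-! The integrand of the limit is built from `Γ`-limits at linear functions on dyadic cubes. For a
slope `p`, a cube and a radius `1 / (l + 1)`, the infimum of the `k`-th energy over functions within
that modular distance of `x ↦ p · x` is a point of `[0, ∞]`. Restricting `p` to a countable dense
set leaves countably many such sequences, so compactness of a countable product makes all of them
converge along one subsequence (`exists_subseq_hasCellLimits`).

For these slopes the limit values are additive under subdivision of a cube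
(`HasCellLimits.sum_children`). Superadditivity comes from restricting competitors. Subadditivity
comes from gluing: a near-optimal competitor can be cut off so that it differs from the given
function by a corrector vanishing outside the cube, at small cost (`GammaUpper.exists_corrector`,
`exists_glued_corrector`). The averages of an additive function with bounded density form a bounded
martingale, whose limit is a density (`setLIntegral_limsup_dyadicAverage`). Taking the limsup of the
averages defines the integrand at every `x` and `p`, and convexity and the growth bounds pass to it
without exceptional sets; the lower bound with the same `c₁` uses semicontinuity of the modular
(`modular_linear_le`).

To reach a general `u` in `W¹_Φ`, only the field `Du` is approximated, never `u` itself. Up to a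
small error in modular, `Du` is constant on finitely many dyadic cubes, with dense-set values `p_z`
(`InOrlicz.exists_dyadic_approx`). Convexity and the doubling property make the energies uniformly
continuous in the field on modular-bounded sets, uniformly in `k`
(`IsYoungFunction.exists_fieldEnergy_add_le`). For the lower bound, a competitor `w` near `u` is
transplanted to the competitor `p_z · x + (w - u)` on each cube; for the upper bound, the correctors
of the linear functions are added to `u` (`gammaLower_limitIntegrand`, `gammaUpper_limitIntegrand`).

Outside `W¹_Φ` the limit is infinite: bounded energies bound the gradients in modular, hence give
weak `L¹` limits that stay in `L_Φ` and are the weak gradient (`memOrliczSobolev_of_tendsto`). -/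

/-! ### Elementary properties of Young functions -/

namespace IsYoungFunction

variable {Φ : ℝ → ℝ}

/-- A monotone nonnegative selection of slopes of supporting lines. -/
theorem exists_slope (hΦ : IsYoungFunction Φ) : ∃ s : ℝ → ℝ, Monotone s ∧ (∀ t, 0 ≤ s t) ∧
    (∀ t, 0 < t → 0 < s t) ∧ Tendsto s atTop atTop ∧
    (∀ t₀ t, 0 ≤ t₀ → 0 ≤ t → Φ t₀ + s t₀ * (t - t₀) ≤ Φ t) ∧
    Φ 0 = 0 ∧ ∃ a : ℝ, 1 < a ∧ ∀ u : ℝ, 0 < u → u * s u < a * Φ u := by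
  obtain ⟨φ, h0, hpos, hmono, -, htop, hint, a, ha, hdel⟩ := hΦ
  have hnn : ∀ t, 0 ≤ t → 0 ≤ φ t := fun t ht => by
    rcases ht.eq_or_lt with rfl | h
    · exact h0.ge
    · exact (hpos t h).le
  have hii : ∀ p q : ℝ, 0 ≤ p → 0 ≤ q → IntervalIntegrable φ volume p q := fun p q hp hq =>
    (hmono.mono (by
      intro x hx
      exact (le_inf hp hq).trans hx.1)).intervalIntegrable
  -- Precomposing with `max t 0` makes the slope monotone and nonnegative on all of `ℝ`, since `φ`
  -- is unconstrained on the negative axis.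
  refine ⟨fun t => φ (max t 0), ?_, fun t => hnn _ (le_max_right _ _), ?_, ?_, ?_, ?_, a, ha, ?_⟩
  · intro x y hxy
    exact hmono (mem_Ici.2 (le_max_right _ _)) (mem_Ici.2 (le_max_right _ _)) (max_le_max_right _ hxy)
  · intro t ht
    exact hpos _ (lt_max_of_lt_left ht)
  · refine htop.congr' ?_
    filter_upwards [eventually_ge_atTop 0] with t ht
    rw [max_eq_left ht]
  · intro t₀ t h₀ h
    simp only [max_eq_left h₀]
    have hdiff : Φ t - Φ t₀ = ∫ r in t₀..t, φ r := by
      rw [hint t h, hint t₀ h₀, intervalIntegral.integral_interval_sub_left (hii _ _ le_rfl h)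
        (hii _ _ le_rfl h₀)]
    rcases le_total t₀ t with htt | htt
    · have := intervalIntegral.integral_mono_on (μ := volume) htt
        (intervalIntegrable_const (c := φ t₀)) (hii t₀ t h₀ h)
        (fun x hx => hmono h₀ (h₀.trans hx.1) hx.1)
      rw [intervalIntegral.integral_const, smul_eq_mul] at this
      linarith
    · have := intervalIntegral.integral_mono_on (μ := volume) htt (hii t t₀ h h₀)
        (intervalIntegrable_const (c := φ t₀))
        (fun x hx => hmono (h.trans hx.1) h₀ hx.2)
      rw [intervalIntegral.integral_const, smul_eq_mul] at this
      rw [intervalIntegral.integral_symm] at hdiff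
      linarith
  · rw [hint 0 le_rfl]; simp
  · intro u hu
    simpa [max_eq_left hu.le] using hdel u hu

theorem map_zero (hΦ : IsYoungFunction Φ) : Φ 0 = 0 := by
  obtain ⟨s, -, -, -, -, -, h, -⟩ := hΦ.exists_slope
  exact h

theorem monotoneOn (hΦ : IsYoungFunction Φ) : MonotoneOn Φ (Ici 0) := by
  obtain ⟨s, -, hs, -, -, h, -⟩ := hΦ.exists_slope
  intro x hx y hy hxy
  have := h x y hx hy
  nlinarith [hs x, mul_nonneg (hs x) (sub_nonneg.2 hxy)]

theorem nonneg (hΦ : IsYoungFunction Φ) {t : ℝ} (ht : 0 ≤ t) : 0 ≤ Φ t := by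
  have := hΦ.monotoneOn (mem_Ici.2 le_rfl) (mem_Ici.2 ht) ht
  rwa [hΦ.map_zero] at this

theorem mono (hΦ : IsYoungFunction Φ) {s t : ℝ} (hs : 0 ≤ s) (h : s ≤ t) : Φ s ≤ Φ t :=
  hΦ.monotoneOn (mem_Ici.2 hs) (mem_Ici.2 (hs.trans h)) h

theorem convexOn (hΦ : IsYoungFunction Φ) : ConvexOn ℝ (Ici 0) Φ := by
  obtain ⟨s, -, -, -, -, h, -⟩ := hΦ.exists_slope
  refine ⟨convex_Ici 0, ?_⟩
  intro x hx y hy a b ha hb hab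
  have hz : 0 ≤ a * x + b * y := add_nonneg (mul_nonneg ha hx) (mul_nonneg hb hy)
  simp only [smul_eq_mul]
  have h1 := mul_le_mul_of_nonneg_left (h (a * x + b * y) x hz hx) ha
  have h2 := mul_le_mul_of_nonneg_left (h (a * x + b * y) y hz hy) hb
  have h3 : a * (x - (a * x + b * y)) + b * (y - (a * x + b * y)) = 0 := by
    have : b = 1 - a := by linarith
    subst this; ring
  have h4 : (a + b) * Φ (a * x + b * y) = Φ (a * x + b * y) := by rw [hab, one_mul]
  have h5 : a * (s (a * x + b * y) * (x - (a * x + b * y))) +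
      b * (s (a * x + b * y) * (y - (a * x + b * y))) = 0 := by
    rw [← mul_zero (s (a * x + b * y)), ← h3]; ring
  nlinarith

theorem map_mul_le (hΦ : IsYoungFunction Φ) {l t : ℝ} (hl : 0 ≤ l) (hl1 : l ≤ 1) (ht : 0 ≤ t) :
    Φ (l * t) ≤ l * Φ t := by
  have := hΦ.convexOn.2 (mem_Ici.2 ht) (mem_Ici.2 le_rfl) hl (sub_nonneg.2 hl1) (by ring)
  simpa [hΦ.map_zero] using this

theorem pos (hΦ : IsYoungFunction Φ) {t : ℝ} (ht : 0 < t) : 0 < Φ t := by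
  obtain ⟨s, -, -, hs, -, h, h0, -⟩ := hΦ.exists_slope
  have h1 := h (t / 2) t (by linarith) ht.le
  have h2 := hs (t / 2) (by linarith)
  have h3 := hΦ.nonneg (t := t / 2) (by linarith)
  nlinarith [mul_pos h2 ht]

/-- Take the supporting line at a point `r` where the slope is at least `2 |M|`; for `t ≥ 2 r` one
has `t - r ≥ t / 2`. -/
theorem superlinear (hΦ : IsYoungFunction Φ) (M : ℝ) : ∃ R : ℝ, 0 ≤ R ∧ ∀ t, R ≤ t → M * t ≤ Φ t := by
  obtain ⟨s, -, -, -, htop, h, h0, -⟩ := hΦ.exists_slope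
  obtain ⟨r, hr0, hr⟩ := ((eventually_ge_atTop (0 : ℝ)).and
    (htop.eventually_ge_atTop (2 * |M|))).exists
  refine ⟨2 * r, by linarith, fun t ht => ?_⟩
  have ht0 : 0 ≤ t := by linarith
  have h1 := h r t hr0 ht0
  have h2 := hΦ.nonneg hr0
  have h3 : 2 * |M| * (t - r) ≤ s r * (t - r) := mul_le_mul_of_nonneg_right hr (by linarith)
  have h4 : |M| * t ≤ 2 * |M| * (t - r) := by nlinarith [abs_nonneg M]
  nlinarith [le_abs_self M, mul_le_mul_of_nonneg_right (le_abs_self M) ht0]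

/-- This is the `Δ₂` property. The supporting line at `u`, evaluated at `θ u` with `θ = 1 - 1 / (2
a)`, loses only `u s(u) / (2 a) ≤ Φ(u) / 2`, so `Φ(u) ≤ 2 Φ(θ u)`. Iterating until `θ ^ N * l ≤ 1`
gives the constant `2 ^ N`. -/
theorem exists_scale (hΦ : IsYoungFunction Φ) {l : ℝ} (hl : 0 ≤ l) :
    ∃ C : ℝ, 1 ≤ C ∧ ∀ u, 0 ≤ u → Φ (l * u) ≤ C * Φ u := by
  obtain ⟨s, -, hs0, -, -, h, h0, a, ha, hdel⟩ := hΦ.exists_slope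
  have hth0 : (0 : ℝ) < 1 - 1 / (2 * a) := by
    have : 1 / (2 * a) < 1 := by rw [div_lt_one (by linarith)]; linarith
    linarith
  have hth1 : (1 : ℝ) - 1 / (2 * a) < 1 := by
    have : (0 : ℝ) < 1 / (2 * a) := by positivity
    linarith
  set θ : ℝ := 1 - 1 / (2 * a) with hθ
  have step : ∀ u, 0 ≤ u → Φ u ≤ 2 * Φ (θ * u) := by
    intro u hu
    rcases hu.eq_or_lt with rfl | hu
    · simp [h0]
    have h1 := h u (θ * u) hu.le (by positivity)
    have h2 := hdel u hu
    have h3 : s u * (θ * u - u) = - (u * s u) / (2 * a) := by rw [hθ]; field_simp; ring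
    rw [h3] at h1
    have h4 : u * s u / (2 * a) ≤ Φ u / 2 := by
      rw [div_le_div_iff₀ (by linarith) two_pos]; nlinarith
    rw [neg_div] at h1
    linarith
  have iter : ∀ N : ℕ, ∀ u, 0 ≤ u → Φ u ≤ 2 ^ N * Φ (θ ^ N * u) := by
    intro N
    induction N with
    | zero => intro u _; simp
    | succ N ih =>
      intro u hu
      calc Φ u ≤ 2 ^ N * Φ (θ ^ N * u) := ih u hu
        _ ≤ 2 ^ N * (2 * Φ (θ * (θ ^ N * u))) := by gcongr; exact step _ (by positivity)
        _ = 2 ^ (N + 1) * Φ (θ ^ (N + 1) * u) := by rw [pow_succ, pow_succ]; ring_nf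
  obtain ⟨N, hN⟩ := exists_pow_lt_of_lt_one (show (0 : ℝ) < 1 / (|l| + 1) by positivity) hth1
  refine ⟨2 ^ N, one_le_pow₀ (by norm_num), fun u hu => ?_⟩
  refine (iter N (l * u) (by positivity)).trans ?_
  gcongr
  refine hΦ.mono (by positivity) ?_
  rw [← mul_assoc]
  have : θ ^ N * l ≤ 1 := by
    rw [abs_of_nonneg hl, lt_div_iff₀ (by positivity)] at hN
    nlinarith [pow_pos hth0 N]
  nlinarith

theorem exists_doubling (hΦ : IsYoungFunction Φ) :
    ∃ D : ℝ, 1 ≤ D ∧ ∀ s t, 0 ≤ s → 0 ≤ t → Φ (s + t) ≤ D * (Φ s + Φ t) := by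
  obtain ⟨D, hD, h⟩ := hΦ.exists_scale (l := 2) two_pos.le
  refine ⟨D, hD, fun s t hs ht => ?_⟩
  have hs' := hΦ.nonneg hs
  have ht' := hΦ.nonneg ht
  rcases le_total s t with hst | hst
  · have h1 := hΦ.mono (add_nonneg hs ht) (show s + t ≤ 2 * t by linarith)
    nlinarith [h t ht]
  · have h1 := hΦ.mono (add_nonneg hs ht) (show s + t ≤ 2 * s by linarith)
    nlinarith [h s hs]

theorem measurable_norm {F : Type*} [NormedAddCommGroup F] [MeasurableSpace F]
    [OpensMeasurableSpace F] (hΦ : IsYoungFunction Φ) : Measurable fun p : F => Φ ‖p‖ := by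
  have h : Monotone fun t : ℝ => Φ (max t 0) := fun s t hst =>
    hΦ.mono (le_max_right _ _) (max_le_max_right _ hst)
  have h' := h.measurable.comp (_root_.measurable_norm : Measurable fun p : F => ‖p‖)
  have e : (fun p : F => Φ ‖p‖) = (fun t : ℝ => Φ (max t 0)) ∘ fun p : F => ‖p‖ := by
    ext p
    simp
  rw [e]
  exact h'

theorem exists_le_add (hΦ : IsYoungFunction Φ) :
    ∃ R : ℝ, 0 ≤ R ∧ ∀ t, 0 ≤ t → t ≤ R + Φ t := by
  obtain ⟨R, hR, h⟩ := hΦ.superlinear 1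
  refine ⟨R, hR, fun t ht => ?_⟩
  rcases le_total R t with h' | h'
  · linarith [h t h']
  · linarith [hΦ.nonneg ht]

theorem norm_convex_comb_le {F : Type*} [NormedAddCommGroup F] [NormedSpace ℝ F]
    (hΦ : IsYoungFunction Φ) {a b : ℝ} (ha : 0 ≤ a) (hb : 0 ≤ b) (hab : a + b = 1) (p q : F) :
    Φ ‖a • p + b • q‖ ≤ a * Φ ‖p‖ + b * Φ ‖q‖ := by
  have h1 : ‖a • p + b • q‖ ≤ a * ‖p‖ + b * ‖q‖ := by
    refine (norm_add_le _ _).trans ?_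
    rw [norm_smul, norm_smul, Real.norm_of_nonneg ha, Real.norm_of_nonneg hb]
  refine (hΦ.mono (norm_nonneg _) h1).trans ?_
  exact hΦ.convexOn.2 (mem_Ici.2 (norm_nonneg p)) (mem_Ici.2 (norm_nonneg q)) ha hb hab

end IsYoungFunction

/-! ### Modular convergence and Luxemburg norm convergence -/

section Modular

variable {n : ℕ} {Φ : ℝ → ℝ} {Ω : Set (EuclideanSpace ℝ (Fin n))}

/-- The modular `∫_Ω Φ(|u|)` of a scalar or vector function. -/
noncomputable def orliczModular {n : ℕ} {F : Type*} [Norm F] (Φ : ℝ → ℝ)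
    (Ω : Set (EuclideanSpace ℝ (Fin n))) (u : EuclideanSpace ℝ (Fin n) → F) : ℝ≥0∞ :=
  ∫⁻ x in Ω, ENNReal.ofReal (Φ ‖u x‖)

theorem orliczModular_mono_set {F : Type*} [Norm F] {A B : Set (EuclideanSpace ℝ (Fin n))}
    (h : A ⊆ B) (u : EuclideanSpace ℝ (Fin n) → F) :
    orliczModular Φ A u ≤ orliczModular Φ B u :=
  lintegral_mono_set h

/-- Convexity and `Φ 0 = 0` give `Φ(|u|) ≤ l Φ(|u| / l)` for `l ≤ 1`. -/
theorem orliczModular_le_luxemburgNorm (hΦ : IsYoungFunction Φ)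
    (u : EuclideanSpace ℝ (Fin n) → ℝ) {r : ℝ} (hr : r ≤ 1)
    (h : luxemburgNorm Φ Ω u < ENNReal.ofReal r) : orliczModular Φ Ω u ≤ ENNReal.ofReal r := by
  simp only [luxemburgNorm, iInf_lt_iff] at h
  obtain ⟨l, ⟨hl, hl1⟩, hlr⟩ := h
  have hlr' : l < r := (ENNReal.ofReal_lt_ofReal_iff_of_nonneg hl.le).1 hlr
  calc orliczModular Φ Ω u
      ≤ ∫⁻ x in Ω, ENNReal.ofReal l * ENNReal.ofReal (Φ (|u x| / l)) := by
        refine lintegral_mono fun x => ?_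
        rw [← ENNReal.ofReal_mul hl.le]
        refine ENNReal.ofReal_le_ofReal ?_
        have := hΦ.map_mul_le hl.le (hlr'.le.trans hr) (div_nonneg (abs_nonneg (u x)) hl.le)
        rwa [mul_div_cancel₀ _ hl.ne'] at this
    _ = ENNReal.ofReal l * ∫⁻ x in Ω, ENNReal.ofReal (Φ (|u x| / l)) :=
        lintegral_const_mul' _ _ ENNReal.ofReal_ne_top
    _ ≤ ENNReal.ofReal l * 1 := by gcongr
    _ ≤ ENNReal.ofReal r := by rw [mul_one]; exact hlr.le

theorem exists_ofReal_scale_le (hΦ : IsYoungFunction Φ) {l : ℝ} (hl : 0 ≤ l) :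
    ∃ C : ℝ, 1 ≤ C ∧ ∀ t, 0 ≤ t → ENNReal.ofReal (Φ (l * t)) ≤ ENNReal.ofReal C * ENNReal.ofReal (Φ t) := by
  obtain ⟨C, hC, h⟩ := hΦ.exists_scale hl
  refine ⟨C, hC, fun t ht => ?_⟩
  rw [← ENNReal.ofReal_mul (by linarith)]
  exact ENNReal.ofReal_le_ofReal (h t ht)

/-- The doubling property bounds `Φ(t / l)` by a multiple of `Φ(t)`; the resulting `δ` depends on
`l` alone. -/
theorem exists_luxemburgNorm_le (hΦ : IsYoungFunction Φ) {l : ℝ} (hl : 0 < l) :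
    ∃ δ : ℝ≥0∞, 0 < δ ∧ ∀ (Ω : Set (EuclideanSpace ℝ (Fin n))) (u : EuclideanSpace ℝ (Fin n) → ℝ),
      orliczModular Φ Ω u ≤ δ → luxemburgNorm Φ Ω u ≤ ENNReal.ofReal l := by
  obtain ⟨C, hC, h⟩ := exists_ofReal_scale_le hΦ (inv_nonneg.2 hl.le)
  refine ⟨(ENNReal.ofReal C)⁻¹, ENNReal.inv_pos.2 ENNReal.ofReal_ne_top, fun Ω u hu => ?_⟩
  refine iInf₂_le l ⟨hl, ?_⟩
  calc ∫⁻ x in Ω, ENNReal.ofReal (Φ (|u x| / l))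
      ≤ ∫⁻ x in Ω, ENNReal.ofReal C * ENNReal.ofReal (Φ |u x|) := by
        refine lintegral_mono fun x => ?_
        simpa only [div_eq_inv_mul] using h _ (abs_nonneg (u x))
    _ = ENNReal.ofReal C * orliczModular Φ Ω u := lintegral_const_mul' _ _ ENNReal.ofReal_ne_top
    _ ≤ ENNReal.ofReal C * (ENNReal.ofReal C)⁻¹ := by gcongr
    _ ≤ 1 := ENNReal.mul_inv_le_one _

/-- Convexity gives one direction and doubling the other. The whole argument can then be run with
modulars, which are integrals and add over disjoint sets. -/
theorem tendsto_luxemburgNorm_iff (hΦ : IsYoungFunction Φ) {ι : Type*} {l : Filter ι}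
    (u : ι → EuclideanSpace ℝ (Fin n) → ℝ) :
    Tendsto (fun k => luxemburgNorm Φ Ω (u k)) l (𝓝 0) ↔
      Tendsto (fun k => orliczModular Φ Ω (u k)) l (𝓝 0) := by
  simp only [ENNReal.tendsto_nhds_zero]
  constructor
  · intro h ε hε
    obtain ⟨r, hr0, hr⟩ : ∃ r : ℝ, 0 < r ∧ ENNReal.ofReal r ≤ ε ∧ r ≤ 1 := by
      rcases eq_or_ne ε ⊤ with rfl | hne
      · exact ⟨1, one_pos, le_top, le_rfl⟩
      · refine ⟨min ε.toReal 1, lt_min (ENNReal.toReal_pos hε.ne' hne) one_pos, ?_, min_le_right _ _⟩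
        exact (ENNReal.ofReal_le_ofReal (min_le_left _ _)).trans ENNReal.ofReal_toReal_le
    have hr2 : (0 : ℝ≥0∞) < ENNReal.ofReal (r / 2) := ENNReal.ofReal_pos.2 (by linarith)
    filter_upwards [h _ hr2] with k hk
    refine (orliczModular_le_luxemburgNorm hΦ (u k) hr.2 (hk.trans_lt ?_)).trans hr.1
    exact (ENNReal.ofReal_lt_ofReal_iff hr0).2 (by linarith)
  · intro h ε hε
    obtain ⟨r, hr0, hr⟩ : ∃ r : ℝ, 0 < r ∧ ENNReal.ofReal r ≤ ε := by
      rcases eq_or_ne ε ⊤ with rfl | hne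
      · exact ⟨1, one_pos, le_top⟩
      · exact ⟨ε.toReal, ENNReal.toReal_pos hε.ne' hne, ENNReal.ofReal_toReal_le⟩
    obtain ⟨δ, hδ, hδ'⟩ := exists_luxemburgNorm_le (n := n) hΦ hr0
    filter_upwards [h δ hδ] with k hk
    exact (hδ' Ω (u k) hk).trans hr

end Modular

/-- Euclidean space of dimension `n`. -/
abbrev Euc (n : ℕ) := EuclideanSpace ℝ (Fin n)

/-! ### Calculus of modulars for scalar and vector functions -/

section ModularCalculus

variable {n : ℕ} {Φ : ℝ → ℝ} {Ω : Set (Euc n)}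

theorem IsYoungFunction.aemeasurable_ofReal_norm {F : Type*} [NormedAddCommGroup F]
    [MeasurableSpace F] [BorelSpace F] (hΦ : IsYoungFunction Φ)
    {α : Type*} [MeasurableSpace α] {μ : Measure α} {u : α → F} (hu : AEStronglyMeasurable u μ) :
    AEMeasurable (fun x => ENNReal.ofReal (Φ ‖u x‖)) μ :=
  ((hΦ.measurable_norm (F := ℝ)).comp_aemeasurable
    (hu.norm.aemeasurable)).ennreal_ofReal.congr (by simp)

theorem orliczModular_mono (hΦ : IsYoungFunction Φ) {F G : Type*} [NormedAddCommGroup F]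
    [NormedAddCommGroup G] {u : Euc n → F} {v : Euc n → G}
    (h : ∀ x, ‖u x‖ ≤ ‖v x‖) : orliczModular Φ Ω u ≤ orliczModular Φ Ω v :=
  lintegral_mono fun x => ENNReal.ofReal_le_ofReal (hΦ.mono (norm_nonneg _) (h x))

/-- Doubling gives a quasi-triangle inequality, which replaces the triangle inequality of a norm. -/
theorem IsYoungFunction.exists_orliczModular_add_le (hΦ : IsYoungFunction Φ) :
    ∃ D : ℝ≥0∞, D ≠ ⊤ ∧ ∀ {F : Type} [NormedAddCommGroup F] [MeasurableSpace F] [BorelSpace F]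
      (Ω : Set (Euc n)) (u v : Euc n → F), AEStronglyMeasurable v (volume.restrict Ω) →
        orliczModular Φ Ω (u + v) ≤ D * (orliczModular Φ Ω u + orliczModular Φ Ω v) := by
  obtain ⟨D, hD, h⟩ := hΦ.exists_doubling
  refine ⟨ENNReal.ofReal D, ENNReal.ofReal_ne_top, fun {F} _ _ _ Ω u v hv => ?_⟩
  unfold orliczModular
  rw [← lintegral_add_right' _ (hΦ.aemeasurable_ofReal_norm hv),
    ← lintegral_const_mul' _ _ ENNReal.ofReal_ne_top]
  refine lintegral_mono fun x => ?_
  rw [← ENNReal.ofReal_add (hΦ.nonneg (norm_nonneg _)) (hΦ.nonneg (norm_nonneg _)),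
    ← ENNReal.ofReal_mul (by linarith)]
  exact ENNReal.ofReal_le_ofReal ((hΦ.mono (norm_nonneg _) (norm_add_le _ _)).trans
    (h _ _ (norm_nonneg _) (norm_nonneg _)))

theorem IsYoungFunction.exists_orliczModular_smul_le (hΦ : IsYoungFunction Φ) {l : ℝ} (hl : 0 ≤ l) :
    ∃ C : ℝ≥0∞, C ≠ ⊤ ∧ ∀ {F G : Type} [NormedAddCommGroup F] [NormedAddCommGroup G]
      (Ω : Set (Euc n)) (u : Euc n → F) (v : Euc n → G), (∀ x, ‖v x‖ ≤ l * ‖u x‖) →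
        orliczModular Φ Ω v ≤ C * orliczModular Φ Ω u := by
  obtain ⟨C, hC, h⟩ := hΦ.exists_scale hl
  refine ⟨ENNReal.ofReal C, ENNReal.ofReal_ne_top, fun {F G} _ _ Ω u v huv => ?_⟩
  unfold orliczModular
  rw [← lintegral_const_mul' _ _ ENNReal.ofReal_ne_top]
  refine lintegral_mono fun x => ?_
  rw [← ENNReal.ofReal_mul (by linarith)]
  exact ENNReal.ofReal_le_ofReal ((hΦ.mono (norm_nonneg _) (huv x)).trans (h _ (norm_nonneg _)))

/-- `u` is measurable on `Ω` with finite modular; the vector valued version of `MemOrlicz`. -/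
def InOrlicz {F : Type} [NormedAddCommGroup F] (Φ : ℝ → ℝ) (Ω : Set (Euc n)) (u : Euc n → F) : Prop :=
  AEStronglyMeasurable u (volume.restrict Ω) ∧ orliczModular Φ Ω u < ⊤

namespace InOrlicz

variable {F : Type} [NormedAddCommGroup F] {u v : Euc n → F}

theorem mono_set {A B : Set (Euc n)} (h : InOrlicz Φ B u) (hAB : A ⊆ B) : InOrlicz Φ A u :=
  ⟨h.1.mono_set hAB, (orliczModular_mono_set hAB u).trans_lt h.2⟩

theorem add [MeasurableSpace F] [BorelSpace F] (hΦ : IsYoungFunction Φ)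
    (hu : InOrlicz Φ Ω u) (hv : InOrlicz Φ Ω v) : InOrlicz Φ Ω (u + v) := by
  obtain ⟨D, hD, h⟩ := hΦ.exists_orliczModular_add_le (n := n)
  exact ⟨hu.1.add hv.1, (h Ω u v hv.1).trans_lt
    (ENNReal.mul_lt_top hD.lt_top (ENNReal.add_lt_top.2 ⟨hu.2, hv.2⟩))⟩

theorem of_norm_le (hΦ : IsYoungFunction Φ) {G : Type} [NormedAddCommGroup G] {w : Euc n → G}
    (hu : InOrlicz Φ Ω u) {l : ℝ} (hl : 0 ≤ l) (hw : AEStronglyMeasurable w (volume.restrict Ω))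
    (h : ∀ x, ‖w x‖ ≤ l * ‖u x‖) : InOrlicz Φ Ω w := by
  obtain ⟨C, hC, h'⟩ := hΦ.exists_orliczModular_smul_le (n := n) hl
  exact ⟨hw, (h' Ω u w h).trans_lt (ENNReal.mul_lt_top hC.lt_top hu.2)⟩

theorem const_smul [NormedSpace ℝ F] (hΦ : IsYoungFunction Φ) (hu : InOrlicz Φ Ω u) (c : ℝ) :
    InOrlicz Φ Ω (c • u) :=
  hu.of_norm_le hΦ (abs_nonneg c) (hu.1.const_smul c) fun x => by simp [norm_smul]

theorem of_bounded (hΦ : IsYoungFunction Φ) (hΩ : volume Ω < ⊤)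
    (hu : AEStronglyMeasurable u (volume.restrict Ω)) {C : ℝ}
    (h : ∀ᵐ x ∂volume.restrict Ω, ‖u x‖ ≤ C) : InOrlicz Φ Ω u := by
  refine ⟨hu, ?_⟩
  calc orliczModular Φ Ω u ≤ ∫⁻ _ in Ω, ENNReal.ofReal (Φ C) :=
        lintegral_mono_ae (h.mono fun x hx =>
          ENNReal.ofReal_le_ofReal (hΦ.mono (norm_nonneg _) hx))
    _ < ⊤ := by
        rw [setLIntegral_const]
        exact ENNReal.mul_lt_top ENNReal.ofReal_lt_top hΩ

theorem integrableOn (hΦ : IsYoungFunction Φ) (hΩ : volume Ω < ⊤) (hu : InOrlicz Φ Ω u) :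
    IntegrableOn u Ω := by
  obtain ⟨R, hR, h⟩ := hΦ.exists_le_add
  refine ⟨hu.1, ?_⟩
  rw [hasFiniteIntegral_iff_norm]
  calc ∫⁻ x in Ω, ENNReal.ofReal ‖u x‖
      ≤ ∫⁻ x in Ω, (ENNReal.ofReal R + ENNReal.ofReal (Φ ‖u x‖)) := by
        refine lintegral_mono fun x => ?_
        rw [← ENNReal.ofReal_add hR (hΦ.nonneg (norm_nonneg _))]
        exact ENNReal.ofReal_le_ofReal (h _ (norm_nonneg _))
    _ = ENNReal.ofReal R * volume Ω + orliczModular Φ Ω u := by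
        rw [lintegral_add_left measurable_const, setLIntegral_const]; rfl
    _ < ⊤ := ENNReal.add_lt_top.2 ⟨ENNReal.mul_lt_top ENNReal.ofReal_lt_top hΩ, hu.2⟩

end InOrlicz

theorem norm_le_sum_abs (p : Euc n) : ‖p‖ ≤ ∑ i, |p i| := by
  conv_lhs => rw [← (EuclideanSpace.basisFun (Fin n) ℝ).sum_repr p]
  refine (norm_sum_le _ _).trans (Finset.sum_le_sum fun i _ => ?_)
  rw [norm_smul]
  simp

theorem inOrlicz_iff_forall_apply (hΦ : IsYoungFunction Φ) {v : Euc n → Euc n} :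
    InOrlicz Φ Ω v ↔ ∀ i, InOrlicz Φ Ω (fun x => v x i) := by
  constructor
  · intro h i
    refine h.of_norm_le hΦ zero_le_one ?_ fun x => ?_
    · exact (EuclideanSpace.proj (𝕜 := ℝ) i).continuous.comp_aestronglyMeasurable h.1
    · rw [one_mul]; exact PiLp.norm_apply_le (v x) i
  · intro h
    have hm : AEStronglyMeasurable v (volume.restrict Ω) := by
      have : AEMeasurable (fun x => WithLp.ofLp (v x)) (volume.restrict Ω) :=
        aemeasurable_pi_lambda _ fun i => (h i).1.aemeasurable
      exact ((PiLp.continuous_toLp 2 (fun _ : Fin n => ℝ)).measurable.comp_aemeasurable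
        this).aestronglyMeasurable
    have hs : InOrlicz Φ Ω (∑ i, fun x => |v x i|) := by
      refine Finset.sum_induction _ (InOrlicz Φ Ω) (fun a b ha hb => ha.add hΦ hb) ?_ ?_
      · refine ⟨aestronglyMeasurable_const, ?_⟩
        simp [orliczModular, hΦ.map_zero]
      · intro i _
        exact (h i).of_norm_le hΦ zero_le_one (h i).1.norm fun x => by simp
    refine hs.of_norm_le hΦ zero_le_one hm fun x => ?_
    rw [one_mul]
    refine (norm_le_sum_abs _).trans ((le_abs_self _).trans (by simp))

end ModularCalculus

theorem setLIntegral_eq_of_forall_diff {α : Type*} [MeasurableSpace α] {μ : Measure α} {A B : Set α}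
    (hA : MeasurableSet A) (hB : MeasurableSet B) (hAB : A ⊆ B) {g : α → ℝ≥0∞}
    (h : ∀ x ∈ B \ A, g x = 0) : ∫⁻ x in B, g x ∂μ = ∫⁻ x in A, g x ∂μ := by
  rw [← lintegral_inter_add_sdiff g B hA, inter_eq_self_of_subset_right hAB,
    setLIntegral_congr_fun (hB.diff hA) (g := fun _ => 0) h]
  simp

/-! ### Weak gradients in Orlicz spaces -/

section WeakGradient

variable {n : ℕ} {Φ : ℝ → ℝ} {Ω : Set (Euc n)}

/-- `v` is the distributional gradient of `u` on `Ω`. -/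
def IsWeakGradient (Ω : Set (Euc n)) (u : Euc n → ℝ) (v : Euc n → Euc n) : Prop :=
  ∀ (i : Fin n) (ψ : Euc n → ℝ), ContDiff ℝ ∞ ψ → HasCompactSupport ψ → tsupport ψ ⊆ Ω →
    ∫ x in Ω, u x * fderiv ℝ ψ x (EuclideanSpace.single i (1 : ℝ)) = - ∫ x in Ω, v x i * ψ x

/-- On a set of finite measure `L_Φ` is contained in `L¹`, so the local integrability requirements
are automatic. -/
theorem hasOrliczGradient_iff (hΦ : IsYoungFunction Φ) (hΩ : volume Ω < ⊤) {u : Euc n → ℝ}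
    {v : Euc n → Euc n} : HasOrliczGradient Φ Ω u v ↔
      InOrlicz Φ Ω u ∧ InOrlicz Φ Ω v ∧ IsWeakGradient Ω u v := by
  rw [inOrlicz_iff_forall_apply hΦ]
  constructor
  · rintro ⟨h1, h2⟩
    exact ⟨h1, fun i => (h2 i).1, fun i => (h2 i).2.2.2⟩
  · rintro ⟨h1, h2, h3⟩
    exact ⟨h1, fun i => ⟨h2 i, (h1.integrableOn hΦ hΩ).locallyIntegrableOn,
      ((h2 i).integrableOn hΦ hΩ).locallyIntegrableOn, h3 i⟩⟩

theorem integrable_mul_continuous {u ψ : Euc n → ℝ} (hu : IntegrableOn u Ω) (hψ : Continuous ψ)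
    (hc : HasCompactSupport ψ) : IntegrableOn (fun x => u x * ψ x) Ω := by
  obtain ⟨C, hC⟩ := hψ.bounded_above_of_compact_support hc
  exact hu.mul_bdd hψ.aestronglyMeasurable (Eventually.of_forall hC)

theorem ContDiff.continuous_partial {ψ : Euc n → ℝ} (hψ : ContDiff ℝ ∞ ψ) (e : Euc n) :
    Continuous fun x => fderiv ℝ ψ x e :=
  (hψ.continuous_fderiv (by simp)).clm_apply continuous_const

theorem HasCompactSupport.partial {ψ : Euc n → ℝ} (hψ : HasCompactSupport ψ) (e : Euc n) :
    HasCompactSupport fun x => fderiv ℝ ψ x e :=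
  hψ.fderiv_apply (𝕜 := ℝ) e

namespace HasOrliczGradient

variable {u u' : Euc n → ℝ} {v v' : Euc n → Euc n}

theorem inOrlicz (hΦ : IsYoungFunction Φ) (h : HasOrliczGradient Φ Ω u v) : InOrlicz Φ Ω v :=
  (inOrlicz_iff_forall_apply hΦ).2 fun i => (h.2 i).1

theorem integrableOn (hΦ : IsYoungFunction Φ) (hΩ : volume Ω < ⊤)
    (h : HasOrliczGradient Φ Ω u v) : IntegrableOn u Ω := InOrlicz.integrableOn hΦ hΩ h.1

theorem integrableOn_apply (hΦ : IsYoungFunction Φ) (hΩ : volume Ω < ⊤)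
    (h : HasOrliczGradient Φ Ω u v) (i : Fin n) : IntegrableOn (fun x => v x i) Ω :=
  InOrlicz.integrableOn hΦ hΩ (h.2 i).1

theorem add (hΦ : IsYoungFunction Φ) (hΩ : volume Ω < ⊤) (h : HasOrliczGradient Φ Ω u v)
    (h' : HasOrliczGradient Φ Ω u' v') : HasOrliczGradient Φ Ω (u + u') (v + v') := by
  refine (hasOrliczGradient_iff hΦ hΩ).2 ⟨InOrlicz.add hΦ h.1 h'.1,
    (h.inOrlicz hΦ).add hΦ (h'.inOrlicz hΦ), fun i ψ hψ hc hs => ?_⟩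
  simp only [Pi.add_apply, PiLp.add_apply, add_mul]
  rw [integral_add, integral_add, (h.2 i).2.2.2 ψ hψ hc hs, (h'.2 i).2.2.2 ψ hψ hc hs]
  · ring
  · exact integrable_mul_continuous (h.integrableOn_apply hΦ hΩ i) hψ.continuous hc
  · exact integrable_mul_continuous (h'.integrableOn_apply hΦ hΩ i) hψ.continuous hc
  · exact integrable_mul_continuous (h.integrableOn hΦ hΩ) (hψ.continuous_partial _) (hc.partial _)
  · exact integrable_mul_continuous (h'.integrableOn hΦ hΩ) (hψ.continuous_partial _) (hc.partial _)

theorem const_smul (hΦ : IsYoungFunction Φ) (hΩ : volume Ω < ⊤) (h : HasOrliczGradient Φ Ω u v)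
    (c : ℝ) : HasOrliczGradient Φ Ω (c • u) (c • v) := by
  refine (hasOrliczGradient_iff hΦ hΩ).2 ⟨InOrlicz.const_smul hΦ h.1 c,
    (h.inOrlicz hΦ).const_smul hΦ c, fun i ψ hψ hc hs => ?_⟩
  simp only [Pi.smul_apply, PiLp.smul_apply, smul_eq_mul, mul_assoc]
  rw [integral_const_mul, integral_const_mul, (h.2 i).2.2.2 ψ hψ hc hs]
  ring

theorem sub (hΦ : IsYoungFunction Φ) (hΩ : volume Ω < ⊤) (h : HasOrliczGradient Φ Ω u v)
    (h' : HasOrliczGradient Φ Ω u' v') : HasOrliczGradient Φ Ω (u - u') (v - v') := by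
  have := h.add hΦ hΩ (h'.const_smul hΦ hΩ (-1))
  simpa [sub_eq_add_neg] using this

theorem zero (hΦ : IsYoungFunction Φ) : HasOrliczGradient Φ Ω (0 : Euc n → ℝ) 0 := by
  have h0 : MemOrlicz Φ Ω (0 : Euc n → ℝ) :=
    ⟨aestronglyMeasurable_const, by simp [hΦ.map_zero]⟩
  refine ⟨h0, fun i => ⟨h0, ?_, ?_, ?_⟩⟩
  · exact (locallyIntegrable_zero).locallyIntegrableOn _
  · exact (locallyIntegrable_zero (ε'' := ℝ)).locallyIntegrableOn _
  · simp

theorem sum (hΦ : IsYoungFunction Φ) (hΩ : volume Ω < ⊤) {ι : Type*} (s : Finset ι)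
    {w : ι → Euc n → ℝ} {z : ι → Euc n → Euc n} (h : ∀ i ∈ s, HasOrliczGradient Φ Ω (w i) (z i)) :
    HasOrliczGradient Φ Ω (∑ i ∈ s, w i) (∑ i ∈ s, z i) := by
  classical
  induction s using Finset.induction_on with
  | empty => simpa using HasOrliczGradient.zero hΦ
  | insert a s ha ih =>
    rw [Finset.sum_insert ha, Finset.sum_insert ha]
    exact (h a (Finset.mem_insert_self _ _)).add hΦ hΩ
      (ih fun i hi => h i (Finset.mem_insert_of_mem hi))

theorem mono_set (hΦ : IsYoungFunction Φ) {A B : Set (Euc n)} (hB : IsOpen B) (hBf : volume B < ⊤)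
    (hAB : A ⊆ B) (h : HasOrliczGradient Φ B u v) : HasOrliczGradient Φ A u v := by
  refine (hasOrliczGradient_iff hΦ ((measure_mono hAB).trans_lt hBf)).2
    ⟨InOrlicz.mono_set h.1 hAB, (h.inOrlicz hΦ).mono_set hAB, fun i ψ hψ hc hs => ?_⟩
  have := (h.2 i).2.2.2 ψ hψ hc (hs.trans hAB)
  rw [setIntegral_eq_of_subset_of_forall_sdiff_eq_zero hB.measurableSet hAB,
    setIntegral_eq_of_subset_of_forall_sdiff_eq_zero hB.measurableSet hAB] at this
  · exact this
  · intro x hx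
    rw [image_eq_zero_of_notMem_tsupport (fun h' => hx.2 (hs h')), mul_zero]
  · intro x hx
    have : fderiv ℝ ψ x = 0 := image_eq_zero_of_notMem_tsupport
      fun h' => hx.2 (hs (tsupport_fderiv_subset ℝ h'))
    rw [this]; simp

/-- Uniqueness of the weak gradient. -/
theorem ae_eq (hΦ : IsYoungFunction Φ) (hΩo : IsOpen Ω) (hΩ : volume Ω < ⊤)
    (h : HasOrliczGradient Φ Ω u v) (h' : HasOrliczGradient Φ Ω u v') :
    v =ᵐ[volume.restrict Ω] v' := by
  have hi : ∀ i : Fin n, ∀ᵐ x ∂volume.restrict Ω, v x i - v' x i = 0 := by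
    intro i
    have hint := (h.integrableOn_apply hΦ hΩ i).sub (h'.integrableOn_apply hΦ hΩ i)
    rw [ae_restrict_iff' hΩo.measurableSet]
    refine hΩo.ae_eq_zero_of_integral_contDiff_smul_eq_zero (f := fun x => v x i - v' x i)
      (IntegrableOn.locallyIntegrableOn hint) fun g hg hc hs => ?_
    have e1 : ∫ x, g x • (v x i - v' x i) = ∫ x in Ω, g x • (v x i - v' x i) := by
      symm
      refine setIntegral_eq_integral_of_forall_compl_eq_zero fun x hx => ?_
      rw [image_eq_zero_of_notMem_tsupport (fun h' => hx (hs h')), zero_smul]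
    rw [e1]
    have e2 : ∀ x, g x • (v x i - v' x i) = v x i * g x - v' x i * g x := fun x => by
      simp only [smul_eq_mul]; ring
    simp only [e2]
    rw [integral_sub]
    · have a1 := (h.2 i).2.2.2 g hg hc hs
      have a2 := (h'.2 i).2.2.2 g hg hc hs
      linarith
    · exact integrable_mul_continuous (h.integrableOn_apply hΦ hΩ i) hg.continuous hc
    · exact integrable_mul_continuous (h'.integrableOn_apply hΦ hΩ i) hg.continuous hc
  filter_upwards [ae_all_iff.2 hi] with x hx
  ext i
  linarith [hx i]

/-- The product rule holds on `Ω` by testing with `θ ψ`, which is supported in `Ω` even when `ψ` is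
not. Since `θ` has compact support in `Ω`, extension by zero creates no boundary term in the larger
set `A`. -/
theorem cutoff (hΦ : IsYoungFunction Φ) {A : Set (Euc n)} (hΩo : IsOpen Ω)
    (hΩ : volume Ω < ⊤) (hA : IsOpen A) (hAf : volume A < ⊤) (hΩA : Ω ⊆ A)
    {θ : Euc n → ℝ} (hθ : ContDiff ℝ ∞ θ) (hθc : HasCompactSupport θ) (hθs : tsupport θ ⊆ Ω)
    (h : HasOrliczGradient Φ Ω u v) :
    HasOrliczGradient Φ A (fun x => θ x * u x) (fun x => θ x • v x + u x • gradient θ x) := by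
  obtain ⟨C, hC⟩ := hθ.continuous.bounded_above_of_compact_support hθc
  have hgc : Continuous (gradient θ) :=
    (InnerProductSpace.toDual ℝ (Euc n)).symm.continuous.comp (hθ.continuous_fderiv (by simp))
  have hgn : ∀ x, ‖gradient θ x‖ = ‖fderiv ℝ θ x‖ := fun x => by
    rw [← toDual_gradient, LinearIsometryEquiv.norm_map]
  obtain ⟨C', hC'⟩ := (hθ.continuous_fderiv (by simp)).bounded_above_of_compact_support
    (hθc.fderiv (𝕜 := ℝ))
  have hC0 : 0 ≤ C := (norm_nonneg _).trans (hC 0)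
  have hC0' : 0 ≤ C' := (norm_nonneg _).trans (hC' 0)
  have hgi : ∀ x i, (gradient θ x) i = fderiv ℝ θ x (EuclideanSpace.single i (1 : ℝ)) := by
    intro x i
    rw [← inner_gradient_left, EuclideanSpace.inner_single_right]; simp
  have z1 : ∀ x, x ∉ Ω → θ x = 0 := fun x hx => image_eq_zero_of_notMem_tsupport fun h' => hx (hθs h')
  have z2 : ∀ x, x ∉ Ω → fderiv ℝ θ x = 0 := fun x hx => image_eq_zero_of_notMem_tsupport
    fun h' => hx (hθs (tsupport_fderiv_subset ℝ h'))
  have z3 : ∀ x, x ∉ Ω → gradient θ x = 0 := fun x hx => by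
    rw [← norm_eq_zero, hgn, z2 x hx, norm_zero]
  -- Functions vanishing off `Ω` keep their modular when passing to `A`, because `Φ 0 = 0`.
  have key : ∀ {F : Type} [NormedAddCommGroup F] (w : Euc n → F), (∀ x, x ∉ Ω → w x = 0) →
      InOrlicz Φ Ω w → InOrlicz Φ A w := by
    intro F _ w hw hw'
    have e : Ω.indicator w = w := indicator_eq_self.2 fun x hx => by
      by_contra hx'
      exact hx (hw x hx')
    constructor
    · refine AEStronglyMeasurable.restrict ?_
      rw [← e]
      exact (aestronglyMeasurable_indicator_iff hΩo.measurableSet).2 hw'.1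
    · have : orliczModular Φ A w = orliczModular Φ Ω w := by
        unfold orliczModular
        refine setLIntegral_eq_of_forall_diff hΩo.measurableSet hA.measurableSet hΩA fun x hx => ?_
        simp [hw x hx.2, hΦ.map_zero]
      rw [this]; exact hw'.2
  refine (hasOrliczGradient_iff hΦ hAf).2 ⟨key _ (fun x hx => by simp [z1 x hx]) ?_,
    key _ (fun x hx => by simp [z1 x hx, z3 x hx]) ?_, fun i ψ hψ hc hs => ?_⟩
  · refine InOrlicz.of_norm_le hΦ h.1 hC0 (hθ.continuous.aestronglyMeasurable.mul h.1.1) fun x => ?_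
    rw [norm_mul]; gcongr; exact hC x
  · refine InOrlicz.add hΦ (u := fun x => θ x • v x) (v := fun x => u x • gradient θ x) ?_ ?_
    · refine InOrlicz.of_norm_le hΦ (h.inOrlicz hΦ) hC0
        (hθ.continuous.aestronglyMeasurable.smul (h.inOrlicz hΦ).1) fun x => ?_
      rw [norm_smul]; gcongr; exact hC x
    · refine InOrlicz.of_norm_le hΦ h.1 hC0' (h.1.1.smul hgc.aestronglyMeasurable) fun x => ?_
      rw [norm_smul, mul_comm, hgn]; gcongr; exact hC' x
  · have e1 : ∀ x, fderiv ℝ (fun y => θ y * ψ y) x (EuclideanSpace.single i (1 : ℝ)) =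
        θ x * fderiv ℝ ψ x (EuclideanSpace.single i (1 : ℝ)) +
          ψ x * fderiv ℝ θ x (EuclideanSpace.single i (1 : ℝ)) := by
      intro x
      rw [fderiv_fun_mul (hθ.differentiable (by simp) x) (hψ.differentiable (by simp) x)]
      simp
    have hθψ : HasCompactSupport fun y => θ y * ψ y := hθc.mul_right
    have w := (h.2 i).2.2.2 (fun y => θ y * ψ y) (hθ.mul hψ) hθψ (tsupport_mul_subset_left.trans hθs)
    rw [setIntegral_eq_of_subset_of_forall_sdiff_eq_zero hA.measurableSet hΩA,
      setIntegral_eq_of_subset_of_forall_sdiff_eq_zero hA.measurableSet hΩA]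
    rotate_left
    · intro x hx; simp [z1 x hx.2, z3 x hx.2]
    · intro x hx; simp [z1 x hx.2]
    have e3 : ∀ x, (θ x • v x + u x • gradient θ x) i * ψ x =
        v x i * (θ x * ψ x) + u x * (ψ x * fderiv ℝ θ x (EuclideanSpace.single i (1 : ℝ))) := by
      intro x
      simp only [PiLp.add_apply, PiLp.smul_apply, smul_eq_mul, hgi]; ring
    have e4 : ∀ x, θ x * u x * fderiv ℝ ψ x (EuclideanSpace.single i (1 : ℝ)) =
        u x * fderiv ℝ (fun y => θ y * ψ y) x (EuclideanSpace.single i (1 : ℝ)) -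
          u x * (ψ x * fderiv ℝ θ x (EuclideanSpace.single i (1 : ℝ))) := by
      intro x
      rw [e1]; ring
    have i1 := integrable_mul_continuous (h.integrableOn hΦ hΩ)
      (hψ.continuous.mul (hθ.continuous_partial (EuclideanSpace.single i (1 : ℝ))))
      hc.mul_right
    have i2 := integrable_mul_continuous (h.integrableOn hΦ hΩ)
      ((hθ.mul hψ).continuous_partial (EuclideanSpace.single i (1 : ℝ))) (hθψ.partial _)
    have i3 := integrable_mul_continuous (h.integrableOn_apply hΦ hΩ i)
      (hθ.continuous.mul hψ.continuous) hθψ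
    simp only [e3, e4]
    have j1 := integral_sub i2 i1
    have j2 := integral_add i3 i1
    simp only [Pi.mul_apply] at j1 j2
    rw [j1, j2, w]
    ring

/-- Boundedness of `Ω` puts the linear function in `L_Φ`; the weak gradient comes from integration
by parts on the whole space, the test function having compact support. -/
theorem linear (hΦ : IsYoungFunction Φ) (hb : Bornology.IsBounded Ω) (p : Euc n) :
    HasOrliczGradient Φ Ω (fun x => inner ℝ p x) (fun _ => p) := by
  have hΩ : volume Ω < ⊤ := hb.measure_lt_top
  obtain ⟨R, hR⟩ := hb.exists_norm_le
  have hcont : Continuous fun x : Euc n => inner ℝ p x := by fun_prop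
  refine (hasOrliczGradient_iff hΦ hΩ).2 ⟨?_, ?_, fun i ψ hψ hc hs => ?_⟩
  · obtain ⟨K, hK, hΩK⟩ : ∃ K, MeasurableSet K ∧ Ω ⊆ K ∧ ∀ x ∈ K, ‖x‖ ≤ R :=
      ⟨Metric.closedBall 0 R, Metric.isClosed_closedBall.measurableSet,
        fun x hx => by simpa using hR x hx, fun x hx => by simpa using hx⟩
    have : ∀ᵐ x ∂volume.restrict K, ‖inner ℝ p x‖ ≤ ‖p‖ * R := by
      refine ae_restrict_of_forall_mem hK fun x hx => (norm_inner_le_norm p x).trans ?_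
      gcongr
      exact hΩK.2 x hx
    exact InOrlicz.of_bounded hΦ hΩ hcont.aestronglyMeasurable
      (ae_restrict_of_ae_restrict_of_subset hΩK.1 this)
  · exact InOrlicz.of_bounded hΦ hΩ aestronglyMeasurable_const (Eventually.of_forall fun _ => le_rfl)
  · have hd : ∀ x, fderiv ℝ (fun x : Euc n => inner ℝ p x) x (EuclideanSpace.single i (1 : ℝ)) = p i := by
      intro x
      have : (fun x : Euc n => inner ℝ p x) = innerSL ℝ p := rfl
      rw [this, ContinuousLinearMap.fderiv]
      simp [EuclideanSpace.inner_single_right]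
    have hdiff : Differentiable ℝ fun x : Euc n => inner ℝ p x :=
      (innerSL ℝ p).differentiable
    have h1 : Integrable (fun x => inner ℝ p x * ψ x) (volume : Measure (Euc n)) :=
      (hcont.mul hψ.continuous).integrable_of_hasCompactSupport hc.mul_left
    have h2 : Integrable (fun x => inner ℝ p x * fderiv ℝ ψ x (EuclideanSpace.single i (1 : ℝ)))
        (volume : Measure (Euc n)) :=
      (hcont.mul (hψ.continuous_partial _)).integrable_of_hasCompactSupport
        (HasCompactSupport.mul_left (hc.partial _))
    have h3 : Integrable (fun x => fderiv ℝ (fun x : Euc n => inner ℝ p x) x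
        (EuclideanSpace.single i (1 : ℝ)) * ψ x) (volume : Measure (Euc n)) := by
      simp only [hd]
      exact (hψ.continuous.integrable_of_hasCompactSupport hc).const_mul _
    have := integral_mul_fderiv_eq_neg_fderiv_mul_of_integrable h3 h2 h1
      (fun x _ => hdiff x) (fun x _ => hψ.differentiable (by simp) x)
    simp only [hd] at this
    rw [setIntegral_eq_integral_of_forall_compl_eq_zero,
      setIntegral_eq_integral_of_forall_compl_eq_zero]
    · exact this
    · intro x hx
      rw [image_eq_zero_of_notMem_tsupport (fun h' => hx (hs h')), mul_zero]
    · intro x hx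
      have : fderiv ℝ ψ x = 0 := image_eq_zero_of_notMem_tsupport
        fun h' => hx (hs (tsupport_fderiv_subset ℝ h'))
      rw [this]; simp

end HasOrliczGradient

end WeakGradient

/-! ### Cutoff functions and small constants -/

/-- A smooth cutoff function between a compact set and an open set. -/
theorem exists_smooth_cutoff {n : ℕ} {K Q : Set (Euc n)} (hK : IsCompact K) (hQ : IsOpen Q)
    (hKQ : K ⊆ Q) : ∃ θ : Euc n → ℝ, ContDiff ℝ ∞ θ ∧ HasCompactSupport θ ∧ tsupport θ ⊆ Q ∧
      (∀ x ∈ K, θ x = 1) ∧ ∀ x, θ x ∈ Icc (0 : ℝ) 1 := by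
  obtain ⟨L, hL, hKL, hLQ⟩ := exists_compact_between hK hQ hKQ
  obtain ⟨f, h1, h0, h⟩ := exists_contMDiffMap_one_nhds_of_subset_interior
    (n := ⊤) (modelWithCornersSelf ℝ (Euc n)) hK.isClosed hKL
  have hs : tsupport f ⊆ L := closure_minimal (fun x hx => by
    by_contra hx'
    exact hx (h0 x hx')) hL.isClosed
  exact ⟨f, f.contMDiff.contDiff, hL.of_isClosed_subset (isClosed_tsupport _) hs, hs.trans hLQ,
    fun x hx => h1.self_of_nhdsSet x hx, h⟩

theorem ENNReal.exists_pos_mul_le {K ε : ℝ≥0∞} (hK : K ≠ ⊤) (hε : 0 < ε) :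
    ∃ δ : ℝ≥0∞, 0 < δ ∧ K * δ ≤ ε := by
  -- Dividing by `K + 1` covers the case `K = 0`.
  refine ⟨ε / (K + 1), ENNReal.div_pos hε.ne' (by finiteness), ?_⟩
  calc K * (ε / (K + 1)) ≤ (K + 1) * (ε / (K + 1)) := by gcongr; exact le_self_add
    _ ≤ ε := ENNReal.mul_div_le

theorem ENNReal.exists_real_mul_le {K ε : ℝ≥0∞} (hK : K ≠ ⊤) (hε : 0 < ε) :
    ∃ t : ℝ, 0 < t ∧ t ≤ 1 ∧ ENNReal.ofReal t * K ≤ ε := by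
  obtain ⟨δ, hδ, h⟩ := ENNReal.exists_pos_mul_le hK hε
  obtain ⟨t, ht0, ht⟩ := ENNReal.lt_iff_exists_real_btwn.1 hδ
  have ht' : 0 < t := by
    have := ht.1
    simpa using this
  refine ⟨min t 1, lt_min ht' one_pos, min_le_right _ _, ?_⟩
  rw [mul_comm]
  refine le_trans ?_ h
  gcongr
  exact (ENNReal.ofReal_le_ofReal (min_le_left _ _)).trans ht.2.le

/-- Inner regularity makes the measure of `A \ K` small, and absolute continuity of the integral
does the rest. -/
theorem exists_isCompact_setLIntegral_lt {n : ℕ} {A : Set (Euc n)} (hA : MeasurableSet A)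
    (hAf : volume A < ⊤) {g : Euc n → ℝ≥0∞} (hg : ∫⁻ x in A, g x < ⊤) {ε : ℝ≥0∞} (hε : 0 < ε) :
    ∃ K, K ⊆ A ∧ IsCompact K ∧ ∫⁻ x in A \ K, g x < ε := by
  obtain ⟨δ, hδ, h⟩ := exists_pos_setLIntegral_lt_of_measure_lt hg.ne hε.ne'
  obtain ⟨K, hKA, hK, hlt⟩ := hA.exists_isCompact_sdiff_lt hAf.ne hδ.ne'
  refine ⟨K, hKA, hK, ?_⟩
  have hm : MeasurableSet (A \ K) := hA.diff hK.measurableSet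
  have := h (A \ K) (by rw [Measure.restrict_apply hm, inter_eq_self_of_subset_left sdiff_subset]; exact hlt)
  rwa [Measure.restrict_restrict hm, inter_eq_self_of_subset_left sdiff_subset] at this

/-! ### Energies, perturbation of the field, and correctors -/

section Energy

variable {n : ℕ} {Φ : ℝ → ℝ} {c₁ c₂ : ℝ}

/-- The energy `∫_A f(x, v(x)) dx` of a vector field. -/
noncomputable def fieldEnergy {n : ℕ} (f : Euc n → Euc n → ℝ) (A : Set (Euc n))
    (v : Euc n → Euc n) : ℝ≥0∞ :=
  ∫⁻ x in A, ENNReal.ofReal (f x (v x))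

theorem fieldEnergy_mono_set {f : Euc n → Euc n → ℝ} {A B : Set (Euc n)} (h : A ⊆ B)
    (v : Euc n → Euc n) : fieldEnergy f A v ≤ fieldEnergy f B v :=
  lintegral_mono_set h

namespace IsConvexIntegrand

variable {f : Euc n → Euc n → ℝ}

theorem nonneg (hΦ : IsYoungFunction Φ) (hc₁ : 0 < c₁) (hf : IsConvexIntegrand c₁ c₂ Φ f)
    (x p : Euc n) : 0 ≤ f x p :=
  (mul_nonneg hc₁.le (hΦ.nonneg (norm_nonneg p))).trans (hf.lower x p)

/-- The Carathéodory argument: clear for simple `v`, then by continuity of `f x` along simple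
approximations. -/
theorem aemeasurable_comp (hf : IsConvexIntegrand c₁ c₂ Φ f) {A : Set (Euc n)}
    {v : Euc n → Euc n} (hv : AEStronglyMeasurable v (volume.restrict A)) :
    AEMeasurable (fun x => f x (v x)) (volume.restrict A) := by
  have hs : ∀ s : SimpleFunc (Euc n) (Euc n),
      AEMeasurable (fun x => f x (s x)) (volume.restrict A) := by
    intro s
    have e : (fun x => f x (s x)) = fun x => ∑ p ∈ s.range, (s ⁻¹' {p}).indicator (fun x => f x p) x := by
      ext x
      rw [Finset.sum_eq_single (s x)]
      · simp
      · intro p _ hp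
        exact indicator_of_notMem (fun h => hp h.symm) _
      · intro h
        exact absurd (s.mem_range_self x) h
    rw [e]
    refine Finset.aemeasurable_fun_sum _ fun p _ => ?_
    exact ((hf.measurable p).restrict).indicator (s.measurableSet_preimage _)
  have hlim : ∀ᵐ x ∂volume.restrict A, Tendsto (fun m => f x (hv.stronglyMeasurable_mk.approx m x))
      atTop (𝓝 (f x (v x))) := by
    filter_upwards [ae_restrict_of_ae hf.continuous, hv.ae_eq_mk] with x hx hx'
    rw [hx']
    exact (hx.tendsto _).comp (hv.stronglyMeasurable_mk.tendsto_approx x)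
  exact aemeasurable_of_tendsto_metrizable_ae atTop (fun m => hs _) hlim

theorem fieldEnergy_le (hΦ : IsYoungFunction Φ) (hc₂ : 0 < c₂) (hf : IsConvexIntegrand c₁ c₂ Φ f)
    (A : Set (Euc n)) (v : Euc n → Euc n) :
    fieldEnergy f A v ≤ ENNReal.ofReal c₂ * ∫⁻ x in A, (1 + ENNReal.ofReal (Φ ‖v x‖)) := by
  rw [← lintegral_const_mul' _ _ ENNReal.ofReal_ne_top]
  refine lintegral_mono fun x => ?_
  rw [← ENNReal.ofReal_one, ← ENNReal.ofReal_add zero_le_one (hΦ.nonneg (norm_nonneg _)),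
    ← ENNReal.ofReal_mul hc₂.le]
  exact ENNReal.ofReal_le_ofReal (hf.upper x (v x))

/-- Coercivity: bounds on energies become bounds on gradients, uniformly over the class. -/
theorem orliczModular_le_fieldEnergy (hc₁ : 0 < c₁) (hf : IsConvexIntegrand c₁ c₂ Φ f)
    (A : Set (Euc n)) (v : Euc n → Euc n) :
    orliczModular Φ A v ≤ (ENNReal.ofReal c₁)⁻¹ * fieldEnergy f A v := by
  have h0 : ENNReal.ofReal c₁ ≠ 0 := (ENNReal.ofReal_pos.2 hc₁).ne'
  unfold fieldEnergy orliczModular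
  rw [← lintegral_const_mul' _ _ (ENNReal.inv_ne_top.2 h0)]
  refine lintegral_mono fun x => ?_
  rw [← ENNReal.mul_le_iff_le_inv h0 ENNReal.ofReal_ne_top, ← ENNReal.ofReal_mul hc₁.le]
  exact ENNReal.ofReal_le_ofReal (hf.lower x (v x))

theorem fieldEnergy_convex_le (hΦ : IsYoungFunction Φ) (hc₁ : 0 < c₁)
    (hf : IsConvexIntegrand c₁ c₂ Φ f) {A : Set (Euc n)} {v w : Euc n → Euc n}
    (hw : AEStronglyMeasurable w (volume.restrict A)) {a b : ℝ} (ha : 0 ≤ a) (hb : 0 ≤ b)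
    (hab : a + b = 1) : fieldEnergy f A (a • v + b • w) ≤
      ENNReal.ofReal a * fieldEnergy f A v + ENNReal.ofReal b * fieldEnergy f A w := by
  unfold fieldEnergy
  rw [← lintegral_const_mul' _ _ ENNReal.ofReal_ne_top, ← lintegral_const_mul' _ _ ENNReal.ofReal_ne_top,
    ← lintegral_add_right' _ ((hf.aemeasurable_comp hw).ennreal_ofReal.const_mul _)]
  refine lintegral_mono fun x => ?_
  rw [← ENNReal.ofReal_mul ha, ← ENNReal.ofReal_mul hb, ← ENNReal.ofReal_add
    (mul_nonneg ha (hf.nonneg hΦ hc₁ _ _)) (mul_nonneg hb (hf.nonneg hΦ hc₁ _ _))]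
  exact ENNReal.ofReal_le_ofReal ((hf.convex x).2 (mem_univ _) (mem_univ _) ha hb hab)

end IsConvexIntegrand

/-- Write `p + r = (1 - t) p + t (p + r / t)` and use convexity in `p`, then the upper growth bound
and doubling for the second point. The small parameter `t` is free, and the constant is common to
all integrands of the class. -/
theorem IsYoungFunction.exists_perturb (hΦ : IsYoungFunction Φ) (hc₁ : 0 < c₁) (hc₂ : 0 < c₂) :
    ∃ C : ℝ, 0 ≤ C ∧ ∀ f : Euc n → Euc n → ℝ, IsConvexIntegrand c₁ c₂ Φ f →
      ∀ (x p r : Euc n) (t : ℝ), 0 < t → t ≤ 1 →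
        f x (p + r) ≤ f x p + t * (C * (1 + Φ ‖p‖ + Φ (t⁻¹ * ‖r‖))) := by
  obtain ⟨D, hD, h⟩ := hΦ.exists_doubling
  refine ⟨c₂ * D, by positivity, fun f hf x p r t ht ht1 => ?_⟩
  have e : p + r = (1 - t) • p + t • (p + t⁻¹ • r) := by
    rw [smul_add, smul_smul, mul_inv_cancel₀ ht.ne', one_smul, sub_smul, one_smul]; abel
  have h1 := (hf.convex x).2 (mem_univ p) (mem_univ (p + t⁻¹ • r)) (sub_nonneg.2 ht1) ht.le (by ring)
  rw [← e] at h1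
  simp only [smul_eq_mul] at h1
  have h2 := hf.upper x (p + t⁻¹ • r)
  have h3 : Φ ‖p + t⁻¹ • r‖ ≤ D * (Φ ‖p‖ + Φ (t⁻¹ * ‖r‖)) := by
    refine (hΦ.mono (norm_nonneg _) (norm_add_le _ _)).trans ?_
    rw [norm_smul, Real.norm_of_nonneg (inv_nonneg.2 ht.le)]
    exact h _ _ (norm_nonneg _) (by positivity)
  have h4 := hf.nonneg hΦ hc₁ x p
  have h5 : f x (p + t⁻¹ • r) ≤ c₂ * D * (1 + Φ ‖p‖ + Φ (t⁻¹ * ‖r‖)) := by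
    refine h2.trans ?_
    rw [mul_assoc]
    gcongr
    nlinarith
  nlinarith [mul_le_mul_of_nonneg_left h5 ht.le, mul_nonneg ht.le h4]

/-- The energies are uniformly continuous on modular-bounded sets, uniformly in the integrand. -/
theorem IsYoungFunction.exists_fieldEnergy_add_le (hΦ : IsYoungFunction Φ) (hc₁ : 0 < c₁) (hc₂ : 0 < c₂)
    {M ε : ℝ≥0∞} (hM : M ≠ ⊤) (hε : 0 < ε) :
    ∃ δ : ℝ≥0∞, 0 < δ ∧ ∀ f : Euc n → Euc n → ℝ, IsConvexIntegrand c₁ c₂ Φ f →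
      ∀ (A : Set (Euc n)) (v r : Euc n → Euc n), AEStronglyMeasurable v (volume.restrict A) →
        AEStronglyMeasurable r (volume.restrict A) → volume A ≤ M → orliczModular Φ A v ≤ M →
          orliczModular Φ A r ≤ δ → fieldEnergy f A (v + r) ≤ fieldEnergy f A v + ε := by
  obtain ⟨C, hC0, hC⟩ := hΦ.exists_perturb (n := n) hc₁ hc₂
  have hε2 : 0 < ε / 2 := ENNReal.half_pos hε.ne'
  -- The order of choices matters: `t` first absorbs the terms bounded by `M`, and only then is `δ`
  -- chosen, in terms of the scaling constant `C'` for `1 / t`.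
  obtain ⟨t, ht0, ht1, ht⟩ := ENNReal.exists_real_mul_le
    (K := ENNReal.ofReal C * (M + M)) (by finiteness) hε2
  obtain ⟨C', -, hC'⟩ := exists_ofReal_scale_le hΦ (inv_nonneg.2 ht0.le)
  obtain ⟨δ, hδ, hδ'⟩ := ENNReal.exists_pos_mul_le
    (K := ENNReal.ofReal t * (ENNReal.ofReal C * ENNReal.ofReal C')) (by finiteness) hε2
  refine ⟨δ, hδ, fun f hf A v r hv hr hA hvM hrδ => ?_⟩
  have m1 := hΦ.aemeasurable_ofReal_norm hv
  have m2 := hΦ.aemeasurable_ofReal_norm hr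
  calc fieldEnergy f A (v + r)
      ≤ ∫⁻ x in A, (ENNReal.ofReal (f x (v x)) + ENNReal.ofReal t * (ENNReal.ofReal C *
          (1 + ENNReal.ofReal (Φ ‖v x‖) + ENNReal.ofReal C' * ENNReal.ofReal (Φ ‖r x‖)))) := by
        refine lintegral_mono fun x => ?_
        have a1 := hC f hf x (v x) (r x) t ht0 ht1
        have a2 := hΦ.nonneg (norm_nonneg (v x))
        have a3 := hΦ.nonneg (t := t⁻¹ * ‖r x‖) (by positivity)
        refine (ENNReal.ofReal_le_ofReal a1).trans ?_
        rw [ENNReal.ofReal_add (hf.nonneg hΦ hc₁ _ _) (by positivity), ENNReal.ofReal_mul ht0.le,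
          ENNReal.ofReal_mul hC0, ENNReal.ofReal_add (by positivity) a3,
          ENNReal.ofReal_add zero_le_one a2, ENNReal.ofReal_one]
        gcongr
        exact hC' _ (norm_nonneg _)
    _ = fieldEnergy f A v + ENNReal.ofReal t * (ENNReal.ofReal C *
          (volume A + orliczModular Φ A v + ENNReal.ofReal C' * orliczModular Φ A r)) := by
        rw [lintegral_add_right', lintegral_const_mul' _ _ ENNReal.ofReal_ne_top,
          lintegral_const_mul' _ _ ENNReal.ofReal_ne_top, lintegral_add_right', lintegral_add_right' _ m1,
          lintegral_const_mul' _ _ ENNReal.ofReal_ne_top, setLIntegral_one]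
        · rfl
        · exact m2.const_mul _
        · exact (((aemeasurable_const.add m1).add (m2.const_mul _)).const_mul _).const_mul _
    _ ≤ fieldEnergy f A v + ENNReal.ofReal t * (ENNReal.ofReal C * (M + M + ENNReal.ofReal C' * δ)) := by
        gcongr
    _ = fieldEnergy f A v + (ENNReal.ofReal t * (ENNReal.ofReal C * (M + M)) +
          ENNReal.ofReal t * (ENNReal.ofReal C * ENNReal.ofReal C') * δ) := by ring
    _ ≤ fieldEnergy f A v + (ε / 2 + ε / 2) := by gcongr
    _ = fieldEnergy f A v + ε := by rw [ENNReal.add_halves]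

/-- `L` bounds the `Γ`-limsup at `u` of the energies on `A` from above. -/
def GammaUpper (Φ : ℝ → ℝ) (f : ℕ → Euc n → Euc n → ℝ) (A : Set (Euc n)) (u : Euc n → ℝ)
    (L : ℝ≥0∞) : Prop :=
  ∀ ε : ℝ≥0∞, 0 < ε → ∀ᶠ k in atTop, ∃ w v, HasOrliczGradient Φ A w v ∧
    orliczModular Φ A (w - u) ≤ ε ∧ fieldEnergy (f k) A v ≤ L + ε

/-- `L` bounds the `Γ`-liminf at `u` of the energies on `A` from below. -/
def GammaLower (Φ : ℝ → ℝ) (f : ℕ → Euc n → Euc n → ℝ) (A : Set (Euc n)) (u : Euc n → ℝ)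
    (L : ℝ≥0∞) : Prop :=
  ∀ ε : ℝ≥0∞, 0 < ε → ∃ δ : ℝ≥0∞, 0 < δ ∧ ∀ᶠ k in atTop, ∀ w v, HasOrliczGradient Φ A w v →
    orliczModular Φ A (w - u) ≤ δ → L ≤ fieldEnergy (f k) A v + ε

variable {f : ℕ → Euc n → Euc n → ℝ} {A Q : Set (Euc n)} {u : Euc n → ℝ} {v : Euc n → Euc n}
  {L L' : ℝ≥0∞}

theorem GammaLower.le_of_gammaUpper (h : GammaLower Φ f A u L) (h' : GammaUpper Φ f A u L') :
    L ≤ L' := by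
  refine ENNReal.le_of_forall_pos_le_add fun ε hε _ => ?_
  have hε2 : (0 : ℝ≥0∞) < (ε : ℝ≥0∞) / 2 := ENNReal.half_pos (by simpa using hε.ne')
  obtain ⟨δ, hδ, hk⟩ := h _ hε2
  obtain ⟨k, hk, w, v, h1, h2, h3⟩ := (hk.and (h' _ (lt_min hδ hε2))).exists
  calc L ≤ fieldEnergy (f k) A v + (ε : ℝ≥0∞) / 2 := hk w v h1 (h2.trans (min_le_left _ _))
    _ ≤ L' + (ε : ℝ≥0∞) / 2 + (ε : ℝ≥0∞) / 2 := by
      gcongr; exact h3.trans (by gcongr; exact min_le_right _ _)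
    _ = L' + ε := by rw [add_assoc, ENNReal.add_halves]

theorem GammaUpper.sInf_mem (h : GammaUpper Φ f A u L') (hL' : L' ≠ ⊤) :
    GammaUpper Φ f A u (sInf {L | GammaUpper Φ f A u L}) := by
  intro ε hε
  have hS : sInf {L | GammaUpper Φ f A u L} ≠ ⊤ := ((sInf_le h).trans_lt hL'.lt_top).ne
  obtain ⟨L, hL, hlt⟩ := sInf_lt_iff.1 (ENNReal.lt_add_right hS (ENNReal.half_pos hε.ne').ne')
  filter_upwards [hL _ (ENNReal.half_pos hε.ne')] with k ⟨w, v, h1, h2, h3⟩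
  refine ⟨w, v, h1, h2.trans ENNReal.half_le_self, h3.trans ?_⟩
  calc L + ε / 2 ≤ sInf {L | GammaUpper Φ f A u L} + ε / 2 + ε / 2 := by gcongr
    _ = _ := by rw [add_assoc, ENNReal.add_halves]

/-- Given a near-optimal pair `(w, z)`, the corrector is `ζ = θ (w - u)` with a cutoff `θ` equal to
`1` on a compact set `K`. The corrected field is `θ z + (1 - θ) v + (w - u) ∇θ`. By convexity the
first two terms cost at most the energy of `z` plus the growth bound for `v` off `K`, which is small
by choice of `K`. The last term is a perturbation, small in modular because `θ` is fixed before `w`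
is taken close to `u`. -/
theorem GammaUpper.exists_corrector (hΦ : IsYoungFunction Φ) (hc₁ : 0 < c₁) (hc₂ : 0 < c₂)
    (hf : ∀ k, IsConvexIntegrand c₁ c₂ Φ (f k)) (hQo : IsOpen Q) (hQf : volume Q < ⊤)
    (huv : HasOrliczGradient Φ Q u v) (h : GammaUpper Φ f Q u L) (hL : L ≠ ⊤) {ε : ℝ≥0∞} (hε : 0 < ε) :
    ∀ᶠ k in atTop, ∃ (ζ : Euc n → ℝ) (η : Euc n → Euc n), (∀ x ∉ Q, ζ x = 0) ∧ (∀ x ∉ Q, η x = 0) ∧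
      (∀ A, IsOpen A → volume A < ⊤ → Q ⊆ A → HasOrliczGradient Φ A ζ η) ∧
      orliczModular Φ Q ζ ≤ ε ∧ fieldEnergy (f k) Q (v + η) ≤ L + ε := by
  have hε3 : 0 < ε / 3 := ENNReal.div_pos hε.ne' (by finiteness)
  have hvO := huv.inOrlicz hΦ
  -- a compact set carrying most of the energy of `v`
  have hg : ∫⁻ x in Q, ENNReal.ofReal c₂ * (1 + ENNReal.ofReal (Φ ‖v x‖)) < ⊤ := by
    rw [lintegral_const_mul' _ _ ENNReal.ofReal_ne_top, lintegral_add_left measurable_const,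
      setLIntegral_one]
    exact ENNReal.mul_lt_top ENNReal.ofReal_lt_top (ENNReal.add_lt_top.2 ⟨hQf, hvO.2⟩)
  obtain ⟨K, hKQ, hK, hKlt⟩ := exists_isCompact_setLIntegral_lt hQo.measurableSet hQf hg hε3
  obtain ⟨θ, hθ, hθc, hθs, hθK, hθI⟩ := exists_smooth_cutoff hK hQo hKQ
  obtain ⟨B, hB⟩ := (hθ.continuous_fderiv (by simp)).bounded_above_of_compact_support
    (hθc.fderiv (𝕜 := ℝ))
  have hgc : Continuous (gradient θ) :=
    (InnerProductSpace.toDual ℝ (Euc n)).symm.continuous.comp (hθ.continuous_fderiv (by simp))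
  have hgn : ∀ x, ‖gradient θ x‖ ≤ B := fun x => by
    rw [← LinearIsometryEquiv.norm_map (InnerProductSpace.toDual ℝ (Euc n)), toDual_gradient]
    exact hB x
  have hB0 : 0 ≤ B := (norm_nonneg _).trans (hB 0)
  obtain ⟨C, hC, hCB⟩ := hΦ.exists_orliczModular_smul_le (n := n) hB0
  -- A bound for the volume and for the modular of the convex combination `b` below, available
  -- before `δ` is chosen: the crude energy bound `L + 1` suffices through coercivity.
  set M : ℝ≥0∞ := volume Q + ((ENNReal.ofReal c₁)⁻¹ * (L + 1) + orliczModular Φ Q v) with hMdef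
  have hc1' : (ENNReal.ofReal c₁)⁻¹ ≠ ⊤ := ENNReal.inv_ne_top.2 (ENNReal.ofReal_pos.2 hc₁).ne'
  have hM : M ≠ ⊤ := by
    have h1 := hQf.ne
    have h2 := hvO.2.ne
    simp only [hMdef]
    finiteness
  obtain ⟨δ, hδ, hpert⟩ := hΦ.exists_fieldEnergy_add_le (n := n) hc₁ hc₂ hM hε3
  obtain ⟨δ', hδ', hCδ⟩ := ENNReal.exists_pos_mul_le hC hδ
  filter_upwards [h (min (min (ε / 3) 1) δ') (lt_min (lt_min hε3 one_pos) hδ')] with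
    k ⟨w, z, hwz, hwu, hEz⟩
  have hd := hwz.sub hΦ hQf huv
  have hmz := (hwz.inOrlicz hΦ).1
  have hmv := hvO.1
  refine ⟨fun x => θ x * (w - u) x, fun x => θ x • (z - v) x + (w - u) x • gradient θ x, ?_, ?_,
    fun A hAo hAf hQA => hd.cutoff hΦ hQo hQf hAo hAf hQA hθ hθc hθs, ?_, ?_⟩
  · intro x hx
    simp [image_eq_zero_of_notMem_tsupport fun h' => hx (hθs h')]
  · intro x hx
    have z2 : fderiv ℝ θ x = 0 := image_eq_zero_of_notMem_tsupport
      fun h' => hx (hθs (tsupport_fderiv_subset ℝ h'))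
    have z3 : gradient θ x = 0 := by
      rw [← norm_eq_zero, ← LinearIsometryEquiv.norm_map (InnerProductSpace.toDual ℝ (Euc n)),
        toDual_gradient, z2, norm_zero]
    simp [image_eq_zero_of_notMem_tsupport fun h' => hx (hθs h'), z3]
  · refine (orliczModular_mono hΦ fun x => ?_).trans (hwu.trans ((min_le_left _ _).trans
      ((min_le_left _ _).trans ?_)))
    · rw [norm_mul, Real.norm_of_nonneg (hθI x).1]
      exact mul_le_of_le_one_left (norm_nonneg _) (hθI x).2
    · exact ENNReal.div_le_of_le_mul (le_mul_of_one_le_right' (by norm_num))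
  · set b : Euc n → Euc n := fun x => θ x • z x + (1 - θ x) • v x with hb
    set r : Euc n → Euc n := fun x => (w - u) x • gradient θ x with hr
    have hbm : AEStronglyMeasurable b (volume.restrict Q) :=
      (hθ.continuous.aestronglyMeasurable.smul hmz).add
        ((continuous_const.sub hθ.continuous).aestronglyMeasurable.smul hmv)
    have hrm : AEStronglyMeasurable r (volume.restrict Q) :=
      (hwz.1.1.sub huv.1.1).smul hgc.aestronglyMeasurable
    have hbr : v + (fun x => θ x • (z - v) x + (w - u) x • gradient θ x) = b + r := by
      ext1 x
      simp only [hb, hr, Pi.add_apply, Pi.sub_apply, smul_sub, sub_smul, one_smul]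
      abel
    have hEz1 : fieldEnergy (f k) Q z ≤ L + 1 :=
      hEz.trans (by gcongr; exact (min_le_left _ _).trans (min_le_right _ _))
    have hEz2 : fieldEnergy (f k) Q z ≤ L + ε / 3 :=
      hEz.trans (by gcongr; exact (min_le_left _ _).trans (min_le_left _ _))
    have hbM : orliczModular Φ Q b ≤ M := by
      calc orliczModular Φ Q b
          ≤ ∫⁻ x in Q, (ENNReal.ofReal (Φ ‖z x‖) + ENNReal.ofReal (Φ ‖v x‖)) := by
            refine lintegral_mono fun x => ?_
            rw [← ENNReal.ofReal_add (hΦ.nonneg (norm_nonneg _)) (hΦ.nonneg (norm_nonneg _))]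
            refine ENNReal.ofReal_le_ofReal ?_
            have a1 := hΦ.norm_convex_comb_le (hθI x).1 (sub_nonneg.2 (hθI x).2) (by ring) (z x) (v x)
            have a2 := hΦ.nonneg (norm_nonneg (z x))
            have a3 := hΦ.nonneg (norm_nonneg (v x))
            have a4 := hθI x
            refine a1.trans ?_
            nlinarith [a4.1, a4.2]
        _ = orliczModular Φ Q z + orliczModular Φ Q v :=
            lintegral_add_right' _ (hΦ.aemeasurable_ofReal_norm hmv)
        _ ≤ (ENNReal.ofReal c₁)⁻¹ * (L + 1) + orliczModular Φ Q v := by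
            gcongr
            exact ((hf k).orliczModular_le_fieldEnergy hc₁ Q z).trans (by gcongr)
        _ ≤ M := le_add_self
    have hrδ : orliczModular Φ Q r ≤ δ := by
      refine (hCB Q (w - u) r fun x => ?_).trans (le_trans ?_ hCδ)
      · simp only [hr, norm_smul, mul_comm]
        gcongr
        exact hgn x
      · gcongr
        exact hwu.trans (min_le_right _ _)
    -- On `K` the field `b` is `z`; off `K`, convexity and the upper growth bound for `v` apply.
    have hEb : fieldEnergy (f k) Q b ≤ fieldEnergy (f k) Q z + ε / 3 := by
      have hzm := ((hf k).aemeasurable_comp hmz).ennreal_ofReal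
      calc fieldEnergy (f k) Q b
          ≤ ∫⁻ x in Q, (ENNReal.ofReal (f k x (z x)) +
              (Kᶜ).indicator (fun x => ENNReal.ofReal c₂ * (1 + ENNReal.ofReal (Φ ‖v x‖))) x) := by
            refine lintegral_mono fun x => ?_
            by_cases hx : x ∈ K
            · simp [hb, hθK x hx, hx]
            · rw [indicator_of_mem (show x ∈ Kᶜ from hx), ← ENNReal.ofReal_one,
                ← ENNReal.ofReal_add zero_le_one (hΦ.nonneg (norm_nonneg _)), ← ENNReal.ofReal_mul hc₂.le,
                ← ENNReal.ofReal_add ((hf k).nonneg hΦ hc₁ _ _)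
                  (mul_nonneg hc₂.le (add_nonneg zero_le_one (hΦ.nonneg (norm_nonneg _))))]
              refine ENNReal.ofReal_le_ofReal ?_
              have a1 := ((hf k).convex x).2 (mem_univ (z x)) (mem_univ (v x)) (hθI x).1
                (sub_nonneg.2 (hθI x).2) (by ring)
              simp only [smul_eq_mul] at a1
              have a2 := (hf k).nonneg hΦ hc₁ x (z x)
              have a3 := (hf k).nonneg hΦ hc₁ x (v x)
              have a4 := (hf k).upper x (v x)
              have a5 := hθI x
              refine a1.trans ?_
              nlinarith [a5.1, a5.2]
        _ = fieldEnergy (f k) Q z +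
              ∫⁻ x in Q \ K, ENNReal.ofReal c₂ * (1 + ENNReal.ofReal (Φ ‖v x‖)) := by
            rw [lintegral_add_left' hzm, setLIntegral_indicator hK.measurableSet.compl,
              inter_comm, ← sdiff_eq]
            rfl
        _ ≤ _ := by gcongr
    rw [hbr]
    calc fieldEnergy (f k) Q (b + r) ≤ fieldEnergy (f k) Q b + ε / 3 :=
          hpert (f k) (hf k) Q b r hbm hrm le_self_add hbM hrδ
      _ ≤ L + ε / 3 + ε / 3 + ε / 3 := by gcongr; exact hEb.trans (by gcongr)
      _ = L + ε := by rw [add_assoc, add_assoc, ← add_assoc (ε / 3), ENNReal.add_thirds]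

/-- The correctors vanish outside their own sets, so their sum coincides with `ζ i` on `Q i`. The
functions `u i` need not match across interfaces, since only correctors are glued; this permits a
different linear function on each cube. -/
theorem exists_glued_corrector (hΦ : IsYoungFunction Φ) (hc₁ : 0 < c₁) (hc₂ : 0 < c₂)
    (hf : ∀ k, IsConvexIntegrand c₁ c₂ Φ (f k)) (hAo : IsOpen A) (hAf : volume A < ⊤)
    {ι : Type*} (S : Finset ι) {Q : ι → Set (Euc n)} (hQo : ∀ i ∈ S, IsOpen (Q i))
    (hQA : ∀ i ∈ S, Q i ⊆ A) (hdisj : (S : Set ι).PairwiseDisjoint Q)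
    {u : ι → Euc n → ℝ} {v : ι → Euc n → Euc n} {L : ι → ℝ≥0∞}
    (huv : ∀ i ∈ S, HasOrliczGradient Φ (Q i) (u i) (v i))
    (h : ∀ i ∈ S, GammaUpper Φ f (Q i) (u i) (L i)) (hL : ∀ i ∈ S, L i ≠ ⊤)
    {ε : ℝ≥0∞} (hε : 0 < ε) :
    ∀ᶠ k in atTop, ∃ (ζ : Euc n → ℝ) (η : Euc n → Euc n), HasOrliczGradient Φ A ζ η ∧
      (∀ x ∉ ⋃ i ∈ S, Q i, η x = 0) ∧ orliczModular Φ A ζ ≤ ε ∧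
      ∑ i ∈ S, fieldEnergy (f k) (Q i) (v i + η) ≤ ∑ i ∈ S, L i + ε := by
  classical
  obtain ⟨ε', hε', hle⟩ := ENNReal.exists_pos_mul_le (ENNReal.natCast_ne_top S.card) hε
  have hQf : ∀ i ∈ S, volume (Q i) < ⊤ := fun i hi => (measure_mono (hQA i hi)).trans_lt hAf
  have hev : ∀ᶠ k in atTop, ∀ i ∈ S, ∃ (ζ : Euc n → ℝ) (η : Euc n → Euc n),
      (∀ x ∉ Q i, ζ x = 0) ∧ (∀ x ∉ Q i, η x = 0) ∧ HasOrliczGradient Φ A ζ η ∧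
      orliczModular Φ (Q i) ζ ≤ ε' ∧ fieldEnergy (f k) (Q i) (v i + η) ≤ L i + ε' := by
    refine (S.eventually_all).2 fun i hi => ?_
    filter_upwards [(h i hi).exists_corrector hΦ hc₁ hc₂ hf (hQo i hi) (hQf i hi) (huv i hi)
      (hL i hi) hε'] with k ⟨ζ, η, h1, h2, h3, h4, h5⟩
    exact ⟨ζ, η, h1, h2, h3 A hAo hAf (hQA i hi), h4, h5⟩
  filter_upwards [hev] with k hk
  choose! ζ η h1 h2 h3 h4 h5 using hk
  have hother : ∀ i ∈ S, ∀ x ∈ Q i, ∀ j ∈ S, j ≠ i → x ∉ Q j := fun i hi x hx j hj hji hx' =>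
    (disjoint_left.1 (hdisj hi hj hji.symm)) hx hx'
  have hζ : ∀ i ∈ S, ∀ x ∈ Q i, (∑ j ∈ S, ζ j) x = ζ i x := by
    intro i hi x hx
    rw [Finset.sum_apply, Finset.sum_eq_single i]
    · exact fun j hj hji => h1 j hj x (hother i hi x hx j hj hji)
    · exact fun h => absurd hi h
  have hη : ∀ i ∈ S, ∀ x ∈ Q i, (∑ j ∈ S, η j) x = η i x := by
    intro i hi x hx
    rw [Finset.sum_apply, Finset.sum_eq_single i]
    · exact fun j hj hji => h2 j hj x (hother i hi x hx j hj hji)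
    · exact fun h => absurd hi h
  have hUm : MeasurableSet (⋃ i ∈ S, Q i) :=
    S.measurableSet_biUnion fun i hi => (hQo i hi).measurableSet
  refine ⟨∑ i ∈ S, ζ i, ∑ i ∈ S, η i, HasOrliczGradient.sum hΦ hAf S h3, ?_, ?_, ?_⟩
  · intro x hx
    rw [Finset.sum_apply]
    refine Finset.sum_eq_zero fun i hi => h2 i hi x fun hx' => hx ?_
    exact mem_biUnion (s := (S : Set ι)) (t := Q) hi hx'
  · calc orliczModular Φ A (∑ i ∈ S, ζ i) = orliczModular Φ (⋃ i ∈ S, Q i) (∑ i ∈ S, ζ i) := by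
          refine setLIntegral_eq_of_forall_diff hUm hAo.measurableSet (iUnion₂_subset hQA) fun x hx => ?_
          have : (∑ i ∈ S, ζ i) x = 0 := by
            rw [Finset.sum_apply]
            refine Finset.sum_eq_zero fun i hi => h1 i hi x fun hx' => hx.2 ?_
            exact mem_biUnion (s := (S : Set ι)) (t := Q) hi hx'
          rw [this]; simp [hΦ.map_zero]
      _ = ∑ i ∈ S, orliczModular Φ (Q i) (∑ i ∈ S, ζ i) :=
          lintegral_biUnion_finset hdisj (fun i hi => (hQo i hi).measurableSet) _
      _ ≤ ∑ i ∈ S, ε' := by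
          refine Finset.sum_le_sum fun i hi => le_of_eq_of_le ?_ (h4 i hi)
          exact setLIntegral_congr_fun (hQo i hi).measurableSet fun x hx => by simp only [hζ i hi x hx]
      _ ≤ ε := by rwa [Finset.sum_const, nsmul_eq_mul]
  · calc ∑ i ∈ S, fieldEnergy (f k) (Q i) (v i + ∑ i ∈ S, η i) ≤ ∑ i ∈ S, (L i + ε') := by
          refine Finset.sum_le_sum fun i hi => le_of_eq_of_le ?_ (h5 i hi)
          exact setLIntegral_congr_fun (hQo i hi).measurableSet fun x hx => by
            simp only [Pi.add_apply, hη i hi x hx]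
      _ ≤ ∑ i ∈ S, L i + ε := by
          rw [Finset.sum_add_distrib, Finset.sum_const, nsmul_eq_mul]
          gcongr

end Energy

/-! ### Weak convergence of gradients and semicontinuity at linear functions -/

section WeakConvergence

variable {n : ℕ} {Φ : ℝ → ℝ} {Ω : Set (Euc n)}

/-- By convexity `Φ(s) / s` is nondecreasing, hence `s ≤ t + (t / Φ(t)) Φ(s)` for every `t > 0`;
choose `t` small, then the modular small. -/
theorem IsYoungFunction.tendsto_lintegral_enorm (hΦ : IsYoungFunction Φ) (hΩ : volume Ω < ⊤)
    {w : ℕ → Euc n → ℝ} (h : Tendsto (fun k => orliczModular Φ Ω (w k)) atTop (𝓝 0)) :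
    Tendsto (fun k => ∫⁻ x in Ω, ‖w k x‖ₑ) atTop (𝓝 0) := by
  rw [ENNReal.tendsto_nhds_zero]
  intro ε hε
  have hε2 : 0 < ε / 2 := ENNReal.half_pos hε.ne'
  obtain ⟨t, ht0, -, ht⟩ := ENNReal.exists_real_mul_le hΩ.ne hε2
  have hp := hΦ.pos ht0
  obtain ⟨δ, hδ, hδ'⟩ := ENNReal.exists_pos_mul_le (K := ENNReal.ofReal (t / Φ t)) (by finiteness) hε2
  filter_upwards [(ENNReal.tendsto_nhds_zero.1 h) δ hδ] with k hk
  calc ∫⁻ x in Ω, ‖w k x‖ₑ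
      ≤ ∫⁻ x in Ω, (ENNReal.ofReal t + ENNReal.ofReal (t / Φ t) * ENNReal.ofReal (Φ ‖w k x‖)) := by
        refine lintegral_mono fun x => ?_
        have h0 := hΦ.nonneg (norm_nonneg (w k x))
        rw [← ENNReal.ofReal_mul (by positivity), ← ENNReal.ofReal_add ht0.le (by positivity),
          ← ofReal_norm]
        refine ENNReal.ofReal_le_ofReal ?_
        rcases le_total ‖w k x‖ t with h1 | h1
        · have : 0 ≤ t / Φ t * Φ ‖w k x‖ := by positivity
          linarith
        · have hw : 0 < ‖w k x‖ := ht0.trans_le h1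
          have h2 := hΦ.map_mul_le (l := t / ‖w k x‖) (by positivity) ((div_le_one hw).2 h1)
            (norm_nonneg (w k x))
          rw [div_mul_cancel₀ _ hw.ne', div_mul_eq_mul_div, le_div_iff₀ hw] at h2
          have h3 : ‖w k x‖ ≤ t / Φ t * Φ ‖w k x‖ := by
            rw [div_mul_eq_mul_div, le_div_iff₀ hp]; linarith
          linarith
    _ = ENNReal.ofReal t * volume Ω + ENNReal.ofReal (t / Φ t) * orliczModular Φ Ω (w k) := by
        rw [lintegral_add_left measurable_const, setLIntegral_const,
          lintegral_const_mul' _ _ ENNReal.ofReal_ne_top]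
        rfl
    _ ≤ ε / 2 + ε / 2 := by
        gcongr
        exact le_trans (by gcongr) hδ'
    _ = ε := ENNReal.add_halves ε

/-- The derivative is moved to the bounded function `∂ᵢψ`, against which `w k → u` in `L¹`. -/
theorem tendsto_integral_gradient_mul (hΦ : IsYoungFunction Φ) (hΩ : volume Ω < ⊤)
    {w : ℕ → Euc n → ℝ} {v : ℕ → Euc n → Euc n} {u : Euc n → ℝ}
    (hwv : ∀ k, HasOrliczGradient Φ Ω (w k) (v k)) (hu : MemOrlicz Φ Ω u)
    (h : Tendsto (fun k => orliczModular Φ Ω (w k - u)) atTop (𝓝 0)) (i : Fin n) {ψ : Euc n → ℝ}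
    (hψ : ContDiff ℝ ∞ ψ) (hc : HasCompactSupport ψ) (hs : tsupport ψ ⊆ Ω) :
    Tendsto (fun k => ∫ x in Ω, v k x i * ψ x) atTop
      (𝓝 (-∫ x in Ω, u x * fderiv ℝ ψ x (EuclideanSpace.single i (1 : ℝ)))) := by
  have e : ∀ k, ∫ x in Ω, v k x i * ψ x =
      -∫ x in Ω, w k x * fderiv ℝ ψ x (EuclideanSpace.single i (1 : ℝ)) := fun k => by
    rw [((hwv k).2 i).2.2.2 ψ hψ hc hs, neg_neg]
  simp only [e]
  have hpc := hψ.continuous_partial (EuclideanSpace.single i (1 : ℝ))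
  have hpc' := hc.partial (EuclideanSpace.single i (1 : ℝ))
  obtain ⟨B, hB⟩ := hpc.bounded_above_of_compact_support hpc'
  refine Tendsto.neg (tendsto_integral_of_L1 _
    (integrable_mul_continuous (InOrlicz.integrableOn hΦ hΩ hu) hpc hpc').aestronglyMeasurable
    (Eventually.of_forall fun k => integrable_mul_continuous ((hwv k).integrableOn hΦ hΩ) hpc hpc') ?_)
  have hlim := ENNReal.Tendsto.const_mul (a := ENNReal.ofReal B) (hΦ.tendsto_lintegral_enorm hΩ h)
    (Or.inr ENNReal.ofReal_ne_top)
  rw [mul_zero] at hlim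
  refine tendsto_of_tendsto_of_tendsto_of_le_of_le tendsto_const_nhds hlim (fun _ => zero_le) fun k => ?_
  dsimp only
  rw [← lintegral_const_mul' _ _ ENNReal.ofReal_ne_top]
  refine lintegral_mono fun x => ?_
  dsimp only
  rw [← sub_mul, enorm_mul, mul_comm]
  refine mul_le_mul' ?_ le_rfl
  rw [← ofReal_norm]
  exact ENNReal.ofReal_le_ofReal (hB x)

theorem integral_le_toReal_orliczModular {v : Euc n → Euc n} (hΦ : IsYoungFunction Φ) (hv : InOrlicz Φ Ω v) :
    IntegrableOn (fun x => Φ ‖v x‖) Ω ∧ ∫ x in Ω, Φ ‖v x‖ = (orliczModular Φ Ω v).toReal := by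
  have hm : AEStronglyMeasurable (fun x => Φ ‖v x‖) (volume.restrict Ω) := by
    have := ((hΦ.measurable_norm (F := ℝ)).comp_aemeasurable hv.1.norm.aemeasurable)
    exact (this.congr (Eventually.of_forall fun x => by simp)).aestronglyMeasurable
  have hnn : 0 ≤ᵐ[volume.restrict Ω] fun x => Φ ‖v x‖ :=
    Eventually.of_forall fun x => hΦ.nonneg (norm_nonneg _)
  refine ⟨⟨hm, ?_⟩, integral_eq_lintegral_of_nonneg_ae hnn hm⟩
  rw [hasFiniteIntegral_iff_ofReal hnn]
  exact hv.2

/-- Lower semicontinuity of the modular of the gradient at affine functions. -/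
theorem modular_linear_le (hΦ : IsYoungFunction Φ) (hΩo : IsOpen Ω) (hb : Bornology.IsBounded Ω)
    {w : ℕ → Euc n → ℝ} {v : ℕ → Euc n → Euc n} {p : Euc n} {M : ℝ≥0∞}
    (hwv : ∀ k, HasOrliczGradient Φ Ω (w k) (v k))
    (h : Tendsto (fun k => orliczModular Φ Ω (w k - fun x => inner ℝ p x)) atTop (𝓝 0))
    (hM : ∀ k, orliczModular Φ Ω (v k) ≤ M) : ENNReal.ofReal (Φ ‖p‖) * volume Ω ≤ M := by
  rcases eq_or_ne M ⊤ with rfl | hMt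
  · exact le_top
  have hΩ : volume Ω < ⊤ := hb.measure_lt_top
  rcases eq_or_ne p 0 with rfl | hp
  · simp [hΦ.map_zero]
  have hp' : 0 < ‖p‖ := norm_pos_iff.2 hp
  have hlin := HasOrliczGradient.linear hΦ hb p
  obtain ⟨s, -, hs0, -, -, hs, -⟩ := hΦ.exists_slope
  -- The vector `c p` is a subgradient of `q ↦ Φ(|q|)` at `p`, which is inequality `hpt`.
  set c := s ‖p‖ / ‖p‖ with hcdef
  have hc0 : 0 ≤ c := div_nonneg (hs0 _) hp'.le
  have hpt : ∀ q : Euc n, Φ ‖p‖ + c * inner ℝ p (q - p) ≤ Φ ‖q‖ := by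
    intro q
    refine le_trans ?_ (hs ‖p‖ ‖q‖ hp'.le (norm_nonneg _))
    have h1 : inner ℝ p (q - p) ≤ ‖p‖ * (‖q‖ - ‖p‖) := by
      rw [inner_sub_right, real_inner_self_eq_norm_sq]
      nlinarith [real_inner_le_norm p q]
    have h2 : c * (‖p‖ * (‖q‖ - ‖p‖)) = s ‖p‖ * (‖q‖ - ‖p‖) := by
      rw [hcdef]; field_simp
    nlinarith [mul_le_mul_of_nonneg_left h1 hc0]
  have key : ∀ K ⊆ Ω, IsCompact K → ENNReal.ofReal (Φ ‖p‖) * volume K ≤ M := by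
    intro K hKΩ hK
    obtain ⟨θ, hθ, hθc, hθs, hθK, hθI⟩ := exists_smooth_cutoff hK hΩo hKΩ
    have hlim : Tendsto (fun k => ∑ i, p i * (∫ x in Ω, v k x i * θ x)) atTop
        (𝓝 (∑ i, p i * ∫ x in Ω, p i * θ x)) := by
      refine tendsto_finsetSum _ fun i _ => Tendsto.const_mul _ ?_
      have := tendsto_integral_gradient_mul hΦ hΩ hwv hlin.1 h i hθ hθc hθs
      rwa [(hlin.2 i).2.2.2 θ hθ hθc hθs, neg_neg] at this
    have hθi : IntegrableOn θ Ω := (hθ.continuous.integrable_of_hasCompactSupport hθc).integrableOn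
    have hineq : ∀ k, Φ ‖p‖ * ∫ x in Ω, θ x ≤ M.toReal -
        c * ((∑ i, p i * (∫ x in Ω, v k x i * θ x)) - ∑ i, p i * ∫ x in Ω, p i * θ x) := by
      intro k
      obtain ⟨hi, he⟩ := integral_le_toReal_orliczModular hΦ ((hwv k).inOrlicz hΦ)
      have hvi : ∀ i, IntegrableOn (fun x => v k x i * θ x) Ω := fun i =>
        integrable_mul_continuous ((hwv k).integrableOn_apply hΦ hΩ i) hθ.continuous hθc
      -- The subgradient inequality is multiplied by the cutoff `θ ≤ 1` and integrated; the linear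
      -- term then vanishes in the limit, as `θ` is an admissible test function.
      have hle : ∫ x in Ω, (Φ ‖p‖ * θ x + c * ((∑ i, p i * (v k x i * θ x)) -
          ∑ i, p i * (p i * θ x))) ≤ ∫ x in Ω, Φ ‖v k x‖ := by
        refine integral_mono ?_ hi fun x => ?_
        · refine (hθi.const_mul _).add (Integrable.const_mul (Integrable.sub ?_ ?_) _)
          · exact integrable_finsetSum _ fun i _ => (hvi i).const_mul _
          · exact integrable_finsetSum _ fun i _ => (hθi.const_mul _).const_mul _
        · dsimp only
          have e : (∑ i, p i * (v k x i * θ x)) - ∑ i, p i * (p i * θ x) =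
              θ x * inner ℝ p (v k x - p) := by
            rw [PiLp.inner_apply, ← Finset.sum_sub_distrib, Finset.mul_sum]
            refine Finset.sum_congr rfl fun i _ => ?_
            simp
            ring
          rw [e]
          have h1 := hpt (v k x)
          have h2 := hΦ.nonneg (norm_nonneg (v k x))
          have h3 := hθI x
          nlinarith [mul_le_mul_of_nonneg_left h1 h3.1, mul_le_mul_of_nonneg_right h3.2 h2]
      have i1 : IntegrableOn (fun x => ∑ i, p i * (v k x i * θ x)) Ω :=
        integrable_finsetSum _ fun i _ => (hvi i).const_mul _
      have i2 : IntegrableOn (fun x => ∑ i, p i * (p i * θ x)) Ω :=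
        integrable_finsetSum _ fun i _ => (hθi.const_mul _).const_mul _
      have i3 : IntegrableOn (fun x => c * ((∑ i, p i * (v k x i * θ x)) -
          ∑ i, p i * (p i * θ x))) Ω := Integrable.const_mul (i1.sub i2) _
      rw [integral_add (hθi.const_mul _) i3, integral_const_mul, integral_const_mul,
        integral_sub i1 i2, integral_finsetSum _ fun i _ => (hvi i).const_mul _,
        integral_finsetSum _ fun i _ => (hθi.const_mul _).const_mul _, he] at hle
      simp only [integral_const_mul] at hle ⊢
      have := ENNReal.toReal_mono hMt (hM k)
      linarith
    have hlim2 : Tendsto (fun k => M.toReal -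
        c * ((∑ i, p i * (∫ x in Ω, v k x i * θ x)) - ∑ i, p i * ∫ x in Ω, p i * θ x)) atTop
        (𝓝 (M.toReal - c * ((∑ i, p i * ∫ x in Ω, p i * θ x) - ∑ i, p i * ∫ x in Ω, p i * θ x))) :=
      tendsto_const_nhds.sub ((hlim.sub_const _).const_mul _)
    have hfin := ge_of_tendsto' hlim2 hineq
    rw [sub_self, mul_zero, sub_zero] at hfin
    have hKθ : volume.real K ≤ ∫ x in Ω, θ x := by
      have : ∫ x in Ω, K.indicator (fun _ => (1 : ℝ)) x ≤ ∫ x in Ω, θ x := by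
        refine integral_mono ?_ hθi fun x => ?_
        · exact (integrable_indicator_iff hK.measurableSet).2
            (integrableOn_const (hs := ((Measure.restrict_apply_le _ _).trans_lt hK.measure_lt_top).ne))
        · by_cases hx : x ∈ K
          · simp [hx, hθK x hx]
          · simp [hx, (hθI x).1]
      rwa [setIntegral_indicator hK.measurableSet, inter_eq_self_of_subset_right hKΩ,
        setIntegral_const, smul_eq_mul, mul_one] at this
    have hΦ0 := hΦ.nonneg hp'.le
    have h4 : Φ ‖p‖ * volume.real K ≤ M.toReal := (mul_le_mul_of_nonneg_left hKθ hΦ0).trans hfin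
    rw [← ENNReal.ofReal_toReal hMt, ← ENNReal.ofReal_toReal hK.measure_lt_top.ne,
      ← ENNReal.ofReal_mul hΦ0]
    exact ENNReal.ofReal_le_ofReal h4
  -- Inner regularity removes the cutoff.
  rw [hΩo.measure_eq_iSup_isCompact]
  simp only [ENNReal.mul_iSup]
  exact iSup₂_le fun K hK => iSup_le fun hKc => key K hK hKc

end WeakConvergence

/-! ### Structure of Γ-limits: lower bound, superadditivity, convexity -/

section GammaLimits

variable {n : ℕ} {Φ : ℝ → ℝ} {c₁ c₂ : ℝ} {f : ℕ → Euc n → Euc n → ℝ} {A : Set (Euc n)}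
  {u : Euc n → ℝ} {L L' : ℝ≥0∞}

/-- Coercivity turns the energies of a recovery sequence into modulars of gradients, which are lower
semicontinuous at linear functions. -/
theorem GammaUpper.le_of_linear (hΦ : IsYoungFunction Φ) (hc₁ : 0 < c₁)
    (hf : ∀ k, IsConvexIntegrand c₁ c₂ Φ (f k)) (hAo : IsOpen A) (hb : Bornology.IsBounded A)
    {p : Euc n} (h : GammaUpper Φ f A (fun x => inner ℝ p x) L) :
    ENNReal.ofReal (c₁ * Φ ‖p‖) * volume A ≤ L := by
  have h0 : ENNReal.ofReal c₁ ≠ 0 := (ENNReal.ofReal_pos.2 hc₁).ne'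
  have key : ∀ ε : ℝ≥0∞, 0 < ε → ENNReal.ofReal (Φ ‖p‖) * volume A ≤ (ENNReal.ofReal c₁)⁻¹ * (L + ε) := by
    intro ε hε
    have hm : ∀ m : ℕ, 0 < min ε ((m : ℝ≥0∞) + 1)⁻¹ := fun m =>
      lt_min hε (ENNReal.inv_pos.2 (by finiteness))
    -- The indices `k m` need not increase: only the coercivity constant, the same for every `f k`,
    -- is used.
    choose k w v h1 h2 h3 using fun m : ℕ => (h _ (hm m)).exists
    refine modular_linear_le hΦ hAo hb h1 ?_ fun m => ?_
    · refine tendsto_of_tendsto_of_tendsto_of_le_of_le tendsto_const_nhds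
        ENNReal.tendsto_inv_nat_nhds_zero (fun _ => zero_le)
        fun m => (h2 m).trans ((min_le_right _ _).trans ?_)
      exact ENNReal.inv_le_inv.2 le_self_add
    · refine ((hf (k m)).orliczModular_le_fieldEnergy hc₁ A (v m)).trans ?_
      gcongr
      exact (h3 m).trans (by gcongr; exact min_le_left _ _)
  refine ENNReal.le_of_forall_pos_le_add fun ε hε _ => ?_
  have := key ε (by simpa using hε)
  rw [← ENNReal.mul_le_iff_le_inv h0 ENNReal.ofReal_ne_top] at this
  rwa [ENNReal.ofReal_mul hc₁.le, mul_assoc]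

theorem GammaLower.mono (h : GammaLower Φ f A u L) (hL : L' ≤ L) : GammaLower Φ f A u L' :=
  fun ε hε => (h ε hε).imp fun _ ⟨hδ, hk⟩ => ⟨hδ, hk.mono fun _ H w v h1 h2 => hL.trans (H w v h1 h2)⟩

/-- A competitor on `A` restricts to a competitor on each `Q i`, and the energies on disjoint sets
add up to at most the energy on `A`. -/
theorem GammaLower.sum (hΦ : IsYoungFunction Φ) (hAo : IsOpen A) (hAf : volume A < ⊤)
    {ι : Type*} (S : Finset ι) {Q : ι → Set (Euc n)} (hQo : ∀ i ∈ S, IsOpen (Q i))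
    (hQA : ∀ i ∈ S, Q i ⊆ A) (hdisj : (S : Set ι).PairwiseDisjoint Q) {L : ι → ℝ≥0∞}
    (h : ∀ i ∈ S, GammaLower Φ f (Q i) u (L i)) : GammaLower Φ f A u (∑ i ∈ S, L i) := by
  intro ε hε
  obtain ⟨ε', hε', hle⟩ := ENNReal.exists_pos_mul_le (ENNReal.natCast_ne_top S.card) hε
  have h' : ∀ i ∈ S, ∃ δ : ℝ≥0∞, 0 < δ ∧ ∀ᶠ k in atTop, ∀ w v, HasOrliczGradient Φ (Q i) w v →
    orliczModular Φ (Q i) (w - u) ≤ δ → L i ≤ fieldEnergy (f k) (Q i) v + ε' := fun i hi => h i hi ε' hε'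
  choose! δ hδ hk using h'
  have hinf : ∃ d : ℝ≥0∞, 0 < d ∧ ∀ i ∈ S, d ≤ δ i := by
    refine ⟨S.inf δ, ?_, fun i hi => Finset.inf_le hi⟩
    rw [Finset.lt_inf_iff (by simp)]
    exact hδ
  obtain ⟨d, hd, hd'⟩ := hinf
  refine ⟨d, hd, ?_⟩
  filter_upwards [(S.eventually_all).2 hk] with k hk w v hwv hm
  calc ∑ i ∈ S, L i ≤ ∑ i ∈ S, (fieldEnergy (f k) (Q i) v + ε') := by
        refine Finset.sum_le_sum fun i hi => hk i hi w v (hwv.mono_set hΦ hAo hAf (hQA i hi)) ?_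
        exact (orliczModular_mono_set (hQA i hi) _).trans (hm.trans (hd' i hi))
    _ ≤ fieldEnergy (f k) A v + ε := by
        rw [Finset.sum_add_distrib, Finset.sum_const, nsmul_eq_mul]
        gcongr
        unfold fieldEnergy
        rw [← lintegral_biUnion_finset hdisj (fun i hi => (hQo i hi).measurableSet)]
        exact lintegral_mono_set (iUnion₂_subset hQA)

/-- Infimum of the energy over the functions at modular distance at most `1 / (m + 1)` of `u`. -/
noncomputable def localInf {n : ℕ} (Φ : ℝ → ℝ) (g : Euc n → Euc n → ℝ) (A : Set (Euc n))
    (u : Euc n → ℝ) (m : ℕ) : ℝ≥0∞ :=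
  ⨅ (w : Euc n → ℝ) (v : Euc n → Euc n) (_ : HasOrliczGradient Φ A w v ∧
    orliczModular Φ A (w - u) ≤ ((m : ℝ≥0∞) + 1)⁻¹), fieldEnergy g A v

/-- With the next lemma: if the local infima converge in `k` at every radius, the supremum over the
radii of the limits is the `Γ`-limit. -/
theorem gammaUpper_of_tendsto_localInf {J : ℕ → ℝ≥0∞} (hJL : ∀ m, J m ≤ L) (hL : L ≠ ⊤)
    (hJ : ∀ m, Tendsto (fun k => localInf Φ (f k) A u m) atTop (𝓝 (J m))) : GammaUpper Φ f A u L := by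
  intro ε hε
  obtain ⟨m, hm⟩ := ENNReal.exists_inv_nat_lt hε.ne'
  have hlt : J m < L + ε := (hJL m).trans_lt (ENNReal.lt_add_right hL hε.ne')
  filter_upwards [(hJ m).eventually_lt_const hlt] with k hk
  simp only [localInf, iInf_lt_iff] at hk
  obtain ⟨w, v, ⟨h1, h2⟩, h3⟩ := hk
  exact ⟨w, v, h1, h2.trans ((ENNReal.inv_le_inv.2 le_self_add).trans hm.le), h3.le⟩

theorem gammaLower_of_tendsto_localInf {J : ℕ → ℝ≥0∞} (hL : ⨆ m, J m ≠ ⊤)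
    (hJ : ∀ m, Tendsto (fun k => localInf Φ (f k) A u m) atTop (𝓝 (J m))) :
    GammaLower Φ f A u (⨆ m, J m) := by
  intro ε hε
  -- The strict inequality obtained by subtracting `ε` fails when the supremum is `0`.
  rcases eq_or_ne (⨆ m, J m) 0 with h0 | h0
  · exact ⟨1, one_pos, Eventually.of_forall fun k w v _ _ => by rw [h0]; exact zero_le⟩
  obtain ⟨m, hm⟩ := lt_iSup_iff.1 (ENNReal.sub_lt_self hL h0 hε.ne')
  refine ⟨((m : ℝ≥0∞) + 1)⁻¹, ENNReal.inv_pos.2 (by finiteness), ?_⟩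
  filter_upwards [(hJ m).eventually_const_lt hm] with k hk w v h1 h2
  exact tsub_le_iff_right.1 (hk.le.trans (iInf_le_of_le w (iInf_le_of_le v (iInf_le _ ⟨h1, h2⟩))))

/-- Convex combinations of recovery sequences are competitors, both the modular and the energy being
convex. -/
theorem GammaUpper.convex_comb (hΦ : IsYoungFunction Φ) (hc₁ : 0 < c₁)
    (hf : ∀ k, IsConvexIntegrand c₁ c₂ Φ (f k)) (hAf : volume A < ⊤) {u' : Euc n → ℝ}
    (hu' : AEStronglyMeasurable u' (volume.restrict A))
    (h : GammaUpper Φ f A u L) (h' : GammaUpper Φ f A u' L') {a b : ℝ} (ha : 0 ≤ a) (hb : 0 ≤ b)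
    (hab : a + b = 1) :
    GammaUpper Φ f A (a • u + b • u') (ENNReal.ofReal a * L + ENNReal.ofReal b * L') := by
  intro ε hε
  filter_upwards [h ε hε, h' ε hε] with k ⟨w, v, h1, h2, h3⟩ ⟨w', v', h1', h2', h3'⟩
  have hε1 : ENNReal.ofReal a * ε + ENNReal.ofReal b * ε = ε := by
    rw [← add_mul, ← ENNReal.ofReal_add ha hb, hab, ENNReal.ofReal_one, one_mul]
  refine ⟨a • w + b • w', a • v + b • v', (h1.const_smul hΦ hAf a).add hΦ hAf (h1'.const_smul hΦ hAf b),
    ?_, ?_⟩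
  · calc orliczModular Φ A (a • w + b • w' - (a • u + b • u'))
        ≤ ∫⁻ x in A, (ENNReal.ofReal a * ENNReal.ofReal (Φ ‖(w - u) x‖) +
            ENNReal.ofReal b * ENNReal.ofReal (Φ ‖(w' - u') x‖)) := by
          refine lintegral_mono fun x => ?_
          rw [← ENNReal.ofReal_mul ha, ← ENNReal.ofReal_mul hb, ← ENNReal.ofReal_add
            (mul_nonneg ha (hΦ.nonneg (norm_nonneg _))) (mul_nonneg hb (hΦ.nonneg (norm_nonneg _)))]
          refine ENNReal.ofReal_le_ofReal ?_
          refine le_of_eq_of_le ?_ (hΦ.norm_convex_comb_le ha hb hab ((w - u) x) ((w' - u') x))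
          congr 2
          simp only [Pi.sub_apply, Pi.add_apply, Pi.smul_apply, smul_eq_mul]
          ring
      _ = ENNReal.ofReal a * orliczModular Φ A (w - u) + ENNReal.ofReal b * orliczModular Φ A (w' - u') := by
          rw [lintegral_add_right', lintegral_const_mul' _ _ ENNReal.ofReal_ne_top,
            lintegral_const_mul' _ _ ENNReal.ofReal_ne_top]
          · rfl
          · exact (hΦ.aemeasurable_ofReal_norm (h1'.1.1.sub hu')).const_mul _
      _ ≤ ENNReal.ofReal a * ε + ENNReal.ofReal b * ε := by gcongr
      _ = ε := hε1
  · calc fieldEnergy (f k) A (a • v + b • v')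
        ≤ ENNReal.ofReal a * fieldEnergy (f k) A v + ENNReal.ofReal b * fieldEnergy (f k) A v' :=
          (hf k).fieldEnergy_convex_le hΦ hc₁ (h1'.inOrlicz hΦ).1 ha hb hab
      _ ≤ ENNReal.ofReal a * (L + ε) + ENNReal.ofReal b * (L' + ε) := by gcongr
      _ = ENNReal.ofReal a * L + ENNReal.ofReal b * L' + (ENNReal.ofReal a * ε + ENNReal.ofReal b * ε) := by
          ring
      _ = _ := by rw [hε1]

end GammaLimits

/-! ### Dyadic cubes and densities of additive set functions -/

section Dyadic

variable {n : ℕ}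

/-- The index of the dyadic cell of generation `j` that contains `x`. -/
noncomputable def dyadicIndex {n : ℕ} (j : ℕ) (x : Euc n) : Fin n → ℤ := fun i => ⌊(2 : ℝ) ^ j * x i⌋

/-- The half-open dyadic cell of generation `j` and index `z`. -/
def dyadicCell {n : ℕ} (j : ℕ) (z : Fin n → ℤ) : Set (Euc n) := dyadicIndex j ⁻¹' {z}

/-- The open dyadic cube of generation `j` and index `z`. -/
def dyadicCube {n : ℕ} (j : ℕ) (z : Fin n → ℤ) : Set (Euc n) :=
  {x | ∀ i, (z i : ℝ) < 2 ^ j * x i ∧ 2 ^ j * x i < z i + 1}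

theorem measurable_dyadicIndex (j : ℕ) : Measurable (dyadicIndex (n := n) j) := by
  refine measurable_pi_lambda _ fun i => Int.measurable_floor.comp ?_
  have : Continuous fun x : Euc n => (2 : ℝ) ^ j * x i := by fun_prop
  exact this.measurable

theorem measurableSet_dyadicCell (j : ℕ) (z : Fin n → ℤ) : MeasurableSet (dyadicCell j z) :=
  measurable_dyadicIndex j (measurableSet_singleton z)

theorem mem_dyadicCell {j : ℕ} {z : Fin n → ℤ} {x : Euc n} :
    x ∈ dyadicCell j z ↔ ∀ i, (z i : ℝ) ≤ 2 ^ j * x i ∧ 2 ^ j * x i < z i + 1 := by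
  simp only [dyadicCell, mem_preimage, mem_singleton_iff, funext_iff, dyadicIndex, Int.floor_eq_iff]

theorem dyadicCube_subset_dyadicCell (j : ℕ) (z : Fin n → ℤ) : dyadicCube j z ⊆ dyadicCell j z :=
  fun _ hx => mem_dyadicCell.2 fun i => ⟨(hx i).1.le, (hx i).2⟩

theorem isOpen_dyadicCube (j : ℕ) (z : Fin n → ℤ) : IsOpen (dyadicCube j z) := by
  have : dyadicCube j z = ⋂ i, {x : Euc n | (z i : ℝ) < 2 ^ j * x i ∧ 2 ^ j * x i < z i + 1} := by
    ext x; simp [dyadicCube]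
  rw [this]
  refine isOpen_iInter_of_finite fun i => ?_
  have hc : Continuous fun x : Euc n => (2 : ℝ) ^ j * x i := by fun_prop
  exact (isOpen_lt continuous_const hc).inter (isOpen_lt hc continuous_const)

theorem norm_sub_le_of_mem_dyadicCell {j : ℕ} {z : Fin n → ℤ} {x y : Euc n} (hx : x ∈ dyadicCell j z)
    (hy : y ∈ dyadicCell j z) : ‖x - y‖ ≤ n * ((2 : ℝ) ^ j)⁻¹ := by
  refine (norm_le_sum_abs _).trans ?_
  have : ∀ i ∈ Finset.univ, |(x - y) i| ≤ ((2 : ℝ) ^ j)⁻¹ := by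
    intro i _
    have h1 := mem_dyadicCell.1 hx i
    have h2 := mem_dyadicCell.1 hy i
    have h3 : |(2 : ℝ) ^ j * (x - y) i| ≤ 1 := by
      rw [PiLp.sub_apply, mul_sub, abs_le]
      constructor <;> linarith
    rw [abs_mul, abs_of_pos (by positivity)] at h3
    rw [← one_div, le_div_iff₀' (by positivity)]
    exact h3
  refine (Finset.sum_le_sum this).trans ?_
  simp

theorem isBounded_dyadicCell (j : ℕ) (z : Fin n → ℤ) : Bornology.IsBounded (dyadicCell j z) := by
  refine Metric.isBounded_iff.2 ⟨n * ((2 : ℝ) ^ j)⁻¹, fun x hx y hy => ?_⟩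
  rw [dist_eq_norm]
  exact norm_sub_le_of_mem_dyadicCell hx hy

theorem volume_dyadicCell_lt_top (j : ℕ) (z : Fin n → ℤ) : volume (dyadicCell j z) < ⊤ :=
  (isBounded_dyadicCell j z).measure_lt_top

theorem volume_dyadicCube_pos (j : ℕ) (z : Fin n → ℤ) : 0 < volume (dyadicCube j z) := by
  refine (isOpen_dyadicCube j z).measure_pos volume
    ⟨WithLp.toLp 2 fun i => ((z i : ℝ) + 1 / 2) / 2 ^ j, fun i => ?_⟩
  have : (2 : ℝ) ^ j * (((z i : ℝ) + 1 / 2) / 2 ^ j) = z i + 1 / 2 := by field_simp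
  simp only [this]
  constructor <;> linarith

/-- The difference lies in finitely many coordinate hyperplanes. Half-open cells partition space
exactly, while open cubes are what Sobolev functions need; this allows switching between the two. -/
theorem volume_dyadicCell_sdiff (j : ℕ) (z : Fin n → ℤ) : volume (dyadicCell j z \ dyadicCube j z) = 0 := by
  have hsub : dyadicCell j z \ dyadicCube j z ⊆ ⋃ i, {x : Euc n | x i = z i / 2 ^ j} := by
    intro x hx
    obtain ⟨h1, h0⟩ := hx
    obtain ⟨i, hi⟩ := not_forall.1 h0
    have h2 := mem_dyadicCell.1 h1 i
    refine mem_iUnion.2 ⟨i, ?_⟩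
    have : (z i : ℝ) = 2 ^ j * x i := by
      refine le_antisymm h2.1 (not_lt.1 fun h => hi ⟨h, h2.2⟩)
    show x i = z i / 2 ^ j
    rw [this]
    field_simp
  refine measure_mono_null hsub (measure_iUnion_null fun i => ?_)
  have := (PiLp.volume_preserving_ofLp (Fin n)).measure_preimage
    (s := {y : Fin n → ℝ | y i = z i / 2 ^ j})
    (measurableSet_eq_fun (measurable_pi_apply i) measurable_const).nullMeasurableSet
  exact this.trans (Measure.pi_hyperplane _ i _)

theorem dyadicCube_ae_eq (j : ℕ) (z : Fin n → ℤ) : dyadicCube j z =ᵐ[volume] dyadicCell j z := by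
  refine (dyadicCube_subset_dyadicCell j z).eventuallyLE.antisymm ?_
  rw [ae_le_set]
  exact volume_dyadicCell_sdiff j z

/-- The indices of the cells of the next generation contained in a dyadic cell. -/
def dyadicChildren {n : ℕ} (z : Fin n → ℤ) : Finset (Fin n → ℤ) :=
  Fintype.piFinset fun i => {2 * z i, 2 * z i + 1}

theorem mem_dyadicChildren {z z' : Fin n → ℤ} : z' ∈ dyadicChildren z ↔ ∀ i, z' i / 2 = z i := by
  simp only [dyadicChildren, Fintype.mem_piFinset, Finset.mem_insert, Finset.mem_singleton]
  refine forall_congr' fun i => ?_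
  omega

theorem dyadicIndex_succ (j : ℕ) (x : Euc n) (i : Fin n) :
    dyadicIndex (j + 1) x i / 2 = dyadicIndex j x i := by
  have := Int.floor_div_natCast ((2 : ℝ) ^ (j + 1) * x i) 2
  simp only [dyadicIndex]
  rw [← Nat.cast_ofNat (R := ℤ), ← this]
  congr 1
  push_cast
  ring

theorem dyadicCell_eq_biUnion (j : ℕ) (z : Fin n → ℤ) :
    dyadicCell j z = ⋃ z' ∈ dyadicChildren z, dyadicCell (j + 1) z' := by
  ext x
  simp only [dyadicCell, mem_preimage, mem_singleton_iff, mem_iUnion, mem_dyadicChildren, exists_prop]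
  constructor
  · rintro rfl
    exact ⟨_, dyadicIndex_succ j x, rfl⟩
  · rintro ⟨z', h, rfl⟩
    ext i
    rw [← h i, dyadicIndex_succ]

theorem pairwiseDisjoint_dyadicCell (j : ℕ) (S : Set (Fin n → ℤ)) :
    S.PairwiseDisjoint (dyadicCell (n := n) j) := fun z _ _ _ h => disjoint_left.2 fun x hx hx' =>
  h ((show dyadicIndex j x = z from hx).symm.trans hx')

theorem pairwiseDisjoint_dyadicCube (j : ℕ) (S : Set (Fin n → ℤ)) :
    S.PairwiseDisjoint (dyadicCube (n := n) j) :=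
  (pairwiseDisjoint_dyadicCell j S).mono fun z => dyadicCube_subset_dyadicCell j z

theorem dyadicCube_succ_subset {j : ℕ} {z z' : Fin n → ℤ} (h : z' ∈ dyadicChildren z) :
    dyadicCube (j + 1) z' ⊆ dyadicCube j z := by
  intro x hx i
  have h1 : z' i / 2 = z i := mem_dyadicChildren.1 h i
  have h2 : 2 * z i ≤ z' i ∧ z' i + 1 ≤ 2 * z i + 2 := by omega
  have h3 := hx i
  have h4 : ((2 * z i : ℤ) : ℝ) ≤ z' i := by exact_mod_cast h2.1
  have h5 : ((z' i + 1 : ℤ) : ℝ) ≤ (2 * z i + 2 : ℤ) := by exact_mod_cast h2.2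
  push_cast at h4 h5
  rw [pow_succ] at h3
  constructor <;> nlinarith [h3.1, h3.2]

/-- The filtration generated by the dyadic cells. -/
noncomputable def dyadicFiltration (n : ℕ) : Filtration ℕ (inferInstance : MeasurableSpace (Euc n)) where
  seq j := MeasurableSpace.comap (dyadicIndex j) ⊤
  mono' := by
    refine monotone_nat_of_le_succ fun j => ?_
    rintro _ ⟨T, -, rfl⟩
    refine ⟨(fun z i => z i / 2) ⁻¹' T, trivial, ?_⟩
    ext x
    simp only [mem_preimage]
    rw [show (fun i => dyadicIndex (j + 1) x i / 2) = dyadicIndex j x from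
      funext (dyadicIndex_succ j x)]
  le' j := by
    rintro _ ⟨T, -, rfl⟩
    exact measurable_dyadicIndex j (Set.to_countable T).measurableSet

variable (m : ℕ → (Fin n → ℤ) → ℝ≥0∞)

/-- The averages of a set function over the dyadic cells. -/
noncomputable def dyadicAverage (j : ℕ) (x : Euc n) : ℝ≥0∞ :=
  m j (dyadicIndex j x) / volume (dyadicCell (n := n) j (dyadicIndex j x))

theorem measurable_dyadicAverage (j : ℕ) : Measurable (dyadicAverage m j) :=
  (measurable_of_countable (fun z => m j z / volume (dyadicCell (n := n) j z))).comp
    (measurable_dyadicIndex j)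

variable {m}

theorem volume_dyadicCell_ne_zero (j : ℕ) (z : Fin n → ℤ) : volume (dyadicCell j z) ≠ 0 :=
  ((volume_dyadicCube_pos j z).trans_le (measure_mono (dyadicCube_subset_dyadicCell j z))).ne'

theorem setLIntegral_dyadicAverage (j : ℕ) (z : Fin n → ℤ) :
    ∫⁻ x in dyadicCell j z, dyadicAverage m j x = m j z := by
  rw [setLIntegral_congr_fun (g := fun _ => m j z / volume (dyadicCell (n := n) j z))
    (measurableSet_dyadicCell j z), setLIntegral_const]
  · exact ENNReal.div_mul_cancel (volume_dyadicCell_ne_zero j z) (volume_dyadicCell_lt_top j z).ne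
  · intro x hx
    have : dyadicIndex j x = z := hx
    simp [dyadicAverage, this]

/-- The martingale identity: a set of the `j`-th σ-algebra is a countable disjoint union of cells of
generation `j`, on each of which it is additivity over the children. -/
theorem setLIntegral_dyadicAverage_succ (hadd : ∀ j z, ∑ z' ∈ dyadicChildren z, m (j + 1) z' = m j z)
    {j : ℕ} {s : Set (Euc n)} (hs : MeasurableSet[dyadicFiltration n j] s) :
    ∫⁻ x in s, dyadicAverage m (j + 1) x = ∫⁻ x in s, dyadicAverage m j x := by
  obtain ⟨T, -, rfl⟩ := hs
  have e : dyadicIndex j ⁻¹' T = ⋃ z ∈ T, dyadicCell (n := n) j z := by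
    ext x; simp [dyadicCell]
  rw [e, lintegral_biUnion (Set.to_countable T) (fun z _ => measurableSet_dyadicCell j z)
    (pairwiseDisjoint_dyadicCell j T), lintegral_biUnion (Set.to_countable T)
    (fun z _ => measurableSet_dyadicCell j z) (pairwiseDisjoint_dyadicCell j T)]
  refine tsum_congr fun z => ?_
  rw [setLIntegral_dyadicAverage, dyadicCell_eq_biUnion,
    lintegral_biUnion_finset (pairwiseDisjoint_dyadicCell _ _) fun _ _ => measurableSet_dyadicCell _ _]
  simp only [setLIntegral_dyadicAverage]
  exact hadd j z

theorem measurableSet_dyadicFiltration_cell {i j : ℕ} (h : i ≤ j) (z : Fin n → ℤ) :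
    MeasurableSet[dyadicFiltration n j] (dyadicCell i z) :=
  (dyadicFiltration n).mono h _ ⟨{z}, trivial, rfl⟩

theorem setLIntegral_dyadicAverage_of_le (hadd : ∀ j z, ∑ z' ∈ dyadicChildren z, m (j + 1) z' = m j z)
    {i j : ℕ} (h : i ≤ j) (z : Fin n → ℤ) : ∫⁻ x in dyadicCell i z, dyadicAverage m j x = m i z := by
  induction j, h using Nat.le_induction with
  | base => exact setLIntegral_dyadicAverage i z
  | succ j hij ih =>
    rw [setLIntegral_dyadicAverage_succ hadd (measurableSet_dyadicFiltration_cell hij z), ih]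

theorem dyadicAverage_le {C : ℝ≥0∞} (hC : ∀ j z, m j z ≤ C * volume (dyadicCell j z)) (j : ℕ) (x : Euc n) :
    dyadicAverage m j x ≤ C :=
  ENNReal.div_le_of_le_mul (hC _ _)

/-- On each cell of generation `0`, a set of finite measure, the averages are a bounded martingale
and converge almost everywhere; countably many such cells cover the space. -/
theorem ae_tendsto_dyadicAverage {C : ℝ≥0∞} (hCt : C ≠ ⊤)
    (hC : ∀ j z, m j z ≤ C * volume (dyadicCell j z))
    (hadd : ∀ j z, ∑ z' ∈ dyadicChildren z, m (j + 1) z' = m j z) :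
    ∀ᵐ x : Euc n, ∃ l : ℝ, Tendsto (fun j => (dyadicAverage m j x).toReal) atTop (𝓝 l) := by
  have hlt : ∀ j x, dyadicAverage m j x < ⊤ := fun j x => (dyadicAverage_le hC j x).trans_lt hCt.lt_top
  have hcell : ∀ z, ∀ᵐ x ∂volume.restrict (dyadicCell (n := n) 0 z),
      ∃ l : ℝ, Tendsto (fun j => (dyadicAverage m j x).toReal) atTop (𝓝 l) := by
    intro z
    have : IsFiniteMeasure (volume.restrict (dyadicCell (n := n) 0 z)) :=
      ⟨by rw [Measure.restrict_apply_univ]; exact volume_dyadicCell_lt_top 0 z⟩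
    have hbd : ∀ j x, ‖(dyadicAverage m j x).toReal‖ ≤ C.toReal := fun j x => by
      rw [Real.norm_of_nonneg ENNReal.toReal_nonneg]
      exact ENNReal.toReal_mono hCt (dyadicAverage_le hC j x)
    have hmeas : ∀ j, Measurable fun x => (dyadicAverage m j x).toReal := fun j =>
      (measurable_dyadicAverage m j).ennreal_toReal
    have hint : ∀ j, Integrable (fun x => (dyadicAverage m j x).toReal)
        (volume.restrict (dyadicCell (n := n) 0 z)) := fun j =>
      Integrable.of_bound (hmeas j).aestronglyMeasurable _ (Eventually.of_forall (hbd j))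
    have hadp : StronglyAdapted (dyadicFiltration n) fun j x => (dyadicAverage m j x).toReal := by
      intro j
      have h1 : Measurable[dyadicFiltration n j] (dyadicIndex (n := n) j) := by
        intro T _
        exact ⟨T, trivial, rfl⟩
      have h2 : Measurable fun z : Fin n → ℤ => (m j z / volume (dyadicCell (n := n) j z)).toReal :=
        measurable_of_countable _
      exact Measurable.stronglyMeasurable (h2.comp h1)
    have hmart : Martingale (fun j x => (dyadicAverage m j x).toReal) (dyadicFiltration n)
        (volume.restrict (dyadicCell (n := n) 0 z)) := by
      refine martingale_nat hadp hint fun j => ?_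
      refine ae_eq_condExp_of_forall_setIntegral_eq ((dyadicFiltration n).le j) (hint (j + 1))
        (fun s _ _ => (hint j).integrableOn) (fun s hs _ => ?_) (hadp j).aestronglyMeasurable
      have hs' := (dyadicFiltration n).le j s hs
      rw [Measure.restrict_restrict hs', integral_toReal (measurable_dyadicAverage m j).aemeasurable
        (Eventually.of_forall (hlt j)), integral_toReal (measurable_dyadicAverage m (j + 1)).aemeasurable
        (Eventually.of_forall (hlt (j + 1))), setLIntegral_dyadicAverage_succ hadd]
      exact hs.inter (measurableSet_dyadicFiltration_cell (Nat.zero_le j) z)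
    have hR : ∀ j, eLpNorm (fun x => (dyadicAverage m j x).toReal) 1
        (volume.restrict (dyadicCell (n := n) 0 z)) ≤
        ((volume (dyadicCell (n := n) 0 z) * C).toNNReal : ℝ≥0∞) := by
      intro j
      rw [ENNReal.coe_toNNReal (ENNReal.mul_ne_top (volume_dyadicCell_lt_top 0 z).ne hCt)]
      refine (eLpNorm_le_of_ae_bound (Eventually.of_forall (hbd j))).trans ?_
      simp [ENNReal.ofReal_toReal hCt]
    exact (hmart.submartingale.ae_tendsto_limitProcess hR).mono fun x hx => ⟨_, hx⟩
  have : (⋃ z, dyadicCell (n := n) 0 z) = univ := by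
    ext x; simp [dyadicCell]
  rw [← Measure.restrict_univ (μ := (volume : Measure (Euc n))), ← this, ae_restrict_iUnion_iff]
  exact hcell

/-- A bounded additive function of dyadic cells has a density. -/
theorem setLIntegral_limsup_dyadicAverage {C : ℝ≥0∞} (hCt : C ≠ ⊤)
    (hC : ∀ j z, m j z ≤ C * volume (dyadicCell j z))
    (hadd : ∀ j z, ∑ z' ∈ dyadicChildren z, m (j + 1) z' = m j z) (i : ℕ) (z : Fin n → ℤ) :
    ∫⁻ x in dyadicCell i z, limsup (fun j => dyadicAverage m j x) atTop = m i z := by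
  have hlim : ∀ᵐ x ∂volume.restrict (dyadicCell i z), Tendsto (fun j => dyadicAverage m j x) atTop
      (𝓝 (limsup (fun j => dyadicAverage m j x) atTop)) := by
    filter_upwards [ae_restrict_of_ae (ae_tendsto_dyadicAverage hCt hC hadd)] with x ⟨l, hl⟩
    have h1 := ENNReal.tendsto_ofReal hl
    simp only [ENNReal.ofReal_toReal ((dyadicAverage_le hC _ x).trans_lt hCt.lt_top).ne] at h1
    rwa [h1.limsup_eq]
  -- Dominated convergence on the cell, where the integrals equal `m i z` as soon as `j ≥ i`.
  have h1 := tendsto_lintegral_of_dominated_convergence (μ := volume.restrict (dyadicCell i z))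
    (fun _ => C) (measurable_dyadicAverage m)
    (fun j => Eventually.of_forall (dyadicAverage_le hC j))
    (by rw [setLIntegral_const]; exact ENNReal.mul_ne_top hCt (volume_dyadicCell_lt_top i z).ne) hlim
  refine tendsto_nhds_unique h1 (tendsto_const_nhds.congr' ?_)
  filter_upwards [eventually_ge_atTop i] with j hj
  exact (setLIntegral_dyadicAverage_of_le hadd hj z).symm

end Dyadic

/-! ### The limit integrand -/

section LimitIntegrand

variable {n : ℕ} {Φ : ℝ → ℝ} {c₁ c₂ : ℝ} {f : ℕ → Euc n → Euc n → ℝ}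

theorem isBounded_dyadicCube (j : ℕ) (z : Fin n → ℤ) : Bornology.IsBounded (dyadicCube j z) :=
  (isBounded_dyadicCell j z).subset (dyadicCube_subset_dyadicCell j z)

theorem volume_dyadicCube_lt_top (j : ℕ) (z : Fin n → ℤ) : volume (dyadicCube j z) < ⊤ :=
  (isBounded_dyadicCube j z).measure_lt_top

/-- The `Γ`-limsup of the energies on a dyadic cube at the linear function with gradient `p`. -/
noncomputable def cellValue {n : ℕ} (Φ : ℝ → ℝ) (f : ℕ → Euc n → Euc n → ℝ) (p : Euc n) (j : ℕ)
    (z : Fin n → ℤ) : ℝ≥0∞ :=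
  sInf {L | GammaUpper Φ f (dyadicCube j z) (fun x => inner ℝ p x) L}

/-- The `Γ`-limit at the linear function with gradient `p` exists on all dyadic cubes. -/
def HasCellLimits (Φ : ℝ → ℝ) (f : ℕ → Euc n → Euc n → ℝ) (p : Euc n) : Prop :=
  ∀ j z, GammaLower Φ f (dyadicCube j z) (fun x => inner ℝ p x) (cellValue Φ f p j z)

theorem gammaUpper_linear_bound (hΦ : IsYoungFunction Φ) (hc₂ : 0 < c₂)
    (hf : ∀ k, IsConvexIntegrand c₁ c₂ Φ (f k)) {A : Set (Euc n)} (hA : Bornology.IsBounded A)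
    (p : Euc n) : GammaUpper Φ f A (fun x => inner ℝ p x)
      (ENNReal.ofReal (c₂ * (1 + Φ ‖p‖)) * volume A) := by
  refine fun ε hε => Eventually.of_forall fun k => ⟨_, _, HasOrliczGradient.linear hΦ hA p, ?_, ?_⟩
  · simp [orliczModular, hΦ.map_zero]
  · refine ((hf k).fieldEnergy_le hΦ hc₂ A _).trans ?_
    rw [setLIntegral_const, ← mul_assoc, ENNReal.ofReal_mul hc₂.le,
      ENNReal.ofReal_add zero_le_one (hΦ.nonneg (norm_nonneg _)), ENNReal.ofReal_one]
    exact le_self_add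

theorem cellValue_le (hΦ : IsYoungFunction Φ) (hc₂ : 0 < c₂)
    (hf : ∀ k, IsConvexIntegrand c₁ c₂ Φ (f k)) (p : Euc n) (j : ℕ) (z : Fin n → ℤ) :
    cellValue Φ f p j z ≤ ENNReal.ofReal (c₂ * (1 + Φ ‖p‖)) * volume (dyadicCell j z) := by
  rw [← measure_congr (dyadicCube_ae_eq j z)]
  exact sInf_le (gammaUpper_linear_bound hΦ hc₂ hf (isBounded_dyadicCube j z) p)

theorem cellValue_ne_top (hΦ : IsYoungFunction Φ) (hc₂ : 0 < c₂)
    (hf : ∀ k, IsConvexIntegrand c₁ c₂ Φ (f k)) (p : Euc n) (j : ℕ) (z : Fin n → ℤ) :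
    cellValue Φ f p j z ≠ ⊤ :=
  ((cellValue_le hΦ hc₂ hf p j z).trans_lt
    (ENNReal.mul_lt_top ENNReal.ofReal_lt_top (volume_dyadicCell_lt_top j z))).ne

theorem gammaUpper_cellValue (hΦ : IsYoungFunction Φ) (hc₂ : 0 < c₂)
    (hf : ∀ k, IsConvexIntegrand c₁ c₂ Φ (f k)) (p : Euc n) (j : ℕ) (z : Fin n → ℤ) :
    GammaUpper Φ f (dyadicCube j z) (fun x => inner ℝ p x) (cellValue Φ f p j z) :=
  (gammaUpper_linear_bound hΦ hc₂ hf (isBounded_dyadicCube j z) p).sInf_mem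
    (ENNReal.mul_ne_top ENNReal.ofReal_ne_top (volume_dyadicCube_lt_top j z).ne)

theorem le_cellValue (hΦ : IsYoungFunction Φ) (hc₁ : 0 < c₁)
    (hf : ∀ k, IsConvexIntegrand c₁ c₂ Φ (f k)) (p : Euc n) (j : ℕ) (z : Fin n → ℤ) :
    ENNReal.ofReal (c₁ * Φ ‖p‖) * volume (dyadicCell j z) ≤ cellValue Φ f p j z := by
  rw [← measure_congr (dyadicCube_ae_eq j z)]
  exact le_sInf fun L hL => GammaUpper.le_of_linear hΦ hc₁ hf (isOpen_dyadicCube j z)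
    (isBounded_dyadicCube j z) hL

/-- Only `Γ`-limsups enter, so the slopes are arbitrary: no existence of `Γ`-limits at `p`, `q` or
their combination is required. -/
theorem cellValue_convex (hΦ : IsYoungFunction Φ) (hc₁ : 0 < c₁) (hc₂ : 0 < c₂)
    (hf : ∀ k, IsConvexIntegrand c₁ c₂ Φ (f k)) (p q : Euc n) {a b : ℝ} (ha : 0 ≤ a) (hb : 0 ≤ b)
    (hab : a + b = 1) (j : ℕ) (z : Fin n → ℤ) : cellValue Φ f (a • p + b • q) j z ≤
      ENNReal.ofReal a * cellValue Φ f p j z + ENNReal.ofReal b * cellValue Φ f q j z := by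
  refine sInf_le ?_
  have := (gammaUpper_cellValue hΦ hc₂ hf p j z).convex_comb hΦ hc₁ hf (volume_dyadicCube_lt_top j z)
    (Continuous.aestronglyMeasurable (by fun_prop)) (gammaUpper_cellValue hΦ hc₂ hf q j z) ha hb hab
  have e : (fun x : Euc n => inner ℝ (a • p + b • q) x) =
      a • (fun x => inner ℝ p x) + b • fun x => inner ℝ q x := by
    ext x
    simp [inner_add_left, inner_smul_left]
  change GammaUpper Φ f _ (fun x : Euc n => inner ℝ (a • p + b • q) x) _
  rw [e]
  exact this

theorem dyadicCube_ae_eq_biUnion (j : ℕ) (z : Fin n → ℤ) :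
    dyadicCube j z =ᵐ[volume] ⋃ z' ∈ dyadicChildren z, dyadicCube (n := n) (j + 1) z' := by
  refine (dyadicCube_ae_eq j z).trans ?_
  rw [dyadicCell_eq_biUnion]
  exact (Finset.eventuallyEq_iUnion _ fun z' _ => dyadicCube_ae_eq (j + 1) z').symm

/-- One inequality is superadditivity of the `Γ`-liminf, which is where the existence of the limits
is needed; the other adds glued correctors of the children to the linear function on the parent
cube. -/
theorem HasCellLimits.sum_children (hΦ : IsYoungFunction Φ) (hc₁ : 0 < c₁) (hc₂ : 0 < c₂)
    (hf : ∀ k, IsConvexIntegrand c₁ c₂ Φ (f k)) {p : Euc n} (hp : HasCellLimits Φ f p) (j : ℕ)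
    (z : Fin n → ℤ) : ∑ z' ∈ dyadicChildren z, cellValue Φ f p (j + 1) z' = cellValue Φ f p j z := by
  apply le_antisymm
  · exact (GammaLower.sum hΦ (isOpen_dyadicCube j z) (volume_dyadicCube_lt_top j z) (dyadicChildren z)
      (fun z' _ => isOpen_dyadicCube (j + 1) z') (fun z' h => dyadicCube_succ_subset h)
      (pairwiseDisjoint_dyadicCube (j + 1) _) fun z' _ => hp (j + 1) z').le_of_gammaUpper
        (gammaUpper_cellValue hΦ hc₂ hf p j z)
  · refine sInf_le fun ε hε => ?_
    have hlin := HasOrliczGradient.linear hΦ (isBounded_dyadicCube j z) p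
    filter_upwards [exists_glued_corrector hΦ hc₁ hc₂ hf (isOpen_dyadicCube j z)
      (volume_dyadicCube_lt_top j z) (dyadicChildren z) (fun z' _ => isOpen_dyadicCube (j + 1) z')
      (fun z' h => dyadicCube_succ_subset h) (pairwiseDisjoint_dyadicCube (j + 1) _)
      (fun z' _ => HasOrliczGradient.linear hΦ (isBounded_dyadicCube (j + 1) z') p)
      (fun z' _ => gammaUpper_cellValue hΦ hc₂ hf p (j + 1) z')
      (fun z' _ => cellValue_ne_top hΦ hc₂ hf p (j + 1) z') hε] with k ⟨ζ, η, h1, _, h3, h4⟩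
    refine ⟨_, _, hlin.add hΦ (volume_dyadicCube_lt_top j z) h1, ?_, ?_⟩
    · rwa [add_sub_cancel_left]
    · refine le_of_eq_of_le ?_ h4
      unfold fieldEnergy
      rw [setLIntegral_congr (dyadicCube_ae_eq_biUnion j z),
        lintegral_biUnion_finset (pairwiseDisjoint_dyadicCube (j + 1) _)
          fun z' _ => (isOpen_dyadicCube (j + 1) z').measurableSet]

/-- The integrand of the `Γ`-limit. -/
noncomputable def limitIntegrand {n : ℕ} (Φ : ℝ → ℝ) (f : ℕ → Euc n → Euc n → ℝ) (x p : Euc n) : ℝ :=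
  (limsup (fun j => dyadicAverage (cellValue Φ f p) j x) atTop).toReal

theorem ENNReal.limsup_le_combination {a b : ℝ≥0∞} (ha : a ≠ ⊤) (hb : b ≠ ⊤) {x y z : ℕ → ℝ≥0∞}
    (h : ∀ k, z k ≤ a * x k + b * y k) (hx : limsup x atTop ≠ ⊤) (hy : limsup y atTop ≠ ⊤) :
    limsup z atTop ≤ a * limsup x atTop + b * limsup y atTop := by
  refine ENNReal.le_of_forall_pos_le_add fun ε hε _ => ?_
  have hab : a + b ≠ ⊤ := by finiteness
  obtain ⟨δ, hδ, hle⟩ := ENNReal.exists_pos_mul_le (ε := ε) hab (by simpa using hε)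
  refine limsup_le_of_le (by isBoundedDefault) ?_
  filter_upwards [eventually_lt_of_limsup_lt (ENNReal.lt_add_right hx hδ.ne'),
    eventually_lt_of_limsup_lt (ENNReal.lt_add_right hy hδ.ne')] with k h1 h2
  calc z k ≤ a * (limsup x atTop + δ) + b * (limsup y atTop + δ) := (h k).trans (by gcongr)
    _ = a * limsup x atTop + b * limsup y atTop + (a + b) * δ := by ring
    _ ≤ _ := by gcongr

theorem limsup_dyadicAverage_cellValue_le (hΦ : IsYoungFunction Φ) (hc₂ : 0 < c₂)
    (hf : ∀ k, IsConvexIntegrand c₁ c₂ Φ (f k)) (x p : Euc n) :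
    limsup (fun j => dyadicAverage (cellValue Φ f p) j x) atTop ≤ ENNReal.ofReal (c₂ * (1 + Φ ‖p‖)) :=
  limsup_le_of_le (by isBoundedDefault) (Eventually.of_forall fun j =>
    dyadicAverage_le (cellValue_le hΦ hc₂ hf p) j x)

theorem ofReal_limitIntegrand (hΦ : IsYoungFunction Φ) (hc₂ : 0 < c₂)
    (hf : ∀ k, IsConvexIntegrand c₁ c₂ Φ (f k)) (x p : Euc n) :
    ENNReal.ofReal (limitIntegrand Φ f x p) =
      limsup (fun j => dyadicAverage (cellValue Φ f p) j x) atTop :=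
  ENNReal.ofReal_toReal ((limsup_dyadicAverage_cellValue_le hΦ hc₂ hf x p).trans_lt
    ENNReal.ofReal_lt_top).ne

/-- Each property holds for the averages at every `x` and `p` and survives the limsup. Continuity in
`p` comes for free from finite convexity in finite dimension. -/
theorem isConvexIntegrand_limitIntegrand (hΦ : IsYoungFunction Φ) (hc₁ : 0 < c₁) (hc₂ : 0 < c₂)
    (hf : ∀ k, IsConvexIntegrand c₁ c₂ Φ (f k)) :
    IsConvexIntegrand c₁ c₂ Φ (limitIntegrand Φ f) := by
  have hne : ∀ x p, limsup (fun j => dyadicAverage (cellValue Φ f p) j x) atTop ≠ ⊤ := fun x p =>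
    ((limsup_dyadicAverage_cellValue_le hΦ hc₂ hf x p).trans_lt ENNReal.ofReal_lt_top).ne
  have hconv : ∀ x, ConvexOn ℝ univ (limitIntegrand Φ f x) := by
    refine fun x => ⟨convex_univ, fun p _ q _ a b ha hb hab => ?_⟩
    have h1 : limsup (fun j => dyadicAverage (cellValue Φ f (a • p + b • q)) j x) atTop ≤
        ENNReal.ofReal a * limsup (fun j => dyadicAverage (cellValue Φ f p) j x) atTop +
        ENNReal.ofReal b * limsup (fun j => dyadicAverage (cellValue Φ f q) j x) atTop := by
      refine ENNReal.limsup_le_combination ENNReal.ofReal_ne_top ENNReal.ofReal_ne_top (fun j => ?_)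
        (hne x p) (hne x q)
      simp only [dyadicAverage, div_eq_mul_inv]
      rw [← mul_assoc, ← mul_assoc, ← add_mul]
      gcongr
      exact cellValue_convex hΦ hc₁ hc₂ hf p q ha hb hab j _
    have h2 := ENNReal.toReal_mono (ENNReal.add_ne_top.2 ⟨ENNReal.mul_ne_top ENNReal.ofReal_ne_top
      (hne x p), ENNReal.mul_ne_top ENNReal.ofReal_ne_top (hne x q)⟩) h1
    rw [ENNReal.toReal_add (ENNReal.mul_ne_top ENNReal.ofReal_ne_top (hne x p))
      (ENNReal.mul_ne_top ENNReal.ofReal_ne_top (hne x q)), ENNReal.toReal_mul, ENNReal.toReal_mul,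
      ENNReal.toReal_ofReal ha, ENNReal.toReal_ofReal hb] at h2
    exact h2
  refine ⟨Eventually.of_forall fun x => ?_, fun p => ?_, hconv, fun x p => ?_, fun x p => ?_⟩
  · exact continuousOn_univ.1 ((hconv x).continuousOn isOpen_univ)
  · exact (Measurable.limsup fun j => measurable_dyadicAverage _ j).ennreal_toReal.aemeasurable
  · refine (ENNReal.ofReal_le_iff_le_toReal (hne x p)).1 ?_
    refine le_limsup_of_frequently_le (Frequently.of_forall fun j => ?_) (by isBoundedDefault)
    exact (ENNReal.le_div_iff_mul_le (Or.inl (volume_dyadicCell_ne_zero j _))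
      (Or.inl (volume_dyadicCell_lt_top j _).ne)).2 (le_cellValue hΦ hc₁ hf p j _)
  · exact ENNReal.toReal_le_of_le_ofReal (mul_nonneg hc₂.le (add_nonneg zero_le_one
      (hΦ.nonneg (norm_nonneg _)))) (limsup_dyadicAverage_cellValue_le hΦ hc₂ hf x p)

/-- Existence of the limits gives additivity, hence the averages have a density that integrates back
to the cell values. -/
theorem HasCellLimits.fieldEnergy_limitIntegrand (hΦ : IsYoungFunction Φ) (hc₁ : 0 < c₁) (hc₂ : 0 < c₂)
    (hf : ∀ k, IsConvexIntegrand c₁ c₂ Φ (f k)) {p : Euc n} (hp : HasCellLimits Φ f p) (j : ℕ)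
    (z : Fin n → ℤ) :
    fieldEnergy (limitIntegrand Φ f) (dyadicCube j z) (fun _ => p) = cellValue Φ f p j z := by
  unfold fieldEnergy
  simp only [ofReal_limitIntegrand hΦ hc₂ hf]
  rw [setLIntegral_congr (dyadicCube_ae_eq j z)]
  exact setLIntegral_limsup_dyadicAverage ENNReal.ofReal_ne_top (cellValue_le hΦ hc₂ hf p)
    (hp.sum_children hΦ hc₁ hc₂ hf) j z

/-- Along a subsequence, the `Γ`-limits on dyadic cubes exist for a dense set of slopes. -/
theorem exists_subseq_hasCellLimits (hΦ : IsYoungFunction Φ) (hc₂ : 0 < c₂)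
    (hf : ∀ k, IsConvexIntegrand c₁ c₂ Φ (f k)) (P : ℕ → Euc n) :
    ∃ φ : ℕ → ℕ, StrictMono φ ∧ ∀ m, HasCellLimits Φ (fun k => f (φ k)) (P m) := by
  -- The index set of slopes, generations, cells and radii is countable, so this product of copies
  -- of `[0, ∞]` is sequentially compact; this replaces a diagonal extraction.
  obtain ⟨J, φ, hφ, hJ⟩ := CompactSpace.tendsto_subseq
    (fun (k : ℕ) (i : ℕ × ℕ × (Fin n → ℤ) × ℕ) =>
      localInf Φ (f k) (dyadicCube i.2.1 i.2.2.1) (fun x => inner ℝ (P i.1) x) i.2.2.2)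
  refine ⟨φ, hφ, fun m j z => ?_⟩
  have hJ' : ∀ l, Tendsto (fun k => localInf Φ (f (φ k)) (dyadicCube j z)
      (fun x => inner ℝ (P m) x) l) atTop (𝓝 (J (m, j, z, l))) := fun l =>
    (tendsto_pi_nhds.1 hJ) (m, j, z, l)
  have hb : ∀ l, J (m, j, z, l) ≤ ENNReal.ofReal (c₂ * (1 + Φ ‖P m‖)) * volume (dyadicCube j z) := by
    refine fun l => le_of_tendsto' (hJ' l) fun k => ?_
    refine iInf_le_of_le _ (iInf_le_of_le _ (iInf_le_of_le
      ⟨HasOrliczGradient.linear hΦ (isBounded_dyadicCube j z) (P m), ?_⟩ ?_))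
    · simp [orliczModular, hΦ.map_zero]
    · refine ((hf (φ k)).fieldEnergy_le hΦ hc₂ _ _).trans ?_
      rw [setLIntegral_const, ← mul_assoc, ENNReal.ofReal_mul hc₂.le,
        ENNReal.ofReal_add zero_le_one (hΦ.nonneg (norm_nonneg _)), ENNReal.ofReal_one]
  have hne : ⨆ l, J (m, j, z, l) ≠ ⊤ := ((iSup_le hb).trans_lt
    (ENNReal.mul_lt_top ENNReal.ofReal_lt_top (volume_dyadicCube_lt_top j z))).ne
  -- The supremum of the limits bounds the `Γ`-liminf from below and, being also an upper bound of
  -- the `Γ`-limsup, dominates `cellValue`.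
  refine (gammaLower_of_tendsto_localInf hne hJ').mono (sInf_le ?_)
  exact gammaUpper_of_tendsto_localInf (fun l => le_iSup (fun l => J (m, j, z, l)) l) hne hJ'

end LimitIntegrand

/-! ### Approximation of Orlicz fields by dyadic step fields -/

section Approximation

variable {n : ℕ} {Φ : ℝ → ℝ} {A : Set (Euc n)} {v : Euc n → Euc n}

theorem orliczModular_sub_comm {F : Type*} [NormedAddCommGroup F] (Φ : ℝ → ℝ) (A : Set (Euc n))
    (u w : Euc n → F) : orliczModular Φ A (u - w) = orliczModular Φ A (w - u) := by
  simp only [orliczModular, Pi.sub_apply, norm_sub_rev]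

/-- Set `v` to zero where it is large; `Φ(|v|)` dominates the error. -/
theorem InOrlicz.exists_bounded_approx (hΦ : IsYoungFunction Φ) (hv : InOrlicz Φ A v) {ε : ℝ≥0∞}
    (hε : 0 < ε) : ∃ (R : ℝ) (b : Euc n → Euc n), 0 < R ∧ (∀ x, ‖b x‖ ≤ R) ∧
      AEStronglyMeasurable b (volume.restrict A) ∧ orliczModular Φ A (v - b) ≤ ε := by
  set b : ℕ → Euc n → Euc n := fun m x => {p : Euc n | ‖p‖ ≤ m}.indicator id (v x) with hb
  have hbm : ∀ m, AEStronglyMeasurable (b m) (volume.restrict A) := fun m => by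
    have hs : MeasurableSet {p : Euc n | ‖p‖ ≤ m} := measurableSet_le measurable_norm measurable_const
    exact ((measurable_id.indicator hs).comp_aemeasurable hv.1.aemeasurable).aestronglyMeasurable
  have hlim : Tendsto (fun m => orliczModular Φ A (v - b m)) atTop (𝓝 (∫⁻ _ in A, 0)) := by
    refine tendsto_lintegral_of_dominated_convergence' (fun x => ENNReal.ofReal (Φ ‖v x‖))
      (fun m => hΦ.aemeasurable_ofReal_norm (hv.1.sub (hbm m))) (fun m => Eventually.of_forall fun x => ?_)
      hv.2.ne (Eventually.of_forall fun x => ?_)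
    · refine ENNReal.ofReal_le_ofReal (hΦ.mono (norm_nonneg _) ?_)
      by_cases h : ‖v x‖ ≤ m
      · simp [hb, indicator, h]
      · simp [hb, indicator, h]
    · refine tendsto_const_nhds.congr' ?_
      filter_upwards [eventually_ge_atTop ⌈‖v x‖⌉₊] with m hm
      have h : ‖v x‖ ≤ m := (Nat.le_ceil _).trans (by exact_mod_cast hm)
      simp [hb, indicator, h, hΦ.map_zero]
  rw [lintegral_zero] at hlim
  obtain ⟨m, hm, hm1⟩ := ((ENNReal.tendsto_nhds_zero.1 hlim ε hε).and (eventually_ge_atTop 1)).exists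
  refine ⟨m, b m, by exact_mod_cast hm1, fun x => ?_, hbm m, hm⟩
  by_cases h : ‖v x‖ ≤ m
  · simp [hb, indicator, h]
  · simp [hb, indicator, h]

/-- Radial projection onto the ball of radius `R` moves `q` by at most `|p - q|` when `p` is in the
ball. -/
theorem norm_sub_clip_le {R : ℝ} (hR : 0 < R) {p q : Euc n} (hp : ‖p‖ ≤ R) :
    ‖(R / max R ‖q‖) • q‖ ≤ R ∧ ‖p - (R / max R ‖q‖) • q‖ ≤ 2 * ‖p - q‖ := by
  have hm : 0 < max R ‖q‖ := lt_max_of_lt_left hR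
  constructor
  · rw [norm_smul, Real.norm_of_nonneg (by positivity), div_mul_eq_mul_div, div_le_iff₀ hm]
    exact mul_le_mul_of_nonneg_left (le_max_right _ _) hR.le
  · have h1 : p - (R / max R ‖q‖) • q = (p - q) + (1 - R / max R ‖q‖) • q := by
      rw [sub_smul, one_smul]; abel
    have h2 : ‖(1 - R / max R ‖q‖) • q‖ ≤ ‖p - q‖ := by
      rcases le_total ‖q‖ R with h | h
      · rw [max_eq_left h, div_self hR.ne']; simp
      · have hq : 0 < ‖q‖ := hR.trans_le h
        rw [max_eq_right h, norm_smul, Real.norm_of_nonneg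
          (sub_nonneg.2 ((div_le_one hq).2 h)), sub_mul, div_mul_cancel₀ _ hq.ne', one_mul]
        have := norm_sub_norm_le q p
        rw [norm_sub_rev] at this
        linarith
    rw [h1]
    refine (norm_add_le _ _).trans ?_
    linarith

/-- After truncation, approximate in `L¹` by a continuous field and clip it to the same ball. The
error is then bounded by `2 R`, a range on which `Φ` lies below a linear function, so `L¹` closeness
yields modular closeness. -/
theorem InOrlicz.exists_continuous_approx (hΦ : IsYoungFunction Φ) (hAf : volume A < ⊤)
    (hv : InOrlicz Φ A v) {ε : ℝ≥0∞} (hε : 0 < ε) :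
    ∃ g : Euc n → Euc n, Continuous g ∧ orliczModular Φ A (v - g) ≤ ε := by
  obtain ⟨D, hD, hadd⟩ := hΦ.exists_orliczModular_add_le (n := n)
  obtain ⟨δ, hδ, hle⟩ := ENNReal.exists_pos_mul_le hD hε
  obtain ⟨R, b, hR, hbR, hbm, hbv⟩ := hv.exists_bounded_approx hΦ (ENNReal.half_pos hδ.ne')
  -- The constant is the slope of the chord of `Φ` over `[0, 2 R]`, times the factor `2` lost by
  -- clipping.
  have hC0 : 0 ≤ Φ (2 * R) / (2 * R) * 2 :=
    mul_nonneg (div_nonneg (hΦ.nonneg (by positivity)) (by positivity)) two_pos.le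
  obtain ⟨δ', hδ', hle'⟩ := ENNReal.exists_pos_mul_le
    (K := ENNReal.ofReal (Φ (2 * R) / (2 * R) * 2)) ENNReal.ofReal_ne_top (ENNReal.half_pos hδ.ne')
  have : IsFiniteMeasure (volume.restrict A) := ⟨by rwa [Measure.restrict_apply_univ]⟩
  obtain ⟨g₀, hg₀, -⟩ := (Integrable.of_bound hbm R
    (Eventually.of_forall hbR)).exists_boundedContinuous_lintegral_sub_le hδ'.ne'
  have hgc : Continuous fun x => (R / max R ‖g₀ x‖) • g₀ x := by
    refine (continuous_const.div (continuous_const.max g₀.continuous.norm) fun x => ?_).smul g₀.continuous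
    exact (lt_max_of_lt_left hR).ne'
  refine ⟨_, hgc, ?_⟩
  set g : Euc n → Euc n := fun x => (R / max R ‖g₀ x‖) • g₀ x with hg
  have h1 : orliczModular Φ A (b - g) ≤ δ / 2 := by
    refine le_trans ?_ hle'
    refine le_trans ?_ (mul_le_mul_right hg₀ _)
    rw [← lintegral_const_mul' _ _ ENNReal.ofReal_ne_top]
    refine lintegral_mono fun x => ?_
    dsimp only
    rw [← ofReal_norm, ← ENNReal.ofReal_mul hC0]
    refine ENNReal.ofReal_le_ofReal ?_
    obtain ⟨a1, a2⟩ := norm_sub_clip_le hR (q := g₀ x) (hbR x)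
    have a3 : ‖(b - g) x‖ ≤ 2 * R := (norm_sub_le _ _).trans (by linarith [hbR x])
    have a4 := hΦ.map_mul_le (l := ‖(b - g) x‖ / (2 * R)) (by positivity)
      ((div_le_one (by positivity)).2 a3) (show 0 ≤ 2 * R by positivity)
    rw [div_mul_cancel₀ _ (by positivity)] at a4
    refine a4.trans ?_
    have a5 : 0 ≤ Φ (2 * R) / (2 * R) := div_nonneg (hΦ.nonneg (by positivity)) (by positivity)
    calc ‖(b - g) x‖ / (2 * R) * Φ (2 * R) = Φ (2 * R) / (2 * R) * ‖(b - g) x‖ := by ring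
      _ ≤ Φ (2 * R) / (2 * R) * (2 * ‖b x - g₀ x‖) := mul_le_mul_of_nonneg_left a2 a5
      _ = _ := by ring
  calc orliczModular Φ A (v - g) = orliczModular Φ A ((v - b) + (b - g)) := by rw [sub_add_sub_cancel]
    _ ≤ D * (orliczModular Φ A (v - b) + orliczModular Φ A (b - g)) :=
        hadd A _ _ (hbm.sub hgc.aestronglyMeasurable)
    _ ≤ D * (δ / 2 + δ / 2) := by gcongr
    _ ≤ ε := by rwa [ENNReal.add_halves]

theorem finite_image_dyadicIndex {K : Set (Euc n)} (hK : Bornology.IsBounded K) (j : ℕ) :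
    (dyadicIndex j '' K).Finite := by
  obtain ⟨R, hR⟩ := hK.exists_norm_le
  refine (Set.finite_Icc (fun _ => ⌊(2 : ℝ) ^ j * -R⌋) (fun _ => ⌊(2 : ℝ) ^ j * R⌋)).subset ?_
  rintro _ ⟨x, hx, rfl⟩
  have h : ∀ i, |x i| ≤ R := fun i => (PiLp.norm_apply_le x i).trans (hR x hx)
  constructor
  · intro i
    exact Int.floor_le_floor (mul_le_mul_of_nonneg_left (abs_le.1 (h i)).1 (by positivity))
  · intro i
    exact Int.floor_le_floor (mul_le_mul_of_nonneg_left (abs_le.1 (h i)).2 (by positivity))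

/-- Fields in the Orlicz class are approximated in modular by fields that are constant on dyadic
cubes, with values in a given dense set. -/
theorem InOrlicz.exists_dyadic_approx (hΦ : IsYoungFunction Φ) (hAo : IsOpen A) (hAf : volume A < ⊤)
    (hv : InOrlicz Φ A v) {P : ℕ → Euc n} (hP : DenseRange P) {ε : ℝ≥0∞} (hε : 0 < ε) :
    ∃ (j : ℕ) (S : Finset (Fin n → ℤ)) (q : (Fin n → ℤ) → ℕ), (∀ z ∈ S, dyadicCube j z ⊆ A) ∧
      orliczModular Φ (⋃ z ∈ S, dyadicCube j z) (v - fun x => P (q (dyadicIndex j x))) ≤ ε ∧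
      ∫⁻ x in A \ ⋃ z ∈ S, dyadicCube j z, (1 + ENNReal.ofReal (Φ ‖v x‖)) ≤ ε := by
  obtain ⟨D, hD, hadd⟩ := hΦ.exists_orliczModular_add_le (n := n)
  obtain ⟨δ, hδ, hle⟩ := ENNReal.exists_pos_mul_le hD hε
  obtain ⟨g, hgc, hg⟩ := hv.exists_continuous_approx hΦ hAf (ENNReal.half_pos hδ.ne')
  obtain ⟨τ, hτ0, hτ1, hτ⟩ := ENNReal.exists_real_mul_le (K := ENNReal.ofReal (Φ 1) * volume A)
    (ENNReal.mul_ne_top ENNReal.ofReal_ne_top hAf.ne) (ENNReal.half_pos hδ.ne')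
  have hfin : ∫⁻ x in A, (1 + ENNReal.ofReal (Φ ‖v x‖)) < ⊤ := by
    rw [lintegral_add_left measurable_const, setLIntegral_one]
    exact ENNReal.add_lt_top.2 ⟨hAf, hv.2⟩
  obtain ⟨K, hKA, hK, hKε⟩ := exists_isCompact_setLIntegral_lt hAo.measurableSet hAf hfin hε
  obtain ⟨r, hr, hrA⟩ := hK.exists_cthickening_subset_open hAo hKA
  have hK' : IsCompact (Metric.cthickening r K) := hK.cthickening
  obtain ⟨ρ, hρ, hunif⟩ := Metric.uniformContinuousOn_iff.1
    (hK'.uniformContinuousOn_of_continuous hgc.continuousOn) (τ / 2) (half_pos hτ0)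
  -- Cells of this generation that meet `K` stay in the thickening of `K`, hence in `A`, and `g`
  -- oscillates there by less than `τ / 2` from its value at a chosen point of `K`.
  obtain ⟨j, hj⟩ : ∃ j : ℕ, n * ((2 : ℝ) ^ j)⁻¹ < min r ρ := by
    have h1 : Tendsto (fun j : ℕ => (n : ℝ) * ((2 : ℝ) ^ j)⁻¹) atTop (𝓝 (n * 0)) :=
      (tendsto_inv_atTop_zero.comp (tendsto_pow_atTop_atTop_of_one_lt one_lt_two)).const_mul _
    rw [mul_zero] at h1
    exact (h1.eventually_lt_const (lt_min hr hρ)).exists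
  set S := (finite_image_dyadicIndex hK.isBounded j).toFinset with hS
  have hSK : ∀ z, z ∈ S → ∃ x ∈ K, dyadicIndex j x = z := fun z hz => by simpa [hS] using hz
  have hKS : ∀ x ∈ K, dyadicIndex j x ∈ S := fun x hx => by
    rw [hS, Set.Finite.mem_toFinset]; exact ⟨x, hx, rfl⟩
  choose! y hyK hyz using hSK
  choose q hq using fun z => hP.exists_dist_lt (g (y z)) (half_pos hτ0)
  have hcell : ∀ z ∈ S, ∀ x ∈ dyadicCell j z, dist x (y z) < r ∧ dist x (y z) < ρ := by
    intro z hz x hx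
    have := (norm_sub_le_of_mem_dyadicCell hx (show y z ∈ dyadicCell j z from hyz z hz)).trans_lt hj
    rw [dist_eq_norm]
    exact lt_min_iff.1 this
  have hcellK : ∀ z ∈ S, dyadicCell j z ⊆ Metric.cthickening r K := fun z hz x hx =>
    Metric.mem_cthickening_of_dist_le _ _ _ _ (hyK z hz) (hcell z hz x hx).1.le
  have hcubeA : ∀ z ∈ S, dyadicCube j z ⊆ A := fun z hz =>
    (dyadicCube_subset_dyadicCell j z).trans ((hcellK z hz).trans hrA)
  set U : Set (Euc n) := ⋃ z ∈ S, dyadicCube j z with hU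
  have hUA : U ⊆ A := iUnion₂_subset hcubeA
  have hUm : MeasurableSet U := S.measurableSet_biUnion fun z _ => (isOpen_dyadicCube j z).measurableSet
  have hpm : Measurable fun x : Euc n => P (q (dyadicIndex j x)) :=
    (measurable_of_countable (fun z => P (q z))).comp (measurable_dyadicIndex j)
  refine ⟨j, S, q, hcubeA, ?_, ?_⟩
  · have h1 : orliczModular Φ U (g - fun x => P (q (dyadicIndex j x))) ≤ δ / 2 := by
      calc orliczModular Φ U (g - fun x => P (q (dyadicIndex j x)))
          ≤ ∫⁻ _ in U, ENNReal.ofReal (τ * Φ 1) := by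
            refine setLIntegral_mono measurable_const fun x hx => ENNReal.ofReal_le_ofReal ?_
            obtain ⟨z, hz, hxz⟩ := mem_iUnion₂.1 hx
            have hxc := dyadicCube_subset_dyadicCell j z hxz
            have hxi : dyadicIndex j x = z := hxc
            have a1 := hunif x (hcellK z hz hxc) (y z) (hcellK z hz (hyz z hz)) (hcell z hz x hxc).2
            have a2 : ‖(g - fun x => P (q (dyadicIndex j x))) x‖ ≤ τ := by
              rw [Pi.sub_apply, ← dist_eq_norm, hxi]
              refine (dist_triangle _ (g (y z)) _).trans ?_
              have := hq z
              linarith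
            refine (hΦ.mono (norm_nonneg _) a2).trans ?_
            simpa using hΦ.map_mul_le hτ0.le hτ1 zero_le_one
        _ = ENNReal.ofReal τ * (ENNReal.ofReal (Φ 1) * volume U) := by
            rw [setLIntegral_const, ENNReal.ofReal_mul hτ0.le, mul_assoc]
        _ ≤ ENNReal.ofReal τ * (ENNReal.ofReal (Φ 1) * volume A) := by gcongr
        _ ≤ δ / 2 := hτ
    calc orliczModular Φ U (v - fun x => P (q (dyadicIndex j x)))
        = orliczModular Φ U ((v - g) + (g - fun x => P (q (dyadicIndex j x)))) := by
          rw [sub_add_sub_cancel]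
      _ ≤ D * (orliczModular Φ U (v - g) + orliczModular Φ U (g - fun x => P (q (dyadicIndex j x)))) :=
          hadd U _ _ (hgc.aestronglyMeasurable.sub hpm.aestronglyMeasurable)
      _ ≤ D * (δ / 2 + δ / 2) := by
          gcongr
          exact (orliczModular_mono_set hUA _).trans hg
      _ ≤ ε := by rwa [ENNReal.add_halves]
  · refine le_trans (lintegral_mono_set' ?_) hKε.le
    -- The open cubes may miss points of `K`, but the cells cover `K`; the two unions differ by a
    -- null set.
    have hae : U =ᵐ[volume] ⋃ z ∈ S, dyadicCell (n := n) j z :=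
      Finset.eventuallyEq_iUnion _ fun z _ => dyadicCube_ae_eq j z
    refine (ae_eq_set_sdiff (ae_eq_refl A) hae).le.trans (Eventually.of_forall ?_)
    intro x hx
    exact ⟨hx.1, fun hxK => hx.2 (mem_biUnion (s := (S : Set (Fin n → ℤ))) (hKS x hxK)
      (show x ∈ dyadicCell j (dyadicIndex j x) from rfl))⟩

end Approximation

/-! ### Both Γ-inequalities on the Orlicz–Sobolev space -/

section GammaLimit

variable {n : ℕ} {Φ : ℝ → ℝ} {c₁ c₂ : ℝ} {f : ℕ → Euc n → Euc n → ℝ} {A : Set (Euc n)}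
  {u : Euc n → ℝ} {v : Euc n → Euc n}

theorem sum_fieldEnergy_dyadicCube (g : Euc n → Euc n → ℝ) (j : ℕ) (S : Finset (Fin n → ℤ))
    (p : (Fin n → ℤ) → Euc n) (w : Euc n → Euc n) :
    ∑ z ∈ S, fieldEnergy g (dyadicCube j z) ((fun _ => p z) + w) =
      fieldEnergy g (⋃ z ∈ S, dyadicCube j z) ((fun x => p (dyadicIndex j x)) + w) := by
  unfold fieldEnergy
  rw [lintegral_biUnion_finset (pairwiseDisjoint_dyadicCube j _)
    fun z _ => (isOpen_dyadicCube j z).measurableSet]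
  refine Finset.sum_congr rfl fun z _ => ?_
  refine setLIntegral_congr_fun (isOpen_dyadicCube j z).measurableSet fun x hx => ?_
  have : dyadicIndex j x = z := dyadicCube_subset_dyadicCell j z hx
  simp [this]

theorem sum_cellValue (hΦ : IsYoungFunction Φ) (hc₁ : 0 < c₁) (hc₂ : 0 < c₂)
    (hf : ∀ k, IsConvexIntegrand c₁ c₂ Φ (f k)) {P : ℕ → Euc n} (hcell : ∀ m, HasCellLimits Φ f (P m))
    (j : ℕ) (S : Finset (Fin n → ℤ)) (q : (Fin n → ℤ) → ℕ) :
    ∑ z ∈ S, cellValue Φ f (P (q z)) j z =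
      fieldEnergy (limitIntegrand Φ f) (⋃ z ∈ S, dyadicCube j z) (fun x => P (q (dyadicIndex j x))) := by
  have := sum_fieldEnergy_dyadicCube (limitIntegrand Φ f) j S (fun z => P (q z)) 0
  simp only [add_zero] at this
  rw [← this]
  exact Finset.sum_congr rfl fun z _ => ((hcell (q z)).fieldEnergy_limitIntegrand hΦ hc₁ hc₂ hf j z).symm

theorem fieldEnergy_add_diff (g : Euc n → Euc n → ℝ) {U : Set (Euc n)} (hU : MeasurableSet U)
    (hUA : U ⊆ A) (v : Euc n → Euc n) :
    fieldEnergy g A v = fieldEnergy g U v + fieldEnergy g (A \ U) v := by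
  unfold fieldEnergy
  rw [← lintegral_inter_add_sdiff _ A hU, inter_eq_self_of_subset_right hUA]

theorem fieldEnergy_lt_top (hΦ : IsYoungFunction Φ) (hc₂ : 0 < c₂) {g : Euc n → Euc n → ℝ}
    (hg : IsConvexIntegrand c₁ c₂ Φ g) (hAf : volume A < ⊤) (hv : InOrlicz Φ A v) :
    fieldEnergy g A v < ⊤ := by
  refine (hg.fieldEnergy_le hΦ hc₂ A v).trans_lt ?_
  rw [lintegral_add_left measurable_const, setLIntegral_one]
  exact ENNReal.mul_lt_top ENNReal.ofReal_lt_top (ENNReal.add_lt_top.2 ⟨hAf, hv.2⟩)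

/-- A dyadic approximation of a field, together with the energy estimates it provides for all
integrands of the class. -/
theorem exists_dyadic_energy_approx (hΦ : IsYoungFunction Φ) (hc₁ : 0 < c₁) (hc₂ : 0 < c₂)
    (hAo : IsOpen A) (hAf : volume A < ⊤) (hv : InOrlicz Φ A v) {P : ℕ → Euc n} (hP : DenseRange P)
    {M ε : ℝ≥0∞} (hM : M ≠ ⊤) (hε : 0 < ε) :
    ∃ (j : ℕ) (S : Finset (Fin n → ℤ)) (q : (Fin n → ℤ) → ℕ), (∀ z ∈ S, dyadicCube j z ⊆ A) ∧
      (∀ g : Euc n → Euc n → ℝ, IsConvexIntegrand c₁ c₂ Φ g →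
        fieldEnergy g (A \ ⋃ z ∈ S, dyadicCube j z) v ≤ ε ∧
        fieldEnergy g (⋃ z ∈ S, dyadicCube j z) v ≤
          fieldEnergy g (⋃ z ∈ S, dyadicCube j z) (fun x => P (q (dyadicIndex j x))) + ε ∧
        fieldEnergy g (⋃ z ∈ S, dyadicCube j z) (fun x => P (q (dyadicIndex j x))) ≤
          fieldEnergy g (⋃ z ∈ S, dyadicCube j z) v + ε ∧
        ∀ b : Euc n → Euc n, AEStronglyMeasurable b (volume.restrict (⋃ z ∈ S, dyadicCube j z)) →
          orliczModular Φ (⋃ z ∈ S, dyadicCube j z) b ≤ M →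
          fieldEnergy g (⋃ z ∈ S, dyadicCube j z) (b + (v - fun x => P (q (dyadicIndex j x)))) ≤
            fieldEnergy g (⋃ z ∈ S, dyadicCube j z) b + ε ∧
          fieldEnergy g (⋃ z ∈ S, dyadicCube j z) (b + ((fun x => P (q (dyadicIndex j x))) - v)) ≤
            fieldEnergy g (⋃ z ∈ S, dyadicCube j z) b + ε) := by
  obtain ⟨D, hD, hadd⟩ := hΦ.exists_orliczModular_add_le (n := n)
  have hvt := hv.2.ne
  have hAt := hAf.ne
  -- One bound for every base field of the perturbation estimate; the last summand bounds the step
  -- field, written as `v + (p - v)` with error at most `1`.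
  set M' : ℝ≥0∞ := M + volume A + orliczModular Φ A v + D * (orliczModular Φ A v + 1) with hM'
  have hM't : M' ≠ ⊤ := by simp only [hM']; finiteness
  have hMM : M ≤ M' := by rw [hM', add_assoc, add_assoc]; exact le_self_add
  have hAM : volume A ≤ M' := by rw [hM', add_assoc, add_assoc]; exact le_add_left le_self_add
  have hvM : orliczModular Φ A v ≤ M' := by rw [hM', add_assoc]; exact le_add_left le_self_add
  have hDM : D * (orliczModular Φ A v + 1) ≤ M' := by rw [hM']; exact le_add_self
  obtain ⟨δ, hδ, hpert⟩ := hΦ.exists_fieldEnergy_add_le (n := n) hc₁ hc₂ hM't hε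
  obtain ⟨δ', hδ', hle'⟩ := ENNReal.exists_pos_mul_le (K := ENNReal.ofReal c₂) ENNReal.ofReal_ne_top hε
  obtain ⟨j, S, q, hSA, h1, h2⟩ := hv.exists_dyadic_approx hΦ hAo hAf hP
    (lt_min (lt_min hδ hδ') one_pos)
  set U : Set (Euc n) := ⋃ z ∈ S, dyadicCube j z with hU
  set p : Euc n → Euc n := fun x => P (q (dyadicIndex j x)) with hp
  have hUA : U ⊆ A := iUnion₂_subset hSA
  have hpm : AEStronglyMeasurable p (volume.restrict U) :=
    ((measurable_of_countable (fun z => P (q z))).comp (measurable_dyadicIndex j)).aestronglyMeasurable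
  have hvm : AEStronglyMeasurable v (volume.restrict U) := hv.1.mono_set hUA
  have hvp : orliczModular Φ U (v - p) ≤ δ := h1.trans ((min_le_left _ _).trans (min_le_left _ _))
  have hpv : orliczModular Φ U (p - v) ≤ δ := by rwa [orliczModular_sub_comm]
  have hvU : orliczModular Φ U v ≤ orliczModular Φ A v := orliczModular_mono_set hUA v
  have hpU : orliczModular Φ U p ≤ M' := by
    refine le_trans ?_ hDM
    have := hadd U v (p - v) (hpm.sub hvm)
    rw [add_sub_cancel] at this
    refine this.trans ?_
    gcongr
    rw [orliczModular_sub_comm]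
    exact h1.trans (min_le_right _ _)
  have hUM : volume U ≤ M' := (measure_mono hUA).trans hAM
  refine ⟨j, S, q, hSA, fun g hg => ⟨?_, ?_, ?_, fun b hbm hbM => ⟨?_, ?_⟩⟩⟩
  · refine (hg.fieldEnergy_le hΦ hc₂ _ v).trans (le_trans ?_ hle')
    gcongr
    exact h2.trans ((min_le_left _ _).trans (min_le_right _ _))
  · have := hpert g hg U p (v - p) hpm (hvm.sub hpm) hUM hpU hvp
    rwa [add_sub_cancel] at this
  · have := hpert g hg U v (p - v) hvm (hpm.sub hvm) hUM (hvU.trans hvM) hpv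
    rwa [add_sub_cancel] at this
  · exact hpert g hg U b (v - p) hbm (hvm.sub hpm) hUM (hbM.trans hMM) hvp
  · exact hpert g hg U b (p - v) hbm (hpm.sub hvm) hUM (hbM.trans hMM) hpv

theorem ENNReal.quarter_add (ε : ℝ≥0∞) : ε / 4 + ε / 4 + ε / 4 + ε / 4 = ε := by
  have h : ε / 4 = ε / 2 / 2 := by
    rw [ENNReal.div_eq_inv_mul, ENNReal.div_eq_inv_mul, ENNReal.div_eq_inv_mul, ← mul_assoc,
      ← ENNReal.mul_inv (by simp) (by simp)]
    norm_num
  rw [h, ENNReal.add_halves, add_assoc, ENNReal.add_halves, ENNReal.add_halves]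

/-- For `w` near `u`, the function `p_z · x + (w - u)` is near `p_z · x` on each cube, so its energy
is at least the cell value up to a small error. Its gradient is `Dw + (p - Du)`, with `p - Du` small
in modular, so summing over cubes bounds the energy of `w` from below by that of the step field. The
four errors `ε / 4` are this perturbation, the cell limits, the passage from `Du` to the step field,
and the part of `A` not covered by cubes. -/
theorem gammaLower_limitIntegrand (hΦ : IsYoungFunction Φ) (hc₁ : 0 < c₁) (hc₂ : 0 < c₂)
    (hf : ∀ k, IsConvexIntegrand c₁ c₂ Φ (f k)) {P : ℕ → Euc n} (hP : DenseRange P)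
    (hcell : ∀ m, HasCellLimits Φ f (P m)) (hAo : IsOpen A) (hAf : volume A < ⊤)
    (huv : HasOrliczGradient Φ A u v) :
    GammaLower Φ f A u (fieldEnergy (limitIntegrand Φ f) A v) := by
  intro ε hε
  have hlim := isConvexIntegrand_limitIntegrand hΦ hc₁ hc₂ hf
  have hε4 : 0 < ε / 4 := ENNReal.div_pos hε.ne' (by finiteness)
  have hE := fieldEnergy_lt_top hΦ hc₂ hlim hAf (huv.inOrlicz hΦ)
  set E := fieldEnergy (limitIntegrand Φ f) A v with hEdef
  have hc1' : (ENNReal.ofReal c₁)⁻¹ ≠ ⊤ := ENNReal.inv_ne_top.2 (ENNReal.ofReal_pos.2 hc₁).ne'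
  obtain ⟨j, S, q, hSA, happ⟩ := exists_dyadic_energy_approx hΦ hc₁ hc₂ hAo hAf (huv.inOrlicz hΦ) hP
    (M := (ENNReal.ofReal c₁)⁻¹ * E) (ENNReal.mul_ne_top hc1' hE.ne) hε4
  set U : Set (Euc n) := ⋃ z ∈ S, dyadicCube j z with hU
  have hUA : U ⊆ A := iUnion₂_subset hSA
  have hUm : MeasurableSet U := S.measurableSet_biUnion fun z _ => (isOpen_dyadicCube j z).measurableSet
  obtain ⟨ε', hε', hle⟩ := ENNReal.exists_pos_mul_le (ENNReal.natCast_ne_top S.card) hε4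
  choose δ hδ hk using fun z => hcell (q z) j z ε' hε'
  obtain ⟨d, hd, hd'⟩ : ∃ d : ℝ≥0∞, 0 < d ∧ ∀ z ∈ S, d ≤ δ z := by
    refine ⟨S.inf δ, ?_, fun i hi => Finset.inf_le hi⟩
    rw [Finset.lt_inf_iff (by simp)]
    exact fun z _ => hδ z
  refine ⟨d, hd, ?_⟩
  filter_upwards [(S.eventually_all).2 fun z _ => hk z] with k hk w v' hwv hwu
  -- If the energy of `w` exceeds `E` there is nothing to prove; otherwise coercivity supplies the
  -- modular bound fixed in advance.
  rcases le_total E (fieldEnergy (f k) A v') with hle0 | hle0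
  · exact hle0.trans le_self_add
  obtain ⟨ha1, ha2, -, -⟩ := happ _ hlim
  obtain ⟨-, -, -, hb⟩ := happ _ (hf k)
  have hv'U : orliczModular Φ U v' ≤ (ENNReal.ofReal c₁)⁻¹ * E :=
    (orliczModular_mono_set hUA v').trans
      (((hf k).orliczModular_le_fieldEnergy hc₁ A v').trans (by gcongr))
  have hb2 := (hb v' ((hwv.inOrlicz hΦ).1.mono_set hUA) hv'U).2
  have hsum : ∑ z ∈ S, cellValue Φ f (P (q z)) j z ≤
      fieldEnergy (f k) U (v' + ((fun x => P (q (dyadicIndex j x))) - v)) + ε / 4 := by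
    calc ∑ z ∈ S, cellValue Φ f (P (q z)) j z
        ≤ ∑ z ∈ S, (fieldEnergy (f k) (dyadicCube j z) ((fun _ => P (q z)) + (v' - v)) + ε') := by
          refine Finset.sum_le_sum fun z hz => ?_
          have hsub := hSA z hz
          refine hk z hz ((fun x => inner ℝ (P (q z)) x) + (w - u)) _
            ((HasOrliczGradient.linear hΦ (isBounded_dyadicCube j z) (P (q z))).add hΦ
              (volume_dyadicCube_lt_top j z) ((hwv.sub hΦ hAf huv).mono_set hΦ hAo hAf hsub)) ?_
          rw [add_sub_cancel_left]
          exact (orliczModular_mono_set hsub _).trans (hwu.trans (hd' z hz))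
      _ ≤ _ := by
          rw [Finset.sum_add_distrib, Finset.sum_const, nsmul_eq_mul,
            sum_fieldEnergy_dyadicCube (f k) j S (fun z => P (q z)) (v' - v)]
          refine add_le_add (le_of_eq ?_) hle
          congr 1
          abel
  calc E = fieldEnergy (limitIntegrand Φ f) U v + fieldEnergy (limitIntegrand Φ f) (A \ U) v :=
        fieldEnergy_add_diff _ hUm hUA v
    _ ≤ (fieldEnergy (limitIntegrand Φ f) U (fun x => P (q (dyadicIndex j x))) + ε / 4) + ε / 4 :=
        add_le_add ha2 ha1
    _ ≤ ((fieldEnergy (f k) U v' + ε / 4 + ε / 4) + ε / 4) + ε / 4 := by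
        rw [← sum_cellValue hΦ hc₁ hc₂ hf hcell]
        gcongr
        exact hsum.trans (by gcongr)
    _ ≤ ((fieldEnergy (f k) A v' + ε / 4 + ε / 4) + ε / 4) + ε / 4 := by
        gcongr
        exact fieldEnergy_mono_set hUA v'
    _ = fieldEnergy (f k) A v' + (ε / 4 + ε / 4 + ε / 4 + ε / 4) := by ring
    _ = _ := by rw [ENNReal.quarter_add]

/-- The recovery function is `u + ζ`, with `ζ` the glued corrector of the linear functions. On the
cubes `p + η` has nearly the limit energy of the step field, and replacing `p` by `Du` costs little.
Elsewhere `η = 0` and the energy of `Du` is small. -/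
theorem gammaUpper_limitIntegrand (hΦ : IsYoungFunction Φ) (hc₁ : 0 < c₁) (hc₂ : 0 < c₂)
    (hf : ∀ k, IsConvexIntegrand c₁ c₂ Φ (f k)) {P : ℕ → Euc n} (hP : DenseRange P)
    (hcell : ∀ m, HasCellLimits Φ f (P m)) (hAo : IsOpen A) (hAf : volume A < ⊤)
    (huv : HasOrliczGradient Φ A u v) :
    GammaUpper Φ f A u (fieldEnergy (limitIntegrand Φ f) A v) := by
  intro ε₀ hε₀
  -- With `ε ≤ 1` the energy of `p + η` is at most `E + 1 + 1`, so the modular bound `M` can be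
  -- fixed before the dyadic approximation is chosen.
  set ε := min ε₀ 1 with hεdef
  have hε : 0 < ε := lt_min hε₀ one_pos
  have hlim := isConvexIntegrand_limitIntegrand hΦ hc₁ hc₂ hf
  have hε4 : 0 < ε / 4 := ENNReal.div_pos hε.ne' (by finiteness)
  have hε41 : ε / 4 ≤ 1 := ENNReal.div_le_of_le_mul
    ((min_le_right _ _).trans (by norm_num))
  have hE := (fieldEnergy_lt_top hΦ hc₂ hlim hAf (huv.inOrlicz hΦ)).ne
  set E := fieldEnergy (limitIntegrand Φ f) A v with hEdef
  have hc1' : (ENNReal.ofReal c₁)⁻¹ ≠ ⊤ := ENNReal.inv_ne_top.2 (ENNReal.ofReal_pos.2 hc₁).ne'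
  obtain ⟨j, S, q, hSA, happ⟩ := exists_dyadic_energy_approx hΦ hc₁ hc₂ hAo hAf (huv.inOrlicz hΦ) hP
    (M := (ENNReal.ofReal c₁)⁻¹ * (E + 1 + 1)) (by finiteness) hε4
  set U : Set (Euc n) := ⋃ z ∈ S, dyadicCube j z with hU
  have hUA : U ⊆ A := iUnion₂_subset hSA
  have hUm : MeasurableSet U := S.measurableSet_biUnion fun z _ => (isOpen_dyadicCube j z).measurableSet
  have hpm : AEStronglyMeasurable (fun x => P (q (dyadicIndex j x))) (volume.restrict U) :=
    ((measurable_of_countable (fun z => P (q z))).comp (measurable_dyadicIndex j)).aestronglyMeasurable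
  filter_upwards [exists_glued_corrector hΦ hc₁ hc₂ hf hAo hAf S (Q := dyadicCube j)
    (fun z _ => isOpen_dyadicCube j z) hSA (pairwiseDisjoint_dyadicCube j _)
    (fun z _ => HasOrliczGradient.linear hΦ (isBounded_dyadicCube j z) (P (q z)))
    (fun z _ => gammaUpper_cellValue hΦ hc₂ hf (P (q z)) j z)
    (fun z _ => cellValue_ne_top hΦ hc₂ hf (P (q z)) j z) hε4] with k ⟨ζ, η, h1, h2, h3, h4⟩
  obtain ⟨-, -, ha3, -⟩ := happ _ hlim
  obtain ⟨hb1, -, -, hb⟩ := happ _ (hf k)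
  rw [sum_fieldEnergy_dyadicCube (f k) j S (fun z => P (q z)) η,
    sum_cellValue hΦ hc₁ hc₂ hf hcell] at h4
  have hEU : fieldEnergy (limitIntegrand Φ f) U v ≤ E := fieldEnergy_mono_set hUA v
  have h5 : fieldEnergy (f k) U ((fun x => P (q (dyadicIndex j x))) + η) ≤ E + ε / 4 + ε / 4 :=
    h4.trans (by gcongr; exact ha3.trans (by gcongr))
  have hmod : orliczModular Φ U ((fun x => P (q (dyadicIndex j x))) + η) ≤
      (ENNReal.ofReal c₁)⁻¹ * (E + 1 + 1) :=
    ((hf k).orliczModular_le_fieldEnergy hc₁ U _).trans (by gcongr; exact h5.trans (by gcongr))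
  have hb2 := (hb _ (hpm.add ((h1.inOrlicz hΦ).1.mono_set hUA)) hmod).1
  refine ⟨_, _, huv.add hΦ hAf h1, ?_, ?_⟩
  · rw [add_sub_cancel_left]
    exact h3.trans ((ENNReal.div_le_of_le_mul (le_mul_of_one_le_right' (by norm_num))).trans
      (min_le_left _ _))
  · have e1 : fieldEnergy (f k) (A \ U) (v + η) = fieldEnergy (f k) (A \ U) v :=
      setLIntegral_congr_fun (hAo.measurableSet.diff hUm) fun x hx => by simp [h2 x hx.2]
    have e2 : (fun x => P (q (dyadicIndex j x))) + η + (v - fun x => P (q (dyadicIndex j x))) = v + η := by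
      abel
    rw [e2] at hb2
    calc fieldEnergy (f k) A (v + η) = fieldEnergy (f k) U (v + η) + fieldEnergy (f k) (A \ U) (v + η) :=
          fieldEnergy_add_diff _ hUm hUA _
      _ ≤ (E + ε / 4 + ε / 4 + ε / 4) + ε / 4 := by
          rw [e1]
          gcongr
          exact hb2.trans (by gcongr)
      _ = E + (ε / 4 + ε / 4 + ε / 4 + ε / 4) := by ring
      _ ≤ E + ε₀ := by rw [ENNReal.quarter_add]; gcongr; exact min_le_left _ _

end GammaLimit

/-! ### Weak compactness in `L¹` along an ultrafilter -/

section WeakCompactness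

variable {X : Type*} [MeasurableSpace X] {μ : Measure X}

/-- Setwise limits along an ultrafilter of uniformly absolutely continuous measures are measures. -/
theorem exists_measure_tendsto [IsFiniteMeasure μ] (𝒰 : Ultrafilter ℕ) {h : ℕ → X → ℝ≥0∞}
    {C : ℝ≥0∞} (hC : C ≠ ⊤) (hb : ∀ k, ∫⁻ x, h k x ∂μ ≤ C)
    (hui : ∀ ε : ℝ≥0∞, 0 < ε → ∃ δ : ℝ≥0∞, 0 < δ ∧ ∀ k B, MeasurableSet B → μ B ≤ δ →
      ∫⁻ x in B, h k x ∂μ ≤ ε) :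
    ∃ ν : Measure X, IsFiniteMeasure ν ∧ ν ≪ μ ∧ ∀ B, MeasurableSet B →
      Tendsto (fun k => ∫⁻ x in B, h k x ∂μ) 𝒰 (𝓝 (ν B)) := by
  -- Along an ultrafilter every `[0, ∞]`-valued sequence converges, so the limits exist for all sets
  -- at once without extraction.
  have hex : ∀ B : Set X, ∃ l, Tendsto (fun k => ∫⁻ x in B, h k x ∂μ) 𝒰 (𝓝 l) := by
    intro B
    obtain ⟨l, -, hl⟩ := isCompact_univ.ultrafilter_le_nhds (𝒰.map fun k => ∫⁻ x in B, h k x ∂μ)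
      (by simp)
    exact ⟨l, hl⟩
  choose m hm using hex
  have hm0 : m ∅ = 0 := tendsto_nhds_unique (hm ∅) (by simp)
  have hunion : ∀ A B : Set X, MeasurableSet B → Disjoint A B → m (A ∪ B) = m A + m B := by
    intro A B hB hAB
    refine tendsto_nhds_unique (hm _) (((hm A).add (hm B)).congr fun k => ?_)
    rw [lintegral_union hB hAB]
  have hsmall : ∀ ε : ℝ≥0∞, 0 < ε → ∃ δ : ℝ≥0∞, 0 < δ ∧ ∀ B, MeasurableSet B → μ B ≤ δ → m B ≤ ε :=
    fun ε hε => (hui ε hε).imp fun δ ⟨hδ, H⟩ => ⟨hδ, fun B hB hBδ =>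
      le_of_tendsto' (hm B) fun k => H k B hB hBδ⟩
  have hsum : ∀ s : ℕ → Set X, (∀ i, MeasurableSet (s i)) → Pairwise (Function.onFun Disjoint s) →
      m (⋃ i, s i) = ∑' i, m (s i) := by
    intro s hs hd
    have hfin : ∀ N, m (⋃ i ∈ Finset.range N, s i) = ∑ i ∈ Finset.range N, m (s i) := by
      intro N
      induction N with
      | zero => simpa using hm0
      | succ N ih =>
        rw [Finset.sum_range_succ, ← ih, ← hunion _ _ (hs N)]
        · congr 1
          ext x
          simp only [Finset.mem_range, mem_iUnion, mem_union, exists_prop, Nat.lt_succ_iff_lt_or_eq]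
          constructor
          · rintro ⟨i, hi | rfl, hx⟩
            · exact Or.inl ⟨i, hi, hx⟩
            · exact Or.inr hx
          · rintro (⟨i, hi, hx⟩ | hx)
            · exact ⟨i, Or.inl hi, hx⟩
            · exact ⟨N, Or.inr rfl, hx⟩
        · refine disjoint_iUnion₂_left.2 fun i hi => hd (Finset.mem_range.1 hi).ne
    -- Finite additivity passes to the limit at once. For countable additivity the tails `T N`
    -- shrink to the empty set, and uniform absolute continuity forces `m (T N) → 0`.
    set T : ℕ → Set X := fun N => (⋃ i, s i) \ ⋃ i ∈ Finset.range N, s i with hT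
    have hTm : ∀ N, MeasurableSet (T N) := fun N =>
      (MeasurableSet.iUnion hs).diff ((Finset.range N).measurableSet_biUnion fun i _ => hs i)
    have hTanti : Antitone T := fun N N' hNN' => sdiff_subset_sdiff_right
      (biUnion_subset_biUnion_left fun i hi => Finset.mem_range.2
        ((Finset.mem_range.1 hi).trans_le hNN'))
    have hTe : ⋂ N, T N = ∅ := by
      refine eq_empty_iff_forall_notMem.2 fun x hx => ?_
      obtain ⟨i, hi⟩ := mem_iUnion.1 (mem_iInter.1 hx 0).1
      refine (mem_iInter.1 hx (i + 1)).2 ?_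
      exact mem_iUnion₂.2 ⟨i, Finset.mem_range.2 (Nat.lt_succ_self i), hi⟩
    have hTμ : Tendsto (fun N => μ (T N)) atTop (𝓝 0) := by
      have := tendsto_measure_iInter_atTop (μ := μ) (fun N => (hTm N).nullMeasurableSet) hTanti
        ⟨0, measure_ne_top _ _⟩
      rwa [hTe, measure_empty] at this
    have hTm0 : Tendsto (fun N => m (T N)) atTop (𝓝 0) := by
      rw [ENNReal.tendsto_nhds_zero]
      intro ε hε
      obtain ⟨δ, hδ, H⟩ := hsmall ε hε
      filter_upwards [ENNReal.tendsto_nhds_zero.1 hTμ δ hδ] with N hN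
      exact H _ (hTm N) hN
    have hdec : ∀ N, m (⋃ i, s i) = ∑ i ∈ Finset.range N, m (s i) + m (T N) := by
      intro N
      rw [← hfin, ← hunion _ _ (hTm N) disjoint_sdiff_right]
      congr 1
      exact (union_sdiff_cancel (iUnion₂_subset fun i _ => subset_iUnion s i)).symm
    have hl := (ENNReal.tendsto_nat_tsum fun i => m (s i)).add hTm0
    rw [add_zero] at hl
    exact tendsto_nhds_unique (tendsto_const_nhds.congr hdec) hl
  set ν : Measure X := Measure.ofMeasurable (fun B _ => m B) hm0 (fun s hs hd => hsum s hs hd) with hν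
  have hνB : ∀ B, MeasurableSet B → ν B = m B := fun B hB => Measure.ofMeasurable_apply B hB
  refine ⟨ν, ⟨?_⟩, ?_, fun B hB => by rw [hνB B hB]; exact hm B⟩
  · rw [hνB _ MeasurableSet.univ]
    refine (le_of_tendsto' (hm univ) fun k => ?_).trans_lt hC.lt_top
    rw [Measure.restrict_univ]
    exact hb k
  · refine Measure.AbsolutelyContinuous.mk fun B hB hB0 => ?_
    rw [hνB B hB]
    refine le_antisymm (tendsto_nhds_unique (hm B) (tendsto_const_nhds.congr fun k => ?_)).le zero_le
    rw [setLIntegral_measure_zero _ _ hB0]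

/-- Rounding down to multiples of `η` takes finitely many values because `ψ` is bounded. -/
theorem exists_simpleFunc_abs_sub_le {ψ : X → ℝ} (hψ : Measurable ψ) {B : ℝ} (hB : ∀ x, |ψ x| ≤ B)
    {η : ℝ} (hη : 0 < η) : ∃ s : SimpleFunc X ℝ, ∀ x, |ψ x - s x| ≤ η := by
  have hm : Measurable fun x => (⌊ψ x / η⌋ : ℝ) * η := by fun_prop
  refine ⟨⟨fun x => ⌊ψ x / η⌋ * η, fun c => hm (measurableSet_singleton c), ?_⟩, fun x => ?_⟩
  · refine ((Set.finite_Icc ⌊-B / η⌋ ⌊B / η⌋).image fun z : ℤ => (z : ℝ) * η).subset ?_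
    rintro _ ⟨x, rfl⟩
    refine ⟨⌊ψ x / η⌋, ⟨Int.floor_le_floor ?_, Int.floor_le_floor ?_⟩, rfl⟩
    · exact div_le_div_of_nonneg_right (abs_le.1 (hB x)).1 hη.le
    · exact div_le_div_of_nonneg_right (abs_le.1 (hB x)).2 hη.le
  · change |ψ x - ⌊ψ x / η⌋ * η| ≤ η
    have h1 := Int.floor_le (ψ x / η)
    have h2 := Int.lt_floor_add_one (ψ x / η)
    rw [le_div_iff₀ hη] at h1
    rw [div_lt_iff₀ hη] at h2
    rw [abs_le]
    constructor <;> linarith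

/-- Weak sequential compactness in `L¹` of bounded uniformly absolutely continuous sequences, along an
ultrafilter. -/
theorem exists_weak_limit [IsFiniteMeasure μ] (𝒰 : Ultrafilter ℕ) {t : ℕ → X → ℝ}
    (ht : ∀ k, AEStronglyMeasurable (t k) μ) {C : ℝ≥0∞} (hC : C ≠ ⊤) (hb : ∀ k, ∫⁻ x, ‖t k x‖ₑ ∂μ ≤ C)
    (hui : ∀ ε : ℝ≥0∞, 0 < ε → ∃ δ : ℝ≥0∞, 0 < δ ∧ ∀ k B, MeasurableSet B → μ B ≤ δ →
      ∫⁻ x in B, ‖t k x‖ₑ ∂μ ≤ ε) :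
    ∃ g : X → ℝ, Measurable g ∧ Integrable g μ ∧ ∀ (ψ : X → ℝ) (B : ℝ), Measurable ψ → (∀ x, |ψ x| ≤ B) →
      Tendsto (fun k => ∫ x, t k x * ψ x ∂μ) 𝒰 (𝓝 (∫ x, g x * ψ x ∂μ)) := by
  have hti : ∀ k, Integrable (t k) μ := fun k => ⟨ht k, (hb k).trans_lt hC.lt_top⟩
  have hle1 : ∀ k x, ENNReal.ofReal (t k x) ≤ ‖t k x‖ₑ := fun k x => by
    rw [← ofReal_norm]; exact ENNReal.ofReal_le_ofReal (Real.le_norm_self _)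
  have hle2 : ∀ k x, ENNReal.ofReal (-t k x) ≤ ‖t k x‖ₑ := fun k x => by
    rw [← ofReal_norm, ← norm_neg]; exact ENNReal.ofReal_le_ofReal (Real.le_norm_self _)
  -- Positive and negative parts have limit measures separately; the weak limit is the difference of
  -- their Radon–Nikodym densities.
  obtain ⟨ν₁, hf₁, hac₁, hν₁⟩ := exists_measure_tendsto (μ := μ) 𝒰
    (h := fun k x => ENNReal.ofReal (t k x)) hC
    (fun k => (lintegral_mono (hle1 k)).trans (hb k)) fun ε hε => (hui ε hε).imp fun δ ⟨hδ, H⟩ =>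
      ⟨hδ, fun k B hB hB' => (lintegral_mono (hle1 k)).trans (H k B hB hB')⟩
  obtain ⟨ν₂, hf₂, hac₂, hν₂⟩ := exists_measure_tendsto (μ := μ) 𝒰
    (h := fun k x => ENNReal.ofReal (-t k x)) hC
    (fun k => (lintegral_mono (hle2 k)).trans (hb k)) fun ε hε => (hui ε hε).imp fun δ ⟨hδ, H⟩ =>
      ⟨hδ, fun k B hB hB' => (lintegral_mono (hle2 k)).trans (H k B hB hB')⟩
  set g : X → ℝ := fun x => (ν₁.rnDeriv μ x).toReal - (ν₂.rnDeriv μ x).toReal with hg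
  have hi₁ : Integrable (fun x => (ν₁.rnDeriv μ x).toReal) μ := Measure.integrable_toReal_rnDeriv
  have hi₂ : Integrable (fun x => (ν₂.rnDeriv μ x).toReal) μ := Measure.integrable_toReal_rnDeriv
  have hgi : Integrable g μ := hi₁.sub hi₂
  have hgm : Measurable g := ((Measure.measurable_rnDeriv ν₁ μ).ennreal_toReal).sub
    ((Measure.measurable_rnDeriv ν₂ μ).ennreal_toReal)
  have hset : ∀ B, MeasurableSet B →
      Tendsto (fun k => ∫ x in B, t k x ∂μ) 𝒰 (𝓝 (∫ x in B, g x ∂μ)) := by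
    intro B hB
    have e : ∫ x in B, g x ∂μ = (ν₁ B).toReal - (ν₂ B).toReal := by
      rw [hg, integral_sub hi₁.integrableOn hi₂.integrableOn, Measure.setIntegral_toReal_rnDeriv hac₁,
        Measure.setIntegral_toReal_rnDeriv hac₂]
      rfl
    rw [e]
    refine (((ENNReal.tendsto_toReal (measure_ne_top ν₁ B)).comp (hν₁ B hB)).sub
      ((ENNReal.tendsto_toReal (measure_ne_top ν₂ B)).comp (hν₂ B hB))).congr fun k => ?_
    exact (integral_eq_lintegral_pos_part_sub_lintegral_neg_part (hti k).integrableOn).symm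
  have hmul : ∀ (w : X → ℝ) (s : SimpleFunc X ℝ), Integrable w μ → Integrable (fun x => w x * s x) μ := by
    intro w s hw
    obtain ⟨c, hc⟩ := s.exists_forall_norm_le
    exact hw.mul_bdd s.stronglyMeasurable.aestronglyMeasurable (Eventually.of_forall hc)
  have hsimple : ∀ s : SimpleFunc X ℝ,
      Tendsto (fun k => ∫ x, t k x * s x ∂μ) 𝒰 (𝓝 (∫ x, g x * s x ∂μ)) := by
    intro s
    induction s using SimpleFunc.induction with
    | @const c B hB =>
      have e : ∀ w : X → ℝ, ∫ x, w x * (SimpleFunc.piecewise B hB (SimpleFunc.const X c)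
          (SimpleFunc.const X 0)) x ∂μ = (∫ x in B, w x ∂μ) * c := by
        intro w
        rw [← integral_mul_const, ← integral_indicator hB]
        refine integral_congr_ae (Eventually.of_forall fun x => ?_)
        by_cases hx : x ∈ B <;> simp [hx]
      simp only [e]
      exact (hset B hB).mul_const c
    | @add s₁ s₂ _ h₁ h₂ =>
      have e : ∀ w : X → ℝ, Integrable w μ → ∫ x, w x * (s₁ + s₂) x ∂μ =
          ∫ x, w x * s₁ x ∂μ + ∫ x, w x * s₂ x ∂μ := by
        intro w hw
        rw [← integral_add (hmul w s₁ hw) (hmul w s₂ hw)]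
        simp [mul_add]
      rw [e g hgi]
      exact (h₁.add h₂).congr fun k => (e _ (hti k)).symm
  refine ⟨g, hgm, hgi, fun ψ B hψ hB => ?_⟩
  have hψi : ∀ w : X → ℝ, Integrable w μ → Integrable (fun x => w x * ψ x) μ := fun w hw =>
    hw.mul_bdd hψ.aestronglyMeasurable (Eventually.of_forall hB)
  have hdiff : ∀ (w : X → ℝ) (s : SimpleFunc X ℝ) (η K : ℝ), 0 ≤ η → Integrable w μ → (∀ x, |ψ x - s x| ≤ η) →
      ∫ x, ‖w x‖ ∂μ ≤ K → |∫ x, w x * ψ x ∂μ - ∫ x, w x * s x ∂μ| ≤ K * η := by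
    intro w s η K hη hw hs hK
    rw [← integral_sub (hψi w hw) (hmul w s hw), ← Real.norm_eq_abs]
    refine (norm_integral_le_integral_norm _).trans ?_
    calc ∫ x, ‖w x * ψ x - w x * s x‖ ∂μ ≤ ∫ x, ‖w x‖ * η ∂μ := by
          refine integral_mono ((hψi w hw).sub (hmul w s hw)).norm (hw.norm.mul_const η) fun x => ?_
          dsimp only
          rw [← mul_sub, norm_mul]
          exact mul_le_mul_of_nonneg_left (hs x) (norm_nonneg _)
      _ = (∫ x, ‖w x‖ ∂μ) * η := integral_mul_const _ _
      _ ≤ K * η := mul_le_mul_of_nonneg_right hK hη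
  have htK : ∀ k, ∫ x, ‖t k x‖ ∂μ ≤ C.toReal := fun k => by
    rw [integral_norm_eq_lintegral_enorm (ht k)]
    exact ENNReal.toReal_mono hC (hb k)
  rw [Metric.tendsto_nhds]
  intro ε hε
  set K := max C.toReal (∫ x, ‖g x‖ ∂μ) with hK
  have hK0 : 0 ≤ K := ENNReal.toReal_nonneg.trans (le_max_left _ _)
  -- The test function is approximated uniformly, at cost `K η` for `t k` and for `g`, as `K` bounds
  -- both `L¹` norms.
  have hη : 0 < ε / (4 * (K + 1)) := by positivity
  obtain ⟨s, hs⟩ := exists_simpleFunc_abs_sub_le hψ hB hη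
  have hsm : K * (ε / (4 * (K + 1))) ≤ ε / 4 := by
    rw [mul_div_assoc', div_le_div_iff₀ (by positivity) (by norm_num)]
    nlinarith
  filter_upwards [Metric.tendsto_nhds.1 (hsimple s) (ε / 4) (by positivity)] with k hk
  have h1 := hdiff (t k) s _ K hη.le (hti k) hs ((htK k).trans (le_max_left _ _))
  have h2 := hdiff g s _ K hη.le hgi hs (le_max_right _ _)
  rw [Real.dist_eq] at hk ⊢
  have h3 := abs_le.1 (h1.trans hsm)
  have h4 := abs_le.1 (h2.trans hsm)
  have h5 := abs_lt.1 hk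
  rw [abs_lt]
  constructor <;> linarith [h3.1, h3.2, h4.1, h4.2, h5.1, h5.2]

end WeakCompactness

/-! ### Closedness of the Orlicz–Sobolev space under bounded energy -/

section Closure

variable {n : ℕ} {Φ : ℝ → ℝ} {A : Set (Euc n)}

/-- The de la Vallée-Poussin criterion: superlinearity gives `s ≤ R + r Φ(s)` with `r` as small as
desired. -/
theorem IsYoungFunction.exists_uniform_integrability (hΦ : IsYoungFunction Φ) {M : ℝ≥0∞} (hM : M ≠ ⊤)
    {ε : ℝ≥0∞} (hε : 0 < ε) : ∃ R : ℝ, 0 ≤ R ∧ ∀ (A B : Set (Euc n)) (t : Euc n → ℝ),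
      orliczModular Φ A t ≤ M → MeasurableSet B →
        ∫⁻ x in B, ‖t x‖ₑ ∂volume.restrict A ≤ ENNReal.ofReal R * (volume.restrict A) B + ε := by
  obtain ⟨r, hr0, -, hr⟩ := ENNReal.exists_real_mul_le hM hε
  obtain ⟨R, hR0, hR⟩ := hΦ.superlinear r⁻¹
  refine ⟨R, hR0, fun A B t ht hB => ?_⟩
  calc ∫⁻ x in B, ‖t x‖ₑ ∂volume.restrict A
      ≤ ∫⁻ x in B, (ENNReal.ofReal R + ENNReal.ofReal r * ENNReal.ofReal (Φ ‖t x‖)) ∂volume.restrict A := by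
        refine lintegral_mono fun x => ?_
        have h0 := hΦ.nonneg (norm_nonneg (t x))
        rw [← ofReal_norm, ← ENNReal.ofReal_mul hr0.le, ← ENNReal.ofReal_add hR0 (by positivity)]
        refine ENNReal.ofReal_le_ofReal ?_
        rcases le_total R ‖t x‖ with h | h
        · have := hR _ h
          rw [inv_mul_le_iff₀ hr0] at this
          linarith
        · have : 0 ≤ r * Φ ‖t x‖ := by positivity
          linarith
    _ = ENNReal.ofReal R * (volume.restrict A) B +
          ENNReal.ofReal r * ∫⁻ x in B, ENNReal.ofReal (Φ ‖t x‖) ∂volume.restrict A := by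
        rw [lintegral_add_left measurable_const, setLIntegral_const,
          lintegral_const_mul' _ _ ENNReal.ofReal_ne_top]
    _ ≤ ENNReal.ofReal R * (volume.restrict A) B + ENNReal.ofReal r * M := by
        gcongr
        exact (setLIntegral_le_lintegral _ _).trans ht
    _ ≤ _ := by gcongr

/-- Bounded modulars give uniform integrability, hence a weak `L¹` limit `g`. That `g` has finite
modular follows from supporting lines of `Φ` at `|g|`, used as bounded test functions on `{|g| ≤
N}`, and monotone convergence in `N`. -/
theorem exists_orlicz_weak_limit (hΦ : IsYoungFunction Φ) (hAf : volume A < ⊤) (𝒰 : Ultrafilter ℕ)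
    {t : ℕ → Euc n → ℝ} (ht : ∀ k, InOrlicz Φ A (t k)) {M : ℝ≥0∞} (hM : M ≠ ⊤)
    (hb : ∀ k, orliczModular Φ A (t k) ≤ M) :
    ∃ g : Euc n → ℝ, InOrlicz Φ A g ∧ ∀ (ψ : Euc n → ℝ) (B : ℝ), Measurable ψ → (∀ x, |ψ x| ≤ B) →
      Tendsto (fun k => ∫ x in A, t k x * ψ x) 𝒰 (𝓝 (∫ x in A, g x * ψ x)) := by
  have : IsFiniteMeasure (volume.restrict A) := ⟨by rwa [Measure.restrict_apply_univ]⟩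
  obtain ⟨R₁, -, hR₁⟩ := hΦ.exists_uniform_integrability (n := n) hM one_pos
  have hbd : ∀ k, ∫⁻ x in A, ‖t k x‖ₑ ≤ ENNReal.ofReal R₁ * volume A + 1 := by
    intro k
    have := hR₁ A univ (t k) (hb k) MeasurableSet.univ
    rwa [Measure.restrict_univ, Measure.restrict_apply_univ] at this
  obtain ⟨g, hgm, hgi, hg⟩ := exists_weak_limit 𝒰 (fun k => (ht k).1)
    (ENNReal.add_ne_top.2 ⟨ENNReal.mul_ne_top ENNReal.ofReal_ne_top hAf.ne, ENNReal.one_ne_top⟩) hbd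
    (fun ε hε => by
      obtain ⟨R, -, hR⟩ := hΦ.exists_uniform_integrability (n := n) hM (ENNReal.half_pos hε.ne')
      obtain ⟨δ, hδ, hle⟩ := ENNReal.exists_pos_mul_le (K := ENNReal.ofReal R) ENNReal.ofReal_ne_top
        (ENNReal.half_pos hε.ne')
      refine ⟨δ, hδ, fun k B hB hBδ => (hR A B (t k) (hb k) hB).trans ?_⟩
      calc ENNReal.ofReal R * (volume.restrict A) B + ε / 2 ≤ ε / 2 + ε / 2 := by
            gcongr
            exact le_trans (by gcongr) hle
        _ = ε := ENNReal.add_halves ε)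
  refine ⟨g, ⟨hgm.aestronglyMeasurable, ?_⟩, hg⟩
  obtain ⟨s, hsm, hs0, -, -, hs, -⟩ := hΦ.exists_slope
  have hΦm : Measurable fun x => Φ ‖g x‖ := (hΦ.measurable_norm (F := ℝ)).comp hgm
  have key : ∀ N : ℕ, ∫⁻ x in A, {x | |g x| ≤ N}.indicator (fun x => ENNReal.ofReal (Φ ‖g x‖)) x ≤ M := by
    intro N
    have hSm : MeasurableSet {x | |g x| ≤ N} := measurableSet_le hgm.abs measurable_const
    set S : Set (Euc n) := {x | |g x| ≤ N} with hS
    -- This is a subgradient of `Φ(|·|)` at `g`, bounded by `s N` thanks to the restriction to `{|g|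
    -- ≤ N}`.
    set ψ : Euc n → ℝ := S.indicator fun x => s |g x| * SignType.sign (g x) with hψ
    have hsgn : Measurable fun x => ((SignType.sign (g x) : SignType) : ℝ) := by
      have : (fun x => ((SignType.sign (g x) : SignType) : ℝ)) =
          fun x => if 0 < g x then (1 : ℝ) else if g x < 0 then -1 else 0 := by
        ext x
        rw [sign_apply]
        split_ifs <;> simp
      rw [this]
      exact Measurable.ite (measurableSet_lt measurable_const hgm) measurable_const
        (Measurable.ite (measurableSet_lt hgm measurable_const) measurable_const measurable_const)
    have hψm : Measurable ψ := ((hsm.measurable.comp hgm.abs).mul hsgn).indicator hSm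
    have hsgn1 : ∀ r : ℝ, |((SignType.sign r : SignType) : ℝ)| ≤ 1 := fun r => by
      rcases lt_trichotomy r 0 with h | h | h <;> simp [h]
    have hψB : ∀ x, |ψ x| ≤ s N := by
      intro x
      by_cases hx : x ∈ S
      · rw [hψ, indicator_of_mem hx, abs_mul, abs_of_nonneg (hs0 _)]
        exact (mul_le_of_le_one_right (hs0 _) (hsgn1 _)).trans (hsm hx)
      · rw [hψ, indicator_of_notMem hx, abs_zero]; exact hs0 _
    have hcut : IntegrableOn (S.indicator fun x => Φ ‖g x‖) A := by
      refine Integrable.of_bound ((hΦm.indicator hSm).aestronglyMeasurable) (Φ N)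
        (Eventually.of_forall fun x => ?_)
      by_cases hx : x ∈ S
      · rw [indicator_of_mem hx, Real.norm_of_nonneg (hΦ.nonneg (norm_nonneg _))]
        exact hΦ.mono (norm_nonneg _) hx
      · rw [indicator_of_notMem hx, norm_zero]; exact hΦ.nonneg (Nat.cast_nonneg _)
    have hpt : ∀ k x, S.indicator (fun x => Φ ‖g x‖) x + (t k x * ψ x - g x * ψ x) ≤ Φ ‖t k x‖ := by
      intro k x
      by_cases hx : x ∈ S
      · rw [hψ, indicator_of_mem hx, indicator_of_mem hx]
        have h1 := hs |g x| |t k x| (abs_nonneg _) (abs_nonneg _)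
        have h2 : g x * (SignType.sign (g x) : ℝ) = |g x| := self_mul_sign (g x)
        have h3 : t k x * (SignType.sign (g x) : ℝ) ≤ |t k x| := by
          refine (le_abs_self _).trans ?_
          rw [abs_mul]
          exact mul_le_of_le_one_right (abs_nonneg _) (hsgn1 _)
        have h4 := mul_le_mul_of_nonneg_left h3 (hs0 |g x|)
        rw [Real.norm_eq_abs, Real.norm_eq_abs]
        have h5 : g x * (s |g x| * (SignType.sign (g x) : ℝ)) = s |g x| * |g x| := by
          rw [mul_left_comm, h2]
        rw [h5]
        nlinarith
      · rw [hψ, indicator_of_notMem hx, indicator_of_notMem hx]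
        simpa using hΦ.nonneg (norm_nonneg (t k x))
    have hψi : ∀ w : Euc n → ℝ, IntegrableOn w A → IntegrableOn (fun x => w x * ψ x) A := fun w hw =>
      hw.mul_bdd hψm.aestronglyMeasurable (Eventually.of_forall hψB)
    have hti : ∀ k, IntegrableOn (t k) A := fun k => (ht k).integrableOn hΦ hAf
    have hineq : ∀ k, (∫ x in A, S.indicator (fun x => Φ ‖g x‖) x) +
        ((∫ x in A, t k x * ψ x) - ∫ x in A, g x * ψ x) ≤ M.toReal := by
      intro k
      have hΦt : AEStronglyMeasurable (fun x => Φ ‖t k x‖) (volume.restrict A) :=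
        ((hΦ.measurable_norm (F := ℝ)).comp_aemeasurable (ht k).1.aemeasurable).aestronglyMeasurable
      have hnn : 0 ≤ᵐ[volume.restrict A] fun x => Φ ‖t k x‖ :=
        Eventually.of_forall fun x => hΦ.nonneg (norm_nonneg _)
      have hΦi : IntegrableOn (fun x => Φ ‖t k x‖) A :=
        ⟨hΦt, by rw [hasFiniteIntegral_iff_ofReal hnn]; exact (ht k).2⟩
      have hd : IntegrableOn (fun x => t k x * ψ x - g x * ψ x) A :=
        (hψi _ (hti k)).sub (hψi _ hgi)
      rw [← integral_sub (hψi _ (hti k)) (hψi _ hgi), ← integral_add hcut hd]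
      refine (integral_mono (hcut.add hd) hΦi (hpt k)).trans ?_
      rw [integral_eq_lintegral_of_nonneg_ae hnn hΦt]
      exact ENNReal.toReal_mono hM (hb k)
    have hl := le_of_tendsto' (((hg ψ _ hψm hψB).sub_const (∫ x in A, g x * ψ x)).const_add
      (∫ x in A, S.indicator (fun x => Φ ‖g x‖) x)) hineq
    rw [sub_self, add_zero] at hl
    have hnn : 0 ≤ᵐ[volume.restrict A] S.indicator fun x => Φ ‖g x‖ :=
      Eventually.of_forall fun x => indicator_nonneg (fun x _ => hΦ.nonneg (norm_nonneg _)) x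
    rw [integral_eq_lintegral_of_nonneg_ae hnn hcut.aestronglyMeasurable] at hl
    have hfin : ∫⁻ x in A, ENNReal.ofReal (S.indicator (fun x => Φ ‖g x‖) x) ≠ ⊤ :=
      ((hasFiniteIntegral_iff_ofReal hnn).1 hcut.hasFiniteIntegral).ne
    rw [ENNReal.toReal_le_toReal hfin hM] at hl
    refine le_of_eq_of_le (lintegral_congr fun x => ?_) hl
    by_cases hx : x ∈ S <;> simp [hx]
  have hmono := lintegral_iSup (μ := volume.restrict A)
    (f := fun (N : ℕ) => {x | |g x| ≤ N}.indicator (fun x => ENNReal.ofReal (Φ ‖g x‖)))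
    (fun N => hΦm.ennreal_ofReal.indicator (measurableSet_le hgm.abs measurable_const))
    (fun N N' hNN' => by
      refine indicator_le_indicator_of_subset (fun x hx => ?_) (fun _ => zero_le)
      have hx' : |g x| ≤ N := hx
      exact hx'.trans (by exact_mod_cast hNN'))
  have hsup : ∀ x, ⨆ N : ℕ, ({x | |g x| ≤ N}.indicator (fun x => ENNReal.ofReal (Φ ‖g x‖)) x : ℝ≥0∞) =
      ENNReal.ofReal (Φ ‖g x‖) := by
    intro x
    apply le_antisymm
    · exact iSup_le fun N => indicator_le_self _ _ x
    · refine le_iSup_of_le ⌈|g x|⌉₊ ?_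
      rw [indicator_of_mem]
      exact Nat.le_ceil |g x|
  simp only [hsup] at hmono
  unfold orliczModular
  rw [hmono]
  exact (iSup_le key).trans_lt hM.lt_top

/-- `W¹_Φ` is closed under modular limits of functions with bounded gradient modulars. -/
theorem memOrliczSobolev_of_tendsto (hΦ : IsYoungFunction Φ) (hAf : volume A < ⊤)
    {w : ℕ → Euc n → ℝ} {v : ℕ → Euc n → Euc n} {u : Euc n → ℝ}
    (hwv : ∀ k, HasOrliczGradient Φ A (w k) (v k)) (hu : MemOrlicz Φ A u)
    (h : Tendsto (fun k => orliczModular Φ A (w k - u)) atTop (𝓝 0)) {M : ℝ≥0∞} (hM : M ≠ ⊤)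
    (hb : ∀ k, orliczModular Φ A (v k) ≤ M) : MemOrliczSobolev Φ A u := by
  have hcomp : ∀ i k, orliczModular Φ A (fun x => v k x i) ≤ M := fun i k =>
    (orliczModular_mono hΦ fun x => PiLp.norm_apply_le (v k x) i).trans (hb k)
  choose g hgO hg using fun i : Fin n => exists_orlicz_weak_limit hΦ hAf (hyperfilter ℕ)
    (fun k => ((hwv k).2 i).1) hM (hcomp i)
  refine ⟨fun x => WithLp.toLp 2 fun i => g i x, (hasOrliczGradient_iff hΦ hAf).2
    ⟨hu, (inOrlicz_iff_forall_apply hΦ).2 hgO, fun i ψ hψ hc hs => ?_⟩⟩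
  obtain ⟨B, hB⟩ := hψ.continuous.bounded_above_of_compact_support hc
  have h1 := hg i ψ B hψ.continuous.measurable hB
  have h2 := (tendsto_integral_gradient_mul hΦ hAf hwv hu h i hψ hc hs).mono_left
    Nat.hyperfilter_le_atTop
  have h3 := tendsto_nhds_unique h1 h2
  simp only [h3, neg_neg]

end Closure

/-! ### From uniform Γ-bounds to sequences -/

section SobolevEnergy

variable {n : ℕ} {Φ : ℝ → ℝ} {c₁ c₂ : ℝ} {A : Set (Euc n)} {u : Euc n → ℝ} {v : Euc n → Euc n}

/-- The energy `∫_A f(x, Du)`, infinite outside `W¹_Φ(A)`. -/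
noncomputable def sobolevEnergy {n : ℕ} (Φ : ℝ → ℝ) (f : Euc n → Euc n → ℝ) (A : Set (Euc n))
    (u : Euc n → ℝ) : ℝ≥0∞ :=
  ⨅ (v : Euc n → Euc n) (_ : HasOrliczGradient Φ A u v), fieldEnergy f A v

theorem HasOrliczGradient.sobolevEnergy_eq (hΦ : IsYoungFunction Φ) (hAo : IsOpen A)
    (hAf : volume A < ⊤) (h : HasOrliczGradient Φ A u v) (f : Euc n → Euc n → ℝ) :
    sobolevEnergy Φ f A u = fieldEnergy f A v := by
  refine le_antisymm (iInf₂_le v h) (le_iInf₂ fun v' h' => le_of_eq ?_)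
  exact lintegral_congr_ae ((h.ae_eq hΦ hAo hAf h').mono fun x hx => by simp only [hx])

theorem sobolevEnergy_eq_top (h : ¬ MemOrliczSobolev Φ A u) (f : Euc n → Euc n → ℝ) :
    sobolevEnergy Φ f A u = ⊤ :=
  iInf₂_eq_top.2 fun v hv => (h ⟨v, hv⟩).elim

theorem exists_fieldEnergy_lt {f : Euc n → Euc n → ℝ} {y : ℝ≥0∞}
    (h : sobolevEnergy Φ f A u < y) : ∃ v, HasOrliczGradient Φ A u v ∧ fieldEnergy f A v < y := by
  simpa only [sobolevEnergy, iInf_lt_iff, exists_prop] using h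

/-- Uniqueness of the weak gradient and the value `⊤` of an empty infimum merge the two cases of the
definition into one formula. -/
theorem mem_convexFunctionalClass_iff (hΦ : IsYoungFunction Φ)
    {F : (Euc n → ℝ) → Set (Euc n) → EReal} :
    F ∈ convexFunctionalClass n c₁ c₂ Φ ↔ ∃ f, IsConvexIntegrand c₁ c₂ Φ f ∧
      ∀ A, IsOpen A → volume A < ⊤ → ∀ u, MemOrlicz Φ A u → F u A = (sobolevEnergy Φ f A u : EReal) := by
  refine exists_congr fun f => and_congr_right fun _ => forall₂_congr fun A hAo =>
    forall_congr' fun hAf => forall₂_congr fun u hu => ⟨fun h => ?_, fun h => ⟨fun v hv => ?_, fun hn => ?_⟩⟩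
  · by_cases hs : MemOrliczSobolev Φ A u
    · obtain ⟨v, hv⟩ := hs
      rw [h.1 v hv, hv.sobolevEnergy_eq hΦ hAo hAf]
      rfl
    · rw [h.2 hs, sobolevEnergy_eq_top hs, EReal.coe_ennreal_top]
  · rw [h, hv.sobolevEnergy_eq hΦ hAo hAf]
    rfl
  · rw [h, sobolevEnergy_eq_top hn, EReal.coe_ennreal_top]

variable {f : ℕ → Euc n → Euc n → ℝ} {g : Euc n → Euc n → ℝ} {w : ℕ → Euc n → ℝ}

theorem GammaLower.le_liminf {L : ℝ≥0∞} (h : GammaLower Φ f A u L)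
    (hw : Tendsto (fun k => orliczModular Φ A (w k - u)) atTop (𝓝 0)) :
    L ≤ liminf (fun k => sobolevEnergy Φ (f k) A (w k)) atTop := by
  refine le_of_forall_lt fun y hy => ?_
  obtain ⟨r, hr, hyr⟩ := ENNReal.lt_iff_exists_add_pos_lt.1 hy
  obtain ⟨δ, hδ, hk⟩ := h (r / 2 : ℝ≥0∞) (ENNReal.half_pos (by exact_mod_cast hr.ne'))
  refine lt_of_lt_of_le (b := y + (r / 2 : ℝ≥0∞)) ?_ (le_liminf_of_le (by isBoundedDefault) ?_)
  · exact ENNReal.lt_add_right (hy.trans_le le_top).ne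
      (ENNReal.half_pos (by exact_mod_cast hr.ne')).ne'
  filter_upwards [hk, ENNReal.tendsto_nhds_zero.1 hw δ hδ] with k hk hwk
  refine le_iInf₂ fun v hv => ?_
  refine (ENNReal.add_le_add_iff_right (a := (r / 2 : ℝ≥0∞)) (by finiteness)).1 ?_
  rw [add_assoc, ENNReal.add_halves]
  exact hyr.le.trans (hk _ v hv hwk)

/-- Otherwise a subsequence has bounded energies, so by coercivity bounded gradient modulars, and
closedness would put `u` in `W¹_Φ`. -/
theorem liminf_eq_top_of_not_memOrliczSobolev (hΦ : IsYoungFunction Φ) (hc₁ : 0 < c₁)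
    (hf : ∀ k, IsConvexIntegrand c₁ c₂ Φ (f k)) (hAf : volume A < ⊤) (hu : MemOrlicz Φ A u)
    (hn : ¬ MemOrliczSobolev Φ A u)
    (hw : Tendsto (fun k => orliczModular Φ A (w k - u)) atTop (𝓝 0)) :
    liminf (fun k => sobolevEnergy Φ (f k) A (w k)) atTop = ⊤ := by
  refine eq_top_iff.2 (le_of_forall_lt_imp_le_of_dense fun y hy => ?_)
  refine le_liminf_of_le (by isBoundedDefault) ?_
  by_contra hcon
  obtain ⟨φ, hφ, hlt⟩ := extraction_of_frequently_atTop (not_eventually.1 hcon)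
  choose v hv hvy using fun k => exists_fieldEnergy_lt (not_le.1 (hlt k))
  refine hn (memOrliczSobolev_of_tendsto hΦ hAf hv hu (hw.comp hφ.tendsto_atTop)
    (M := (ENNReal.ofReal c₁)⁻¹ * y) ?_ fun k => ?_)
  · exact ENNReal.mul_ne_top (ENNReal.inv_ne_top.2 (ENNReal.ofReal_pos.2 hc₁).ne') hy.ne
  · exact ((hf _).orliczModular_le_fieldEnergy hc₁ A (v k)).trans (by gcongr; exact (hvy k).le)

/-- A diagonal choice: at index `k` take a competitor for the best accuracy `1 / (m + 1)` with `m ≤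
k` that is attainable; this accuracy improves to `0` because each one is eventually attainable. -/
theorem GammaUpper.exists_recovery {L : ℝ≥0∞} (hu : MemOrlicz Φ A u)
    (h : GammaUpper Φ f A u L) :
    ∃ w : ℕ → Euc n → ℝ, (∀ k, MemOrlicz Φ A (w k)) ∧
      Tendsto (fun k => orliczModular Φ A (w k - u)) atTop (𝓝 0) ∧
      limsup (fun k => sobolevEnergy Φ (f k) A (w k)) atTop ≤ L := by
  classical
  let R : ℕ → ℕ → (Euc n → ℝ) → Prop := fun m k w => MemOrlicz Φ A w ∧
    orliczModular Φ A (w - u) ≤ ((m : ℝ≥0∞) + 1)⁻¹ ∧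
    sobolevEnergy Φ (f k) A w ≤ L + ((m : ℝ≥0∞) + 1)⁻¹
  have hR : ∀ m, ∀ᶠ k in atTop, ∃ w, R m k w := fun m => by
    filter_upwards [h ((m : ℝ≥0∞) + 1)⁻¹ (ENNReal.inv_pos.2 (by finiteness))] with k hk
    obtain ⟨w, v, hwv, h1, h2⟩ := hk
    exact ⟨w, hwv.1, h1, (iInf₂_le v hwv).trans h2⟩
  let N : ℕ → ℕ := fun k => Nat.findGreatest (fun m => ∃ w, R m k w) k
  -- `Nat.findGreatest` returns `0` when no `m` works; the default `u` then keeps `w k` in `L_Φ`.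
  let w : ℕ → Euc n → ℝ := fun k => if hk : ∃ w, R (N k) k w then hk.choose else u
  have hw : ∀ m : ℕ, ∀ᶠ k in atTop, orliczModular Φ A (w k - u) ≤ ((m : ℝ≥0∞) + 1)⁻¹ ∧
      sobolevEnergy Φ (f k) A (w k) ≤ L + ((m : ℝ≥0∞) + 1)⁻¹ := fun m => by
    filter_upwards [hR m, eventually_ge_atTop m] with k hk hmk
    have hm : m ≤ N k := Nat.le_findGreatest hmk hk
    have hex : ∃ w, R (N k) k w :=
      Nat.findGreatest_spec (P := fun m => ∃ w, R m k w) hmk hk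
    have hwk : w k = hex.choose := dif_pos hex
    have hle : ((N k : ℝ≥0∞) + 1)⁻¹ ≤ ((m : ℝ≥0∞) + 1)⁻¹ :=
      ENNReal.inv_le_inv.2 (by gcongr)
    rw [hwk]
    exact ⟨hex.choose_spec.2.1.trans hle, hex.choose_spec.2.2.trans (by gcongr)⟩
  have hinv : Tendsto (fun m : ℕ => ((m : ℝ≥0∞) + 1)⁻¹) atTop (𝓝 0) := by
    have := ENNReal.tendsto_inv_nat_nhds_zero.comp (tendsto_add_atTop_nat 1)
    simpa [Function.comp_def] using this
  refine ⟨w, fun k => ?_, ENNReal.tendsto_nhds_zero.2 fun ε hε => ?_, ?_⟩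
  · by_cases hk : ∃ w, R (N k) k w
    · rw [show w k = hk.choose from dif_pos hk]
      exact hk.choose_spec.1
    · rwa [show w k = u from dif_neg hk]
  · obtain ⟨m, hm⟩ := ((ENNReal.tendsto_nhds_zero.1 hinv) ε hε).exists
    exact (hw m).mono fun k hk => hk.1.trans hm
  · have hL : Tendsto (fun m : ℕ => L + ((m : ℝ≥0∞) + 1)⁻¹) atTop (𝓝 L) := by
      simpa using tendsto_const_nhds.add hinv
    exact ge_of_tendsto' hL fun m =>
      limsup_le_of_le (by isBoundedDefault) ((hw m).mono fun k hk => hk.2)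

end SobolevEnergy

theorem EReal.coe_ennreal_liminf (e : ℕ → ℝ≥0∞) :
    ((liminf e atTop : ℝ≥0∞) : EReal) = liminf (fun k => (e k : EReal)) atTop :=
  EReal.coe_ennreal_strictMono.monotone.map_liminf_of_continuousAt e
    continuous_coe_ennreal_ereal.continuousAt

theorem EReal.coe_ennreal_limsup (e : ℕ → ℝ≥0∞) :
    ((limsup e atTop : ℝ≥0∞) : EReal) = limsup (fun k => (e k : EReal)) atTop :=
  EReal.coe_ennreal_strictMono.monotone.map_limsup_of_continuousAt e
    continuous_coe_ennreal_ereal.continuousAt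

theorem proposition4 (n : ℕ) (Φ : ℝ → ℝ) (hΦ : IsYoungFunction Φ)
    (c₁ c₂ : ℝ) (hc₁ : 0 < c₁) (hc₂ : 0 < c₂)
    (F : ℕ → (EuclideanSpace ℝ (Fin n) → ℝ) → Set (EuclideanSpace ℝ (Fin n)) → EReal)
    (hF : ∀ k, F k ∈ convexFunctionalClass n c₁ c₂ Φ) :
    ∃ F₀ ∈ convexFunctionalClass n c₁ c₂ Φ, ∃ j : ℕ → ℕ, StrictMono j ∧
      ∀ Ω : Set (EuclideanSpace ℝ (Fin n)), IsOpen Ω → volume Ω < ⊤ →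
        OrliczGammaConverges Φ Ω (fun k u => F (j k) u Ω) (fun u => F₀ u Ω) := by
  choose f hf hFf using fun k => (mem_convexFunctionalClass_iff hΦ).1 (hF k)
  obtain ⟨j, hj, hcell⟩ := exists_subseq_hasCellLimits hΦ hc₂ hf (TopologicalSpace.denseSeq (Euc n))
  have hfj : ∀ k, IsConvexIntegrand c₁ c₂ Φ (f (j k)) := fun k => hf (j k)
  have hP := TopologicalSpace.denseRange_denseSeq (Euc n)
  let g := limitIntegrand Φ fun k => f (j k)
  refine ⟨fun u A => (sobolevEnergy Φ g A u : EReal), (mem_convexFunctionalClass_iff hΦ).2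
    ⟨g, isConvexIntegrand_limitIntegrand hΦ hc₁ hc₂ hfj, fun _ _ _ _ _ => rfl⟩, j, hj,
    fun A hAo hAf u hu => ⟨fun w hw => ?_, ?_⟩⟩
  · have hmod := (tendsto_luxemburgNorm_iff hΦ _).1 hw.2
    simp only [hFf _ A hAo hAf _ (hw.1 _)]
    rw [← EReal.coe_ennreal_liminf, EReal.coe_ennreal_le_coe_ennreal_iff]
    by_cases hs : MemOrliczSobolev Φ A u
    · obtain ⟨v, hv⟩ := hs
      rw [hv.sobolevEnergy_eq hΦ hAo hAf]
      exact (gammaLower_limitIntegrand hΦ hc₁ hc₂ hfj hP hcell hAo hAf hv).le_liminf hmod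
    · exact le_top.trans_eq (liminf_eq_top_of_not_memOrliczSobolev hΦ hc₁ hfj hAf hu hs hmod).symm
  · by_cases hs : MemOrliczSobolev Φ A u
    · obtain ⟨v, hv⟩ := hs
      obtain ⟨w, hwm, hwu, hle⟩ := (gammaUpper_limitIntegrand hΦ hc₁ hc₂ hfj hP hcell hAo hAf
        hv).exists_recovery hu
      refine ⟨w, ⟨hwm, (tendsto_luxemburgNorm_iff hΦ _).2 hwu⟩, ?_⟩
      simp only [hFf _ A hAo hAf _ (hwm _)]
      rw [← EReal.coe_ennreal_limsup, EReal.coe_ennreal_le_coe_ennreal_iff,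
        hv.sobolevEnergy_eq hΦ hAo hAf]
      exact hle
    · refine ⟨fun _ => u, ⟨fun _ => hu, (tendsto_luxemburgNorm_iff hΦ _).2 ?_⟩, ?_⟩
      · simp [orliczModular, hΦ.map_zero]
      · simp only [sobolevEnergy_eq_top hs, EReal.coe_ennreal_top]
        exact le_top
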